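/- Let $X\subset\mathbb P^M$ be a smooth complex projective variety of (pure) dimension $n\ge 0$; $X$ need not be connected. Then there is an algebraically skew embedding $X\hookrightarrow\mathbb P^{4n+1}$. In other words, the number $$\operatorname{msdim}X:=\min\{N:\text{there exists an algebraically skew embedding }X\hookrightarrow\mathbb P^N\}$$ is well defined and satisfies $\operatorname{msdim}X\le 4n+1$. Here an embedding $X\hookrightarrow\mathbb P^N$ is an isomorphism of $X$ onto a closed subvariety $Y\subset\mathbb P^N$. It is called algebraically skew if (i) $Y$ is skew: for any two distinct points $x,y\in Y$ the embedded tangent spaces $T_{x,Y},T_{y,Y}\subset\mathbb P^N$ are disjoint; and (ii) the length $2$ Terracini locus of $Y$ is empty: with $V=H^0(\mathbb P^N,\mathcal O(1))$, there is no zero-dimensional subscheme $S\subset Y$ of length $2$ with $\dim V(-2S)>\dim V-2n-2$, where $V(-2S)\subset V$ is the space of linear forms vanishing on the subscheme $2S\subset Y$ defined by the square of the ideal of $S$ in $Y$; and (iii) if $n=1$, the third osculating planes of $Y$ are nowhere degenerate: for every $x_0\in Y$ and every local holomorphic lifting $f$ to $\mathbb C^{N+1}$ of a local parametrization of $Y$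 with $[f(0)]=x_0$, the vectors $f(0),f'(0),f''(0),f'''(0)$ are linearly independent. -/

import Mathlib

open MvPolynomial Topology

noncomputable section

namespace SkewEmbedding

/-- Complex projective space `ℙ^N = ℙ(ℂ^{N+1})`. -/
abbrev PSpace (N : ℕ) : Type := Projectivization ℂ (Fin (N + 1) → ℂ)

/-- The polynomial ring `ℂ[x_0, …, x_N]`. -/
abbrev Poly (N : ℕ) : Type := MvPolynomial (Fin (N + 1)) ℂ

/-- The value of `F` at the chosen representative of `p`. For a form `F`, whether it vanishes does
not depend on the representative. -/
def evalAt {N : ℕ} (p : PSpace N) (F : Poly N) : ℂ := eval p.rep F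

/-- `X ⊆ ℙ^N` is a (closed) projective algebraic set: the common zero locus of a set of forms. -/
def IsAlgebraicSet {N : ℕ} (X : Set (PSpace N)) : Prop :=
  ∃ E : Set (Poly N), (∀ F ∈ E, ∃ d, F.IsHomogeneous d) ∧ X = {p | ∀ F ∈ E, evalAt p F = 0}

/-- `X ⊆ ℙ^N` is smooth of pure dimension `n` (Jacobian definition): Zariski-locally around each of
its points, on an open set `G ≠ 0`, it is cut out by `c = N - n` forms whose differentials at the
point are linearly independent. -/
def IsSmoothOfDim {N : ℕ} (n : ℕ) (X : Set (PSpace N)) : Prop :=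
  ∀ p ∈ X, ∃ c : ℕ, n + c = N ∧ ∃ (F : Fin c → Poly N) (G : Poly N),
    (∀ j, ∃ d, (F j).IsHomogeneous d) ∧ (∃ d, G.IsHomogeneous d) ∧ evalAt p G ≠ 0 ∧
    (∀ q : PSpace N, evalAt q G ≠ 0 → (q ∈ X ↔ ∀ j, evalAt q (F j) = 0)) ∧
    LinearIndependent ℂ (fun (j : Fin c) (i : Fin (N + 1)) => evalAt p (pderiv i (F j)))

/-- A smooth projective variety of (pure) dimension `n` in `ℙ^N`, not necessarily connected. -/
structure IsSmoothProjectiveVariety {N : ℕ} (n : ℕ) (X : Set (PSpace N)) : Prop where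
  algebraic : IsAlgebraicSet X
  smooth : IsSmoothOfDim n X

/-- A regular map (morphism of varieties) from `X ⊆ ℙ^M` to `ℙ^N`: around each point it is given by
`N + 1` forms of the same degree. -/
def IsRegularMap {M N : ℕ} {X : Set (PSpace M)} (f : X → PSpace N) : Prop :=
  ∀ p : X, ∃ (d : ℕ) (F : Fin (N + 1) → Poly M), (∀ i, (F i).IsHomogeneous d) ∧
    (fun i => evalAt p.1 (F i)) ≠ 0 ∧
    ∀ (q : X) (hq : (fun i => evalAt q.1 (F i)) ≠ 0),
      f q = Projectivization.mk ℂ (fun i => evalAt q.1 (F i)) hq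

/-- An embedding of `X ⊆ ℙ^M` into `ℙ^N`: an isomorphism of varieties onto a closed subvariety. -/
structure IsEmbeddingOfVarieties {M N : ℕ} {X : Set (PSpace M)} (f : X → PSpace N) : Prop where
  regular : IsRegularMap f
  closed_range : IsAlgebraicSet (Set.range f)
  regular_inverse : ∃ g : Set.range f → PSpace M, IsRegularMap g ∧
    ∀ x : X, g ⟨f x, Set.mem_range_self x⟩ = x.1

/-- The embedded tangent space `T_{p,Y} ⊆ ℙ^N`: the common zero locus of the differentials at `p` of
all forms that vanish on `Y`. -/
def embeddedTangentSpace {N : ℕ} (Y : Set (PSpace N)) (p : PSpace N) : Set (PSpace N) :=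
  {q | ∀ (d : ℕ) (F : Poly N), F.IsHomogeneous d → (∀ y ∈ Y, evalAt y F = 0) →
    ∑ i, evalAt p (pderiv i F) * q.rep i = 0}

/-- `Y` is skew: embedded tangent spaces at distinct points do not meet. -/
def IsSkew {N : ℕ} (Y : Set (PSpace N)) : Prop :=
  ∀ x ∈ Y, ∀ y ∈ Y, x ≠ y → embeddedTangentSpace Y x ∩ embeddedTangentSpace Y y = ∅

/-- The affine open piece `Y ∖ {h = 0}`, for a linear form `h`, realised as the closed subset
`{v | h(v) = 1, [v] ∈ Y}` of `ℂ^{N+1}`. On it a linear form `ℓ` restricts to the function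
`ℓ / h`. -/
def affinePiece {N : ℕ} (Y : Set (PSpace N)) (h : Poly N) : Set (Fin (N + 1) → ℂ) :=
  {v | eval v h = 1 ∧ ∃ hv : v ≠ 0, Projectivization.mk ℂ v hv ∈ Y}

/-- The ideal of all polynomials vanishing on `affinePiece Y h`; the quotient by it is the affine
coordinate ring of `Y ∖ {h = 0}`. -/
def affineIdeal {N : ℕ} (Y : Set (PSpace N)) (h : Poly N) : Ideal (Poly N) :=
  vanishingIdeal ℂ (affinePiece Y h)

/-- A zero-dimensional closed subscheme `S` of length `2` of `Y`. A finite subscheme misses some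
hyperplane `h = 0`, so it is an ideal of colength `2` in the affine coordinate ring of
`Y ∖ {h = 0}`, that is, an ideal of the polynomial ring containing `affineIdeal Y h`. -/
structure LengthTwoSubscheme {N : ℕ} (Y : Set (PSpace N)) where
  /-- the linear form whose zero hyperplane is missed -/
  h : Poly N
  isHomogeneous_h : h.IsHomogeneous 1
  /-- the ideal of the subscheme -/
  ideal : Ideal (Poly N)
  le_ideal : affineIdeal Y h ≤ ideal
  length_eq : Module.finrank ℂ (Poly N ⧸ ideal) = 2

/-- `V = H⁰(ℙ^N, 𝒪(1))`, the space of linear forms. -/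
abbrev linearForms (N : ℕ) : Submodule ℂ (Poly N) := homogeneousSubmodule (Fin (N + 1)) ℂ 1

/-- `V(-2S)`: the linear forms vanishing on the subscheme `2S` of `Y`, which is defined by the
square of the ideal of `S` in `Y`. -/
def linearFormsVanishingOnDouble {N : ℕ} {Y : Set (PSpace N)} (S : LengthTwoSubscheme Y) :
    Submodule ℂ (Poly N) :=
  linearForms N ⊓ (S.ideal ^ 2 ⊔ affineIdeal Y S.h).restrictScalars ℂ

/-- The length `2` Terracini locus of an `n`-dimensional `Y ⊆ ℙ^N`: the length `2` subschemes `S`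
with `dim V(-2S) > dim V - 2n - 2`. -/
def terraciniLocus {N : ℕ} (n : ℕ) (Y : Set (PSpace N)) : Set (LengthTwoSubscheme Y) :=
  {S | Module.finrank ℂ (linearForms N) <
    Module.finrank ℂ (linearFormsVanishingOnDouble S) + (2 * n + 2)}

/-- For a curve `Y`: the third osculating planes are nowhere degenerate. Here `f` is a local lifting
to `ℂ^{N+1}` of a local holomorphic parametrisation of `Y`. -/
def HasNondegenerateOsculatingPlanes {N : ℕ} (Y : Set (PSpace N)) : Prop :=
  ∀ f : ℂ → (Fin (N + 1) → ℂ), AnalyticAt ℂ f 0 →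
    (∀ᶠ z in 𝓝 (0 : ℂ), ∃ hz : f z ≠ 0, Projectivization.mk ℂ (f z) hz ∈ Y) →
    LinearIndependent ℂ ![f 0, deriv f 0] →
    LinearIndependent ℂ ![f 0, deriv f 0, iteratedDeriv 2 f 0, iteratedDeriv 3 f 0]

/-- An `n`-dimensional smooth `Y ⊆ ℙ^N` is algebraically skew: it is skew and its length `2`
Terracini locus is empty. For curves the definition is by osculating planes, so that form of the
infinitesimal condition is recorded as well. -/
structure IsAlgebraicallySkew {N : ℕ} (n : ℕ) (Y : Set (PSpace N)) : Prop where
  skew : IsSkew Y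
  terracini : terraciniLocus n Y = ∅
  osculating : n = 1 → HasNondegenerateOsculatingPlanes Y

/-- The `n`-dimensional `X` has an algebraically skew embedding into `ℙ^N`. -/
def HasAlgebraicallySkewEmbedding {M : ℕ} (n : ℕ) (X : Set (PSpace M)) (N : ℕ) : Prop :=
  ∃ f : X → PSpace N, IsEmbeddingOfVarieties f ∧ IsAlgebraicallySkew n (Set.range f)

/-- The minimal algebraically skew embedding dimension of the `n`-dimensional `X`. -/
def msdim {M : ℕ} (n : ℕ) (X : Set (PSpace M)) : ℕ :=
  sInf {N | HasAlgebraicallySkewEmbedding n X N}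

end SkewEmbedding

end

/-! Re-embed `X` by all cubics. For a length 2 subscheme `S` of `X`, cubics separate the functions
on `2S`, so `2S` spans a linear space of dimension `2n + 2` in the affine space of the Veronese
cone. Such `S` move in a family of dimension `2n`, so the union of the spans, `doubleSpans`, is a
cone of dimension at most `4n + 2`. Some linear map to `ℂ^(4n+2)` kills no nonzero vector of this
cone, hence is injective on every single span. This contains all that is needed: the projection is
injective and unramified, tangent spaces at distinct points stay disjoint, doubles impose
independent conditions, and osculating planes stay nondegenerate.

The dimension count is analytic. Smoothness provides countably many holomorphic charts
(`IsSmoothOfDim.exists_countable_charts`). The span of `2S` consists of vectors of derivatives: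
`jet₁` at each of two points, or `jet u` along a tangent vector `u`. Cubics separate them by
`Chart.eq_zero_of_jet₁_add_jet₁_eq_zero` and `Chart.eq_zero_of_jet_eq_zero`. Hausdorff dimension
bounds the union (`dimH_doubleSpans_le`), and `exists_linearMap_of_dimH_le` finds the linear map by
projecting from one missed line at a time.

That the result is an isomorphism of varieties is algebra on affine cones. Forms without a common
zero make the coordinate ring finite (`coordHom_finite`). Nakayama's lemma then shows that the image
is closed (`IsClosedCone.image`) and that an injective unramified linear projection has an inverse
given locally by forms (`hasLocalInverse_of_isHomogeneous_one`). `exists_genericForms` combines both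
sides; the defining conditions are then read off from its output. -/

noncomputable section

/-! ### Cones, differentials of polynomials and Zariski tangent spaces -/

namespace SkewEmbedding

variable {σ τ : Type*}

/-- The restriction of a polynomial to the line through the origin spanned by `v`. -/
def line (P : MvPolynomial σ ℂ) (v : σ → ℂ) : Polynomial ℂ :=
  aeval (fun i => Polynomial.C (v i) * Polynomial.X) P

lemma eval_line (P : MvPolynomial σ ℂ) (v : σ → ℂ) (c : ℂ) :
    (line P v).eval c = eval (c • v) P := by
  unfold line
  induction P using MvPolynomial.induction_on with
  | C a => simp
  | add p q hp hq => simp [hp, hq]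
  | mul_X p i hp =>
    simp only [map_mul, aeval_X, Polynomial.eval_mul, Polynomial.eval_C, Polynomial.eval_X, hp,
      eval_X, Pi.smul_apply, smul_eq_mul, mul_comm c]

/-- Restricting to a line turns the grading into powers of one variable. An identity known at all
nonzero multiples of `v` can therefore be compared degree by degree. -/
lemma coeff_line (P : MvPolynomial σ ℂ) (v : σ → ℂ) (k : ℕ) :
    (line P v).coeff k = eval v (homogeneousComponent k P) := by
  induction P using MvPolynomial.induction_on' with
  | add p q hp hq =>
    have : line (p + q) v = line p v + line q v := by simp [line]
    rw [this, Polynomial.coeff_add, hp, hq, map_add, map_add]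
  | monomial u a =>
    have h : line (monomial u a) v =
        Polynomial.C (eval v (monomial u a)) * Polynomial.X ^ u.degree := by
      simp only [line, aeval_monomial, eval_monomial, mul_pow, Finsupp.prod_mul, map_mul,
        Finsupp.degree_apply]
      rw [mul_assoc]
      congr 1
      simp only [Finsupp.prod, map_prod, map_pow, Finset.prod_pow_eq_pow_sum]
    rw [h, Polynomial.coeff_C_mul, Polynomial.coeff_X_pow,
      homogeneousComponent_of_mem (isHomogeneous_monomial a rfl)]
    split_ifs <;> simp

lemma line_eq_of_isHomogeneous {P : MvPolynomial σ ℂ} {d : ℕ} (hP : P.IsHomogeneous d)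
    (v : σ → ℂ) : line P v = Polynomial.C (eval v P) * Polynomial.X ^ d := by
  ext k
  rw [coeff_line, homogeneousComponent_of_mem hP, Polynomial.coeff_C_mul, Polynomial.coeff_X_pow]
  split_ifs <;> simp

lemma eval_smul_of_isHomogeneous {P : MvPolynomial σ ℂ} {d : ℕ} (hP : P.IsHomogeneous d)
    (c : ℂ) (v : σ → ℂ) : eval (c • v) P = c ^ d * eval v P := by
  rw [← eval_line, line_eq_of_isHomogeneous hP, Polynomial.eval_mul, Polynomial.eval_C,
    Polynomial.eval_pow, Polynomial.eval_X, mul_comm]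

lemma polynomial_eq_of_eval_eq_of_ne_zero {p q : Polynomial ℂ}
    (h : ∀ c : ℂ, c ≠ 0 → p.eval c = q.eval c) : p = q :=
  Polynomial.eq_of_infinite_eval_eq p q <|
    (Set.finite_singleton (0 : ℂ)).infinite_compl.mono fun c hc => h c hc

/-- A closed algebraic cone in `ℂ^σ` without its vertex. -/
structure IsClosedCone (S : Set (σ → ℂ)) : Prop where
  zero_notMem : (0 : σ → ℂ) ∉ S
  smul_mem : ∀ v ∈ S, ∀ c : ℂ, c ≠ 0 → c • v ∈ S
  mem_of_vanishing : ∀ v : σ → ℂ, v ≠ 0 → (∀ P ∈ vanishingIdeal ℂ S, eval v P = 0) → v ∈ S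

lemma mem_vanishingIdeal {S : Set (σ → ℂ)} {P : MvPolynomial σ ℂ} :
    P ∈ vanishingIdeal ℂ S ↔ ∀ v ∈ S, eval v P = 0 := by
  simp [mem_vanishingIdeal_iff, aeval_eq_eval]

/-- A polynomial vanishing on `S` vanishes at all nonzero points of each line of the cone, so its
restriction to the line is the zero polynomial, coefficient by coefficient. -/
lemma homogeneousComponent_mem_vanishingIdeal {S : Set (σ → ℂ)}
    (hS : ∀ v ∈ S, ∀ c : ℂ, c ≠ 0 → c • v ∈ S) {P : MvPolynomial σ ℂ}
    (hP : P ∈ vanishingIdeal ℂ S) (k : ℕ) : homogeneousComponent k P ∈ vanishingIdeal ℂ S := by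
  rw [mem_vanishingIdeal] at hP ⊢
  intro v hv
  have : line P v = 0 := polynomial_eq_of_eval_eq_of_ne_zero fun c hc => by
    rw [eval_line, hP _ (hS v hv c hc), Polynomial.eval_zero]
  rw [← coeff_line, this, Polynomial.coeff_zero]

lemma eval_zero_of_mem_vanishingIdeal {S : Set (σ → ℂ)}
    (hS : ∀ v ∈ S, ∀ c : ℂ, c ≠ 0 → c • v ∈ S) (hne : S.Nonempty) {P : MvPolynomial σ ℂ}
    (hP : P ∈ vanishingIdeal ℂ S) : eval 0 P = 0 := by
  obtain ⟨v, hv⟩ := hne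
  have h := mem_vanishingIdeal.1 (homogeneousComponent_mem_vanishingIdeal hS hP 0) v hv
  rw [← coeff_line, Polynomial.coeff_zero_eq_eval_zero, eval_line, zero_smul] at h
  exact h

lemma eval_bind₁ (G : σ → MvPolynomial τ ℂ) (P : MvPolynomial σ ℂ) (w : τ → ℂ) :
    eval w (bind₁ G P) = eval (fun i => eval w (G i)) P := by
  induction P using MvPolynomial.induction_on with
  | C a => simp
  | add p q hp hq => simp [hp, hq]
  | mul_X p i hp => simp [hp]

/-- The differential of `P` at `v`, applied to `t`. -/
def dd [Fintype σ] (P : MvPolynomial σ ℂ) (v t : σ → ℂ) : ℂ := ∑ i, eval v (pderiv i P) * t i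

section dd
variable [Fintype σ] [Fintype τ]

@[simp] lemma dd_C (a : ℂ) (v t : σ → ℂ) : dd (C a) v t = 0 := by simp [dd]

@[simp] lemma dd_X (i : σ) (v t : σ → ℂ) : dd (X i) v t = t i := by
  classical
  simp [dd, pderiv_X, Pi.single_apply, apply_ite (eval v)]

@[simp] lemma dd_zero_left (v t : σ → ℂ) : dd 0 v t = 0 := by simp [dd]

@[simp] lemma dd_add (P Q : MvPolynomial σ ℂ) (v t : σ → ℂ) :
    dd (P + Q) v t = dd P v t + dd Q v t := by
  simp [dd, add_mul, Finset.sum_add_distrib]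

@[simp] lemma dd_neg (P : MvPolynomial σ ℂ) (v t : σ → ℂ) : dd (-P) v t = - dd P v t := by
  simp [dd]

@[simp] lemma dd_sub (P Q : MvPolynomial σ ℂ) (v t : σ → ℂ) :
    dd (P - Q) v t = dd P v t - dd Q v t := by
  simp [sub_eq_add_neg]

@[simp] lemma dd_sum {ι : Type*} (s : Finset ι) (P : ι → MvPolynomial σ ℂ) (v t : σ → ℂ) :
    dd (∑ i ∈ s, P i) v t = ∑ i ∈ s, dd (P i) v t := by
  classical
  induction s using Finset.induction_on with
  | empty => simp
  | insert a s ha ih => simp [Finset.sum_insert ha, ih]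

@[simp] lemma dd_mul (P Q : MvPolynomial σ ℂ) (v t : σ → ℂ) :
    dd (P * Q) v t = eval v P * dd Q v t + eval v Q * dd P v t := by
  simp only [dd, Derivation.leibniz, smul_eq_mul, map_add, map_mul, add_mul,
    Finset.sum_add_distrib, Finset.mul_sum, mul_assoc]

lemma dd_add_right (P : MvPolynomial σ ℂ) (v t t' : σ → ℂ) :
    dd P v (t + t') = dd P v t + dd P v t' := by
  simp [dd, mul_add, Finset.sum_add_distrib]

lemma dd_smul_right (P : MvPolynomial σ ℂ) (v : σ → ℂ) (c : ℂ) (t : σ → ℂ) :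
    dd P v (c • t) = c * dd P v t := by
  simp only [dd, Pi.smul_apply, smul_eq_mul, Finset.mul_sum]
  exact Finset.sum_congr rfl fun i _ => by ring

/-- The differential as a linear form. -/
def ddLinear (P : MvPolynomial σ ℂ) (v : σ → ℂ) : (σ → ℂ) →ₗ[ℂ] ℂ where
  toFun := dd P v
  map_add' := dd_add_right P v
  map_smul' := dd_smul_right P v

@[simp] lemma ddLinear_apply (P : MvPolynomial σ ℂ) (v t : σ → ℂ) : ddLinear P v t = dd P v t := rfl

lemma dd_bind₁ (G : σ → MvPolynomial τ ℂ) (P : MvPolynomial σ ℂ) (w t : τ → ℂ) :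
    dd (bind₁ G P) w t = dd P (fun i => eval w (G i)) (fun i => dd (G i) w t) := by
  induction P using MvPolynomial.induction_on with
  | C a => simp
  | add p q hp hq => simp [hp, hq]
  | mul_X p i hp => simp [hp, eval_bind₁]

lemma hasFDerivAt_eval (P : MvPolynomial σ ℂ) (v : σ → ℂ) :
    HasFDerivAt (fun x => eval x P) (LinearMap.toContinuousLinearMap (ddLinear P v)) v := by
  induction P using MvPolynomial.induction_on with
  | C a =>
    simp only [eval_C]
    exact (hasFDerivAt_const (𝕜 := ℂ) a v).congr_fderiv (by ext t; simp)
  | add p q hp hq =>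
    simp only [map_add]
    exact (hp.fun_add hq).congr_fderiv (by ext t; simp)
  | mul_X p i hp =>
    simp only [map_mul, eval_X]
    exact (hp.fun_mul (hasFDerivAt_apply (𝕜 := ℂ) i v)).congr_fderiv (by ext t; simp)

lemma analyticAt_eval (P : MvPolynomial σ ℂ) (v : σ → ℂ) :
    AnalyticAt ℂ (fun x : σ → ℂ => eval x P) v := by
  induction P using MvPolynomial.induction_on with
  | C a => simpa using analyticAt_const
  | add p q hp hq =>
    simp only [map_add]
    exact hp.fun_add hq
  | mul_X p i hp =>
    simp only [map_mul, eval_X]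
    exact hp.fun_mul
      ((ContinuousLinearMap.proj (R := ℂ) (φ := fun _ : σ => ℂ) i).analyticAt v)

lemma dd_smul_left_of_isHomogeneous {P : MvPolynomial σ ℂ} {d : ℕ} (hP : P.IsHomogeneous d)
    (c : ℂ) (v t : σ → ℂ) : dd P (c • v) t = c ^ (d - 1) * dd P v t := by
  simp only [dd, Finset.mul_sum]
  exact Finset.sum_congr rfl fun i _ => by
    rw [eval_smul_of_isHomogeneous hP.pderiv, mul_assoc]

/-- Euler's identity. -/
lemma dd_self_of_isHomogeneous {P : MvPolynomial σ ℂ} {d : ℕ} (hP : P.IsHomogeneous d)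
    (v : σ → ℂ) : dd P v v = d * eval v P := by
  -- The function `c ↦ P(c v) = c ^ d * P(v)` is differentiated at `1` in two ways.
  have h1 : HasDerivAt (fun c : ℂ => eval (c • v) P) (dd P v v) 1 := by
    have h2 := hasFDerivAt_eval P ((1 : ℂ) • v)
    have h3 : HasDerivAt (fun c : ℂ => c • v) v 1 := by
      simpa using (hasDerivAt_id (1 : ℂ)).smul_const v
    have h5 : HasDerivAt (fun c : ℂ => eval (c • v) P)
        (LinearMap.toContinuousLinearMap (ddLinear P ((1 : ℂ) • v)) v) 1 :=
      HasFDerivAt.comp_hasDerivAt (l := fun x => eval x P) (1 : ℂ) h2 h3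
    simpa using h5
  have h4 : HasDerivAt (fun c : ℂ => eval (c • v) P) (d * eval v P) 1 := by
    simp only [eval_smul_of_isHomogeneous hP]
    simpa using (hasDerivAt_pow d (1 : ℂ)).mul_const (eval v P)
  exact h1.unique h4

end dd

/-- The Zariski tangent space at `v` of the closed cone `S`. -/
def zt [Fintype σ] (S : Set (σ → ℂ)) (v : σ → ℂ) : Submodule ℂ (σ → ℂ) where
  carrier := {t | ∀ P ∈ vanishingIdeal ℂ S, dd P v t = 0}
  add_mem' ha hb P hP := by rw [dd_add_right, ha P hP, hb P hP, add_zero]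
  zero_mem' P _ := by simp [dd]
  smul_mem' c t ht P hP := by rw [dd_smul_right, ht P hP, mul_zero]

lemma mem_zt [Fintype σ] {S : Set (σ → ℂ)} {v t : σ → ℂ} :
    t ∈ zt S v ↔ ∀ P ∈ vanishingIdeal ℂ S, dd P v t = 0 := Iff.rfl

/-- The vanishing ideal of a cone is graded, so forms suffice to test tangency. This matches the
definition of the embedded tangent space, which only uses forms. -/
lemma mem_zt_iff_isHomogeneous [Fintype σ] {S : Set (σ → ℂ)}
    (hS : ∀ v ∈ S, ∀ c : ℂ, c ≠ 0 → c • v ∈ S) {v t : σ → ℂ} :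
    t ∈ zt S v ↔ ∀ (d : ℕ) (P : MvPolynomial σ ℂ), P.IsHomogeneous d →
      (∀ x ∈ S, eval x P = 0) → dd P v t = 0 := by
  refine ⟨fun h d P _ hP => h P (mem_vanishingIdeal.2 hP), fun h P hP => ?_⟩
  rw [← sum_homogeneousComponent P, dd_sum]
  exact Finset.sum_eq_zero fun k _ => h k _ (homogeneousComponent_isHomogeneous k P)
    (mem_vanishingIdeal.1 (homogeneousComponent_mem_vanishingIdeal hS hP k))

lemma zt_smul [Fintype σ] {S : Set (σ → ℂ)} (hS : ∀ v ∈ S, ∀ c : ℂ, c ≠ 0 → c • v ∈ S)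
    (v : σ → ℂ) {c : ℂ} (hc : c ≠ 0) : zt S (c • v) = zt S v := by
  ext t
  simp only [mem_zt_iff_isHomogeneous hS]
  refine forall₄_congr fun d P hP _ => ?_
  rw [dd_smul_left_of_isHomogeneous hP]
  simp [hc]

end SkewEmbedding

end

/-! ### Nakayama's lemma and finiteness of coordinate rings of cones -/

noncomputable section

namespace SkewEmbedding

/-- Nakayama's lemma for a finite module that is generated by `N` modulo an ideal. -/
lemma exists_smul_mem_of_finite {R B : Type*} [CommRing R] [AddCommGroup B] [Module R B]
    [Module.Finite R B] (m : Ideal R) (N : Submodule R B)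
    (h : ∀ b : B, ∃ a ∈ N, b - a ∈ (m • ⊤ : Submodule R B)) :
    ∃ r : R, r - 1 ∈ m ∧ ∀ b : B, r • b ∈ N := by
  have hle : (⊤ : Submodule R (B ⧸ N)) ≤ m • ⊤ := by
    rintro x -
    obtain ⟨b, rfl⟩ := N.mkQ_surjective x
    obtain ⟨a, ha, hb⟩ := h b
    have h1 : N.mkQ b = N.mkQ (b - a) := by
      rw [map_sub, N.mkQ_apply a, (Submodule.Quotient.mk_eq_zero N).2 ha, sub_zero]
    rw [h1, ← LinearMap.range_eq_top.2 N.mkQ_surjective, LinearMap.range_eq_map,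
      ← Submodule.map_smul'']
    exact Submodule.mem_map_of_mem hb
  obtain ⟨r, hr, hr'⟩ := Submodule.exists_sub_one_mem_and_smul_eq_zero_of_fg_of_le_smul m ⊤
    Module.Finite.fg_top hle
  refine ⟨r, hr, fun b => ?_⟩
  have := hr' (N.mkQ b) trivial
  rwa [← map_smul, N.mkQ_apply, Submodule.Quotient.mk_eq_zero] at this

/-- The hypothesis says that the fibre over `m` is empty; Nakayama with zero submodule then gives a
function that is `1` at the point and pulls back to zero. -/
lemma RingHom.Finite.exists_mul_eq_zero {R B : Type*} [CommRing R] [CommRing B] {φ : R →+* B}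
    (hφ : φ.Finite) (m : Ideal R) (h : m.map φ = ⊤) : ∃ r : R, r - 1 ∈ m ∧ φ r = 0 := by
  let _ := φ.toAlgebra
  have : Module.Finite R B := hφ
  obtain ⟨r, hr, hr'⟩ := exists_smul_mem_of_finite m (⊥ : Submodule R B) fun b =>
    ⟨0, zero_mem _, by
      rw [Ideal.smul_top_eq_map, RingHom.algebraMap_toAlgebra, h]; trivial⟩
  refine ⟨r, hr, ?_⟩
  have := hr' 1
  rwa [Algebra.smul_def, mul_one, Submodule.mem_bot, RingHom.algebraMap_toAlgebra] at this

/-- The hypothesis says that `φ` is surjective on the fibre over `m`; by Nakayama it becomes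
surjective after inverting one function that is `1` at the point. -/
lemma RingHom.Finite.exists_mul_mem_range {R B : Type*} [CommRing R] [CommRing B] {φ : R →+* B}
    (hφ : φ.Finite) (m : Ideal R) (h : ∀ b, ∃ a, b - φ a ∈ m.map φ) :
    ∃ r : R, r - 1 ∈ m ∧ ∀ b, ∃ a, φ r * b = φ a := by
  let _ := φ.toAlgebra
  have : Module.Finite R B := hφ
  obtain ⟨r, hr, hr'⟩ := exists_smul_mem_of_finite m
    (LinearMap.range (Algebra.linearMap R B)) fun b => by
      obtain ⟨a, ha⟩ := h b
      refine ⟨φ a, ⟨a, rfl⟩, ?_⟩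
      rw [Ideal.smul_top_eq_map, RingHom.algebraMap_toAlgebra]
      exact ha
  refine ⟨r, hr, fun b => ?_⟩
  obtain ⟨a, ha⟩ := hr' b
  refine ⟨a, ?_⟩
  rw [Algebra.smul_def] at ha
  exact ha.symm

lemma RingHom.Finite.of_forall_mem {R B : Type*} [CommRing R] [CommRing B] {φ : R →+* B}
    {T : Set B} (hT : T.Finite) (h : ∀ K : AddSubmonoid B, T ⊆ K →
      (∀ r, ∀ b ∈ K, φ r * b ∈ K) → ∀ b, b ∈ K) : φ.Finite := by
  let _ := φ.toAlgebra
  have : Submodule.span R T = ⊤ := eq_top_iff.2 fun b _ =>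
    h (Submodule.span R T).toAddSubmonoid Submodule.subset_span
      (fun r _ hb => (Submodule.span R T).smul_mem r hb) b
  exact (⟨this ▸ Submodule.fg_span hT⟩ : Module.Finite R B)

variable {σ τ : Type*}

/-- Along a line of the cone the generators contribute `F j (v) * t ^ d`, so comparing the
coefficients of `t ^ D` keeps only the components of degree `D - d` of the multipliers. -/
lemma exists_isHomogeneous_combination [Fintype τ] {S : Set (σ → ℂ)}
    (hS : ∀ v ∈ S, ∀ c : ℂ, c ≠ 0 → c • v ∈ S) {F : τ → MvPolynomial σ ℂ} {d D : ℕ}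
    (hF : ∀ j, (F j).IsHomogeneous d) (hdD : d ≤ D) {P : MvPolynomial σ ℂ}
    (hP : P.IsHomogeneous D) (hPI : P ∈ vanishingIdeal ℂ S ⊔ Ideal.span (Set.range F)) :
    ∃ c : τ → MvPolynomial σ ℂ, (∀ j, (c j).IsHomogeneous (D - d)) ∧
      P - ∑ j, c j * F j ∈ vanishingIdeal ℂ S := by
  obtain ⟨Q, hQ, R, hR, rfl⟩ := Submodule.mem_sup.1 hPI
  obtain ⟨c, rfl⟩ := (Ideal.mem_span_range_iff_exists_fun).1 hR
  refine ⟨fun j => homogeneousComponent (D - d) (c j),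
    fun j => homogeneousComponent_isHomogeneous _ _, ?_⟩
  rw [mem_vanishingIdeal] at hQ ⊢
  intro v hv
  have h : line (Q + ∑ j, c j * F j) v =
      (∑ j, line (c j) v * Polynomial.C (eval v (F j))) * Polynomial.X ^ d := by
    refine polynomial_eq_of_eval_eq_of_ne_zero fun a ha => ?_
    rw [eval_line, map_add, hQ _ (hS v hv a ha), zero_add, map_sum]
    simp only [map_mul, Polynomial.eval_mul, Polynomial.eval_finsetSum, Polynomial.eval_C,
      Polynomial.eval_pow, Polynomial.eval_X, eval_line, Finset.sum_mul,
      eval_smul_of_isHomogeneous (hF _)]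
    exact Finset.sum_congr rfl fun j _ => by rw [mul_assoc, mul_comm (a ^ d)]
  have h2 := congrArg (fun p => p.coeff D) h
  rw [line_eq_of_isHomogeneous hP, Polynomial.coeff_C_mul, Polynomial.coeff_X_pow, if_pos rfl,
    mul_one, Polynomial.coeff_mul_X_pow', if_pos hdD] at h2
  rw [map_sub, h2, Polynomial.finsetSum_coeff, map_sum]
  simp only [Polynomial.coeff_mul_C, coeff_line, map_mul, sub_self]

/-- The homomorphism of coordinate rings given by a tuple of forms on a cone. -/
def coordHom (S : Set (σ → ℂ)) (F : τ → MvPolynomial σ ℂ) :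
    MvPolynomial τ ℂ →+* MvPolynomial σ ℂ ⧸ vanishingIdeal ℂ S :=
  (Ideal.Quotient.mk _).comp (bind₁ F : MvPolynomial τ ℂ →ₐ[ℂ] MvPolynomial σ ℂ).toRingHom

lemma coordHom_apply (S : Set (σ → ℂ)) (F : τ → MvPolynomial σ ℂ) (P : MvPolynomial τ ℂ) :
    coordHom S F P = Ideal.Quotient.mk (vanishingIdeal ℂ S) (bind₁ F P) := rfl

/-- Forms of equal positive degree without a common zero on a closed cone make its coordinate ring
a finite algebra. -/
lemma coordHom_finite [Fintype σ] [Fintype τ] {S : Set (σ → ℂ)} (hS : IsClosedCone S)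
    {F : τ → MvPolynomial σ ℂ} {d : ℕ} (hd : 0 < d) (hF : ∀ j, (F j).IsHomogeneous d)
    (hne : ∀ v ∈ S, ∃ j, eval v (F j) ≠ 0) : (coordHom S F).Finite := by
  set I := vanishingIdeal ℂ S with hI
  set J := I ⊔ Ideal.span (Set.range F) with hJ
  -- Nullstellensatz: a nonzero common zero of `J` would be a point of the cone where all `F j`
  -- vanish.
  have hrad : idealOfVars σ ℂ ≤ J.radical := by
    rw [idealOfVars, Ideal.span_le, ← vanishingIdeal_zeroLocus_eq_radical (K := ℂ) J]
    rintro _ ⟨i, rfl⟩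
    rw [SetLike.mem_coe, mem_vanishingIdeal]
    intro v hv
    rw [mem_zeroLocus_iff] at hv
    suffices v = 0 by simp [this]
    by_contra hv0
    have hvS : v ∈ S := hS.mem_of_vanishing v hv0 fun P hP => by
      simpa [aeval_eq_eval] using hv P (Ideal.mem_sup_left hP)
    obtain ⟨j, hj⟩ := hne v hvS
    have := hv (F j) (Ideal.mem_sup_right (Ideal.subset_span ⟨j, rfl⟩))
    exact hj (by simpa [aeval_eq_eval] using this)
  obtain ⟨k, hk⟩ := Ideal.exists_pow_le_of_le_radical_of_fg hrad (idealOfVars_fg σ ℂ)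
  choose T hT using fun e : ℕ => (homogeneousSubmodule_fg σ ℂ e)
  -- Forms of degree below `k + d` generate. A form of degree `D ≥ k + d` lies in `J`, so modulo `I`
  -- it is a combination of the `F j` with coefficients of the smaller degree `D - d`.
  refine RingHom.Finite.of_forall_mem
    (T := ⋃ e ∈ Finset.range (k + d), Ideal.Quotient.mk I '' (T e : Set _))
    (Set.Finite.biUnion (Finset.finite_toSet _) fun e _ => (T e).finite_toSet.image _)
    fun N hTN hsmul => ?_
  have hhom : ∀ (D : ℕ) (P : MvPolynomial σ ℂ), P.IsHomogeneous D → Ideal.Quotient.mk I P ∈ N := by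
    intro D
    induction D using Nat.strong_induction_on with
    | _ D ih =>
      intro P hP
      by_cases hD : D < k + d
      · have hP' : P ∈ Submodule.span ℂ (T D : Set (MvPolynomial σ ℂ)) := by
          rw [hT]; exact hP
        induction hP' using Submodule.span_induction with
        | mem x hx =>
          exact hTN (Set.mem_biUnion (by simpa using hD) ⟨x, hx, rfl⟩)
        | zero => simp
        | add x y hx hy h1 h2 =>
          rw [map_add]
          rw [hT] at hx hy
          exact add_mem (h1 hx) (h2 hy)
        | smul a x hx h1 =>
          rw [hT] at hx
          have : Ideal.Quotient.mk I (a • x) = coordHom S F (C a) * Ideal.Quotient.mk I x := by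
            rw [coordHom_apply, bind₁_C_right,
              ← map_mul, C_mul']
          rw [this]
          exact hsmul _ _ (h1 hx)
      · push Not at hD
        have hPJ : P ∈ J := hk ((mem_pow_idealOfVars_iff k P).2 fun x hx => by
          by_contra hlt
          exact mem_support_iff.1 hx (hP.coeff_eq_zero (by omega)))
        obtain ⟨c, hc, hcP⟩ := exists_isHomogeneous_combination hS.smul_mem hF (by omega) hP hPJ
        rw [← Ideal.Quotient.eq] at hcP
        rw [hcP, map_sum]
        refine sum_mem fun j _ => ?_
        have : Ideal.Quotient.mk I (c j * F j) =
            coordHom S F (X j) * Ideal.Quotient.mk I (c j) := by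
          rw [coordHom_apply, bind₁_X_right,
            ← map_mul, mul_comm]
        rw [this]
        exact hsmul _ _ (ih _ (by omega) _ (hc j))
  intro x
  obtain ⟨P, rfl⟩ := Ideal.Quotient.mk_surjective x
  rw [← sum_homogeneousComponent P, map_sum]
  exact sum_mem fun e _ => hhom e _ (homogeneousComponent_isHomogeneous e P)

end SkewEmbedding

end

/-! ### Images of closed cones and their tangent spaces -/

noncomputable section

namespace SkewEmbedding

variable {σ τ : Type*}

/-- The map of affine spaces given by a tuple of polynomials. -/
def evalMap (F : τ → MvPolynomial σ ℂ) (v : σ → ℂ) : τ → ℂ := fun j => eval v (F j)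

lemma evalMap_smul {F : τ → MvPolynomial σ ℂ} {d : ℕ} (hF : ∀ j, (F j).IsHomogeneous d) (c : ℂ)
    (v : σ → ℂ) : evalMap F (c • v) = c ^ d • evalMap F v := by
  ext j; simp [evalMap, eval_smul_of_isHomogeneous (hF j)]

/-- A scalar on the target is absorbed by a `d`-th root of it on the source. -/
lemma smul_mem_image_evalMap {S : Set (σ → ℂ)} (hS : ∀ v ∈ S, ∀ c : ℂ, c ≠ 0 → c • v ∈ S)
    {F : τ → MvPolynomial σ ℂ} {d : ℕ} (hd : 0 < d) (hF : ∀ j, (F j).IsHomogeneous d) :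
    ∀ w ∈ evalMap F '' S, ∀ c : ℂ, c ≠ 0 → c • w ∈ evalMap F '' S := by
  rintro _ ⟨v, hv, rfl⟩ c hc
  obtain ⟨a, ha⟩ := IsAlgClosed.exists_pow_nat_eq c hd
  have ha0 : a ≠ 0 := by rintro rfl; exact hc (by rw [← ha, zero_pow hd.ne'])
  exact ⟨a • v, hS v hv a ha0, by rw [evalMap_smul hF, ha]⟩

lemma eq_top_of_forall_exists_eval_ne_zero [Finite σ] {J : Ideal (MvPolynomial σ ℂ)}
    (h : ∀ v : σ → ℂ, ∃ P ∈ J, eval v P ≠ 0) : J = ⊤ := by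
  rw [← Ideal.radical_eq_top, ← vanishingIdeal_zeroLocus_eq_radical (K := ℂ) J, eq_top_iff]
  intro P _
  rw [mem_vanishingIdeal]
  intro v hv
  obtain ⟨Q, hQ, hQ'⟩ := h v
  exact absurd (by simpa [aeval_eq_eval] using mem_zeroLocus_iff.1 hv Q hQ) hQ'

/-- The maximal ideal of a point. -/
def pointIdeal (w : σ → ℂ) : Ideal (MvPolynomial σ ℂ) := RingHom.ker (eval w)

lemma mem_pointIdeal {w : σ → ℂ} {P : MvPolynomial σ ℂ} : P ∈ pointIdeal w ↔ eval w P = 0 :=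
  RingHom.mem_ker

lemma map_coordHom_pointIdeal [Fintype τ] (S : Set (σ → ℂ)) (F : τ → MvPolynomial σ ℂ)
    (w : τ → ℂ) {P : MvPolynomial σ ℂ}
    (hP : P ∈ vanishingIdeal ℂ S ⊔ Ideal.span (Set.range fun j => F j - C (w j))) :
    Ideal.Quotient.mk (vanishingIdeal ℂ S) P ∈ (pointIdeal w).map (coordHom S F) := by
  obtain ⟨Q, hQ, R, hR, rfl⟩ := Submodule.mem_sup.1 hP
  obtain ⟨c, rfl⟩ := (Ideal.mem_span_range_iff_exists_fun).1 hR
  rw [map_add, Ideal.Quotient.eq_zero_iff_mem.2 hQ, zero_add, map_sum]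
  refine sum_mem fun j _ => ?_
  rw [map_mul]
  refine Ideal.mul_mem_left _ _ ?_
  have : Ideal.Quotient.mk (vanishingIdeal ℂ S) (F j - C (w j)) = coordHom S F (X j - C (w j)) := by
    rw [coordHom_apply, map_sub (bind₁ F), bind₁_X_right, bind₁_C_right]
  rw [this]
  exact Ideal.mem_map_of_mem _ (mem_pointIdeal.2 (by simp))

/-- The image of a closed cone under forms of equal positive degree without a common zero on it is
a closed cone. -/
lemma IsClosedCone.image [Fintype σ] [Fintype τ] {S : Set (σ → ℂ)} (hS : IsClosedCone S)
    {F : τ → MvPolynomial σ ℂ} {d : ℕ} (hd : 0 < d) (hF : ∀ j, (F j).IsHomogeneous d)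
    (hne : ∀ v ∈ S, evalMap F v ≠ 0) : IsClosedCone (evalMap F '' S) := by
  refine ⟨fun ⟨v, hv, h⟩ => hne v hv h, smul_mem_image_evalMap hS.smul_mem hd hF, ?_⟩
  intro w hw hvan
  by_contra hwS
  have hfin := coordHom_finite hS hd hF fun v hv => Function.ne_iff.1 (hne v hv)
  have htop : (pointIdeal w).map (coordHom S F) = ⊤ := by
    rw [Ideal.eq_top_iff_one]
    -- This ideal cuts out the fibre over `w`, which is empty because `w` is nonzero and not in the
    -- image.
    have hJ : vanishingIdeal ℂ S ⊔ Ideal.span (Set.range fun j => F j - C (w j)) = ⊤ := by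
      refine eq_top_of_forall_exists_eval_ne_zero fun v => ?_
      by_contra! hcon
      have hvw : evalMap F v = w := by
        ext j
        have := hcon _ (Ideal.mem_sup_right (Ideal.subset_span ⟨j, rfl⟩))
        simpa [sub_eq_zero, evalMap] using this
      have hv0 : v ≠ 0 := by
        rintro rfl
        apply hw
        rw [← hvw, ← zero_smul ℂ (0 : σ → ℂ), evalMap_smul hF, zero_pow hd.ne', zero_smul]
      exact hwS ⟨v, hS.mem_of_vanishing v hv0 fun P hP => hcon P (Ideal.mem_sup_left hP), hvw⟩
    have h1 := map_coordHom_pointIdeal S F w (P := 1) (by rw [hJ]; trivial)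
    rwa [map_one] at h1
  -- The function `r` vanishes on the image, hence at `w` by `hvan`, but it is congruent to `1`
  -- modulo the ideal of `w`.
  obtain ⟨r, hr, hr0⟩ := RingHom.Finite.exists_mul_eq_zero hfin _ htop
  rw [coordHom_apply, Ideal.Quotient.eq_zero_iff_mem, mem_vanishingIdeal] at hr0
  have h0 : eval w r = 0 := hvan r <| mem_vanishingIdeal.2 <| by
    rintro _ ⟨v, hv, rfl⟩
    have := hr0 v hv
    rwa [eval_bind₁] at this
  rw [mem_pointIdeal, map_sub, h0, map_one, zero_sub, neg_eq_zero] at hr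
  exact one_ne_zero hr

/-- On the image of `S` under `F`, an inverse of `F` is given, up to scaling, by forms, locally
around each point. -/
def HasLocalInverse (S : Set (σ → ℂ)) (F : τ → MvPolynomial σ ℂ) : Prop :=
  ∀ v ∈ S, ∃ (e : ℕ) (G : σ → MvPolynomial τ ℂ) (c : (σ → ℂ) → ℂ), (∀ i, (G i).IsHomogeneous e) ∧
    c v ≠ 0 ∧ ∀ x ∈ S, evalMap G (evalMap F x) = c x • x

/-- If `F` has a local inverse, the tangent spaces of the image are the images of the tangent
spaces. -/
lemma HasLocalInverse.exists_of_mem_zt [Fintype σ] [Fintype τ] {S : Set (σ → ℂ)}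
    (hS : ∀ v ∈ S, ∀ c : ℂ, c ≠ 0 → c • v ∈ S) {F : τ → MvPolynomial σ ℂ}
    (hinv : HasLocalInverse S F) {d : ℕ} (hF : ∀ j, (F j).IsHomogeneous d) {v : σ → ℂ} (hv : v ∈ S)
    (hne : evalMap F v ≠ 0) {t : τ → ℂ} (ht : t ∈ zt (evalMap F '' S) (evalMap F v)) :
    ∃ (a : ℂ), ∃ u ∈ zt S v, t = a • evalMap F v + fun j => dd (F j) v u := by
  obtain ⟨e, G, c, hG, hc, hGF⟩ := hinv v hv
  have hGv : (fun i => eval (evalMap F v) (G i)) = c v • v := hGF v hv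
  -- The preimage of `t` is, up to scaling, its image under the differential of the inverse `G`.
  set u : σ → ℂ := fun i => dd (G i) (evalMap F v) t with hu
  have hu' : u ∈ zt S v := by
    rw [← zt_smul hS v hc, mem_zt]
    intro P hP
    have h1 : bind₁ G P ∈ vanishingIdeal ℂ (evalMap F '' S) := by
      rw [mem_vanishingIdeal]
      rintro _ ⟨x, hx, rfl⟩
      rw [eval_bind₁]
      change eval (evalMap G (evalMap F x)) P = 0
      rw [hGF x hx]
      by_cases hcx : c x = 0
      · rw [hcx, zero_smul]; exact eval_zero_of_mem_vanishingIdeal hS ⟨v, hv⟩ hP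
      · exact mem_vanishingIdeal.1 hP _ (hS x hx _ hcx)
    have h2 := ht _ h1
    rwa [dd_bind₁, hGv] at h2
  obtain ⟨j, hj⟩ := Function.ne_iff.1 hne
  -- No regularity of the factor `c` is available, so it is eliminated: `F ∘ G` is proportional to
  -- the identity on the image. The resulting 2 × 2 minors vanish there, and differentiating them
  -- along `t` determines `t` up to a multiple of `F(v)`.
  have key : ∀ i, t i * (c v ^ d * evalMap F v j) + evalMap F v i * dd (F j) (c v • v) u =
      t j * (c v ^ d * evalMap F v i) + evalMap F v j * dd (F i) (c v • v) u := by
    intro i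
    have h1 : X i * bind₁ G (F j) - X j * bind₁ G (F i) ∈ vanishingIdeal ℂ (evalMap F '' S) := by
      rw [mem_vanishingIdeal]
      rintro _ ⟨x, hx, rfl⟩
      have h3 : ∀ k, eval (evalMap F x) (bind₁ G (F k)) = c x ^ d * evalMap F x k := fun k => by
        rw [eval_bind₁]
        change eval (evalMap G (evalMap F x)) (F k) = _
        rw [hGF x hx, eval_smul_of_isHomogeneous (hF k)]; rfl
      rw [map_sub, map_mul, map_mul, h3, h3, eval_X, eval_X]
      ring
    have h2 := ht _ h1
    simp only [dd_sub, dd_mul, dd_X, eval_X, eval_bind₁, dd_bind₁, hGv,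
      eval_smul_of_isHomogeneous (hF _)] at h2
    change _ * dd (F j) _ u + _ * _ - (_ * dd (F i) _ u + _ * _) = 0 at h2
    simp only [evalMap] at h2 ⊢
    linear_combination h2
  have hj' : c v ^ d * evalMap F v j ≠ 0 := mul_ne_zero (pow_ne_zero _ hc) hj
  refine ⟨(t j * c v ^ d - dd (F j) (c v • v) u) / (c v ^ d * evalMap F v j),
    (c v ^ (d - 1) / c v ^ d) • u, Submodule.smul_mem _ _ hu', ?_⟩
  ext i
  have hi := key i
  simp only [Pi.add_apply, Pi.smul_apply, smul_eq_mul, dd_smul_right]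
  rw [dd_smul_left_of_isHomogeneous (hF i)] at hi
  have hcd : c v ^ d ≠ 0 := pow_ne_zero _ hc
  have hj'' : evalMap F v j ≠ 0 := hj
  field_simp
  linear_combination hi

end SkewEmbedding

end

/-! ### Injective unramified linear projections are embeddings -/

noncomputable section

namespace SkewEmbedding

variable {σ τ : Type*}

lemma dd_of_isHomogeneous_one [Fintype σ] {P : MvPolynomial σ ℂ} (hP : P.IsHomogeneous 1)
    (v t : σ → ℂ) : dd P v t = eval t P := by
  have h : ∀ x, dd P 0 t = dd P x t := fun x => by
    rw [← zero_smul ℂ x, dd_smul_left_of_isHomogeneous hP]; simp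
  rw [← h v, h t, dd_self_of_isHomogeneous hP]
  simp

/-- First order Taylor expansion with remainder in the square of the maximal ideal. -/
lemma sub_sum_mem_pointIdeal_sq [Fintype σ] (v : σ → ℂ) (P : MvPolynomial σ ℂ) :
    P - C (eval v P) - ∑ i, C (eval v (pderiv i P)) * (X i - C (v i)) ∈ pointIdeal v ^ 2 := by
  classical
  induction P using MvPolynomial.induction_on with
  | C a => simp
  | add p q hp hq =>
    have := add_mem hp hq
    convert this using 1
    simp only [map_add, add_mul, Finset.sum_add_distrib]
    ring
  | mul_X p i hp =>
    have hm : ∀ j, (X j - C (v j) : MvPolynomial σ ℂ) ∈ pointIdeal v := fun j =>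
      mem_pointIdeal.2 (by simp)
    have h2 : (∑ j, C (eval v (pderiv j p)) * (X j - C (v j))) * (X i - C (v i)) ∈
        pointIdeal v ^ 2 := by
      rw [pow_two]
      exact Ideal.mul_mem_mul (sum_mem fun j _ => Ideal.mul_mem_left _ _ (hm j)) (hm i)
    have := add_mem (Ideal.mul_mem_right (X i) _ hp) h2
    convert this using 1
    have h3 : ∑ j, C (eval v (pderiv j (p * X i))) * (X j - C (v j)) =
        C (eval v p) * (X i - C (v i)) +
          C (v i) * ∑ j, C (eval v (pderiv j p)) * (X j - C (v j)) := by
      simp only [Derivation.leibniz, pderiv_X, smul_eq_mul, map_add, map_mul, eval_X, add_mul,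
        Finset.sum_add_distrib, Finset.mul_sum, mul_assoc]
      congr 1
      rw [Finset.sum_eq_single i]
      · simp
      · intro j _ hj
        simp [hj]
      · simp
    rw [h3, map_mul, map_mul, eval_X]
    ring

lemma mem_pointIdeal_sq [Fintype σ] {v : σ → ℂ} {P : MvPolynomial σ ℂ} (hP : eval v P = 0)
    (hd : ddLinear P v = 0) : P ∈ pointIdeal v ^ 2 := by
  classical
  have h := sub_sum_mem_pointIdeal_sq v P
  have hi : ∀ i, eval v (pderiv i P) = 0 := fun i => by
    have := LinearMap.congr_fun hd (Pi.single i 1)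
    simpa [dd, Pi.single_apply] using this
  simpa [hP, hi] using h

/-- A point that is the only zero of an ideal `J`, at which the differentials of the elements of `J`
span the cotangent space, is cut out by `J`. -/
lemma pointIdeal_le_of_unramified [Fintype σ] {J : Ideal (MvPolynomial σ ℂ)} {v : σ → ℂ}
    (hJv : J ≤ pointIdeal v) (huniq : ∀ x, (∀ P ∈ J, eval x P = 0) → x = v)
    (htan : ∀ t, (∀ P ∈ J, dd P v t = 0) → t = 0) : pointIdeal v ≤ J := by
  have hrad : pointIdeal v ≤ J.radical := by
    rw [← vanishingIdeal_zeroLocus_eq_radical (K := ℂ) J]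
    intro P hP
    rw [mem_vanishingIdeal]
    intro x hx
    rw [huniq x fun Q hQ => by simpa [aeval_eq_eval] using mem_zeroLocus_iff.1 hx Q hQ]
    exact mem_pointIdeal.1 hP
  obtain ⟨k, hk⟩ := Ideal.exists_pow_le_of_le_radical_of_fg hrad (IsNoetherian.noetherian _)
  let δ : MvPolynomial σ ℂ →ₗ[ℂ] Module.Dual ℂ (σ → ℂ) :=
    { toFun := fun P => ddLinear P v
      map_add' := fun P Q => by ext; simp
      map_smul' := fun c P => by ext; simp [← C_mul'] }
  -- By `htan` the differentials of `J` have no common kernel, so they span the dual space.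
  have htop : (J.restrictScalars ℂ).map δ = ⊤ := by
    have h1 : ((J.restrictScalars ℂ).map δ).dualCoannihilator = ⊥ := by
      refine (Submodule.eq_bot_iff _).2 fun t ht => htan t fun P hP => ?_
      rw [Submodule.mem_dualCoannihilator] at ht
      exact ht (δ P) (Submodule.mem_map_of_mem hP)
    rw [← Subspace.dualCoannihilator_dualAnnihilator_eq (W := (J.restrictScalars ℂ).map δ), h1,
      Submodule.dualAnnihilator_bot]
  have hsq : pointIdeal v ≤ J ⊔ pointIdeal v ^ 2 := by
    intro P hP
    obtain ⟨Q, hQ, hQP⟩ : δ P ∈ (J.restrictScalars ℂ).map δ := by rw [htop]; trivial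
    rw [← add_sub_cancel Q P]
    refine Submodule.add_mem_sup hQ (mem_pointIdeal_sq ?_ ?_)
    · rw [map_sub, mem_pointIdeal.1 hP, mem_pointIdeal.1 (hJv hQ), sub_zero]
    · change δ (P - Q) = 0
      rw [map_sub, hQP, sub_self]
  -- Iterating `m ≤ J + m²` pushes the error into a high power of `m`, which lies in `J` by the
  -- Nullstellensatz.
  have hpow : ∀ l : ℕ, pointIdeal v ≤ J ⊔ pointIdeal v ^ (l + 1) := by
    intro l
    induction l with
    | zero => simp
    | succ l ih =>
      refine hsq.trans (sup_le le_sup_left ?_)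
      rw [pow_two]
      refine (Ideal.mul_mono_right ih).trans ?_
      rw [Ideal.mul_sup, ← pow_succ']
      exact sup_le_sup Ideal.mul_le_right le_rfl
  exact (hpow k).trans (sup_le le_rfl ((Ideal.pow_le_pow_right (Nat.le_succ k)).trans hk))

/-- A linear projection that is injective and unramified on a closed cone has a local inverse. -/
lemma hasLocalInverse_of_isHomogeneous_one [Fintype σ] [Fintype τ] {S : Set (σ → ℂ)}
    (hS : IsClosedCone S) {A : τ → MvPolynomial σ ℂ} (hA : ∀ j, (A j).IsHomogeneous 1)
    (hne : ∀ v ∈ S, evalMap A v ≠ 0) (hinj : Set.InjOn (evalMap A) S)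
    (htan : ∀ v ∈ S, ∀ t ∈ zt S v, evalMap A t = 0 → t = 0) : HasLocalInverse S A := by
  intro v hv
  set w := evalMap A v with hw
  set J := vanishingIdeal ℂ S ⊔ Ideal.span (Set.range fun j => A j - C (w j)) with hJ
  have hgen : ∀ j, A j - C (w j) ∈ J := fun j =>
    Ideal.mem_sup_right (Ideal.subset_span ⟨j, rfl⟩)
  -- `J` defines the fibre of the projection over `w`: injectivity makes it one point, the tangent
  -- condition makes it reduced.
  have hle : pointIdeal v ≤ J := by
    refine pointIdeal_le_of_unramified ?_ ?_ ?_
    · refine sup_le (fun P hP => mem_pointIdeal.2 (mem_vanishingIdeal.1 hP v hv)) ?_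
      rw [Ideal.span_le]
      rintro _ ⟨j, rfl⟩
      exact mem_pointIdeal.2 (by simp [hw, evalMap])
    · intro x hx
      have hxw : evalMap A x = w := by
        ext j
        have := hx _ (hgen j)
        simpa [sub_eq_zero, evalMap] using this
      have hx0 : x ≠ 0 := by
        rintro rfl
        apply hne v hv
        rw [← hw, ← hxw, ← zero_smul ℂ (0 : σ → ℂ), evalMap_smul hA]
        simp
      exact hinj (hS.mem_of_vanishing x hx0 fun P hP => hx P (Ideal.mem_sup_left hP)) hv hxw
    · intro t ht
      refine htan v hv t (fun P hP => ht P (Ideal.mem_sup_left hP)) ?_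
      ext j
      have := ht _ (hgen j)
      rwa [dd_sub, dd_C, sub_zero, dd_of_isHomogeneous_one (hA j)] at this
  have hfin := coordHom_finite hS one_pos hA fun v hv => Function.ne_iff.1 (hne v hv)
  -- On a reduced one-point fibre every function is constant, so Nakayama applies. It expresses each
  -- `x i` on the cone as a quotient of polynomials in the projected coordinates with denominator
  -- `r`, where `r(w) = 1`.
  obtain ⟨r, hr, hrb⟩ := RingHom.Finite.exists_mul_mem_range hfin (pointIdeal w) <| by
    intro b
    obtain ⟨P, rfl⟩ := Ideal.Quotient.mk_surjective b
    refine ⟨C (eval v P), ?_⟩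
    rw [coordHom_apply, bind₁_C_right, ← map_sub]
    exact map_coordHom_pointIdeal S A w (hle (mem_pointIdeal.2 (by simp)))
  choose G hG using fun i => hrb (Ideal.Quotient.mk _ (X i))
  have hGA : ∀ i, ∀ x ∈ S, eval (evalMap A x) r * x i = eval (evalMap A x) (G i) := by
    intro i x hx
    have h1 := hG i
    rw [coordHom_apply, coordHom_apply, ← map_mul, Ideal.Quotient.eq, mem_vanishingIdeal] at h1
    have h2 := h1 x hx
    rw [map_sub, map_mul, eval_bind₁, eval_bind₁, eval_X, sub_eq_zero] at h2
    exact h2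
  have hrw : eval w r = 1 := by
    rwa [mem_pointIdeal, map_sub, map_one, sub_eq_zero] at hr
  -- The denominator need not be a form; one of its components is nonzero at `w`. The projection has
  -- degree one, so the component of degree `e` of `r` matches that of degree `e + 1` of `G i`.
  obtain ⟨e, he⟩ : ∃ e, eval w (homogeneousComponent e r) ≠ 0 := by
    by_contra! hcon
    rw [← sum_homogeneousComponent r, map_sum, Finset.sum_eq_zero fun e _ => hcon e] at hrw
    exact zero_ne_one hrw
  refine ⟨e + 1, fun i => homogeneousComponent (e + 1) (G i),
    fun x => eval (evalMap A x) (homogeneousComponent e r),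
    fun i => homogeneousComponent_isHomogeneous _ _, he, fun x hx => ?_⟩
  ext i
  have hline : line (G i) (evalMap A x) =
      Polynomial.C (x i) * line r (evalMap A x) * Polynomial.X := by
    refine polynomial_eq_of_eval_eq_of_ne_zero fun c hc => ?_
    have := hGA i (c • x) (hS.smul_mem x hx c hc)
    rw [evalMap_smul hA, pow_one, Pi.smul_apply, smul_eq_mul] at this
    rw [Polynomial.eval_mul, Polynomial.eval_mul, Polynomial.eval_C, Polynomial.eval_X, eval_line,
      eval_line, ← this]
    ring
  have h3 := congrArg (fun p => p.coeff (e + 1)) hline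
  rw [Polynomial.coeff_mul_X, Polynomial.coeff_C_mul, coeff_line, coeff_line] at h3
  rw [Pi.smul_apply, smul_eq_mul, mul_comm]
  exact h3

end SkewEmbedding

end

/-! ### Projective varieties as affine cones; smoothness -/

noncomputable section

namespace SkewEmbedding

/-- The affine cone over a subset of projective space, without its vertex. -/
def cone {N : ℕ} (X : Set (PSpace N)) : Set (Fin (N + 1) → ℂ) :=
  {v | ∃ hv : v ≠ 0, Projectivization.mk ℂ v hv ∈ X}

variable {N : ℕ}

lemma rep_mem_cone {X : Set (PSpace N)} {p : PSpace N} : p.rep ∈ cone X ↔ p ∈ X := by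
  simp [cone, p.rep_nonzero]

lemma mk_mem_iff {X : Set (PSpace N)} {v : Fin (N + 1) → ℂ} (hv : v ≠ 0) :
    Projectivization.mk ℂ v hv ∈ X ↔ v ∈ cone X := by
  simp [cone, hv]

lemma ne_zero_of_mem_cone {X : Set (PSpace N)} {v : Fin (N + 1) → ℂ} (hv : v ∈ cone X) : v ≠ 0 :=
  hv.1

lemma exists_rep_eq_smul (v : Fin (N + 1) → ℂ) (hv : v ≠ 0) :
    ∃ a : ℂ, a ≠ 0 ∧ (Projectivization.mk ℂ v hv).rep = a • v := by
  obtain ⟨a, ha⟩ := Projectivization.exists_smul_eq_mk_rep ℂ v hv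
  exact ⟨a, a.ne_zero, ha.symm⟩

lemma mk_eq_mk_of_eq_smul {v w : Fin (N + 1) → ℂ} (hv : v ≠ 0) (hw : w ≠ 0) {a : ℂ}
    (h : v = a • w) : Projectivization.mk ℂ v hv = Projectivization.mk ℂ w hw :=
  (Projectivization.mk_eq_mk_iff' ℂ v w hv hw).2 ⟨a, h.symm⟩

lemma evalAt_mk_eq_zero_iff {F : Poly N} {d : ℕ} (hF : F.IsHomogeneous d) {v : Fin (N + 1) → ℂ}
    (hv : v ≠ 0) : evalAt (Projectivization.mk ℂ v hv) F = 0 ↔ eval v F = 0 := by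
  obtain ⟨a, ha, h⟩ := exists_rep_eq_smul v hv
  rw [evalAt, h, eval_smul_of_isHomogeneous hF]
  simp [ha]

lemma smul_mem_cone {X : Set (PSpace N)} : ∀ v ∈ cone X, ∀ c : ℂ, c ≠ 0 → c • v ∈ cone X := by
  rintro v ⟨hv, h⟩ c hc
  refine ⟨smul_ne_zero hc hv, ?_⟩
  rwa [mk_eq_mk_of_eq_smul _ hv rfl]

lemma forall_evalAt_eq_zero_iff {X : Set (PSpace N)} {F : Poly N} {d : ℕ}
    (hF : F.IsHomogeneous d) :
    (∀ p ∈ X, evalAt p F = 0) ↔ ∀ v ∈ cone X, eval v F = 0 := by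
  refine ⟨?_, fun h p hp => h _ (rep_mem_cone.2 hp)⟩
  rintro h v ⟨hv, hvX⟩
  exact (evalAt_mk_eq_zero_iff hF hv).1 (h _ hvX)

lemma IsAlgebraicSet.isClosedCone {X : Set (PSpace N)} (hX : IsAlgebraicSet X) :
    IsClosedCone (cone X) := by
  refine ⟨fun h => h.1 rfl, smul_mem_cone, fun v hv hvan => ?_⟩
  obtain ⟨E, hE, rfl⟩ := hX
  refine ⟨hv, fun F hF => ?_⟩
  obtain ⟨d, hd⟩ := hE F hF
  rw [evalAt_mk_eq_zero_iff hd]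
  exact hvan F (mem_vanishingIdeal.2 ((forall_evalAt_eq_zero_iff hd).1 fun p hp => hp F hF))

lemma IsClosedCone.isAlgebraicSet {X : Set (PSpace N)} (hX : IsClosedCone (cone X)) :
    IsAlgebraicSet X := by
  refine ⟨{F | (∃ d, F.IsHomogeneous d) ∧ F ∈ vanishingIdeal ℂ (cone X)}, fun F hF => hF.1, ?_⟩
  ext p
  refine ⟨fun hp F hF => mem_vanishingIdeal.1 hF.2 _ (rep_mem_cone.2 hp), fun hp => ?_⟩
  rw [← rep_mem_cone]
  refine hX.mem_of_vanishing _ p.rep_nonzero fun P hP => ?_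
  rw [← sum_homogeneousComponent P, map_sum]
  exact Finset.sum_eq_zero fun k _ => hp _ ⟨⟨k, homogeneousComponent_isHomogeneous k P⟩,
    homogeneousComponent_mem_vanishingIdeal hX.smul_mem hP k⟩

/-- Smoothness in terms of the affine cone. -/
lemma IsSmoothOfDim.exists_equations {n : ℕ} {X : Set (PSpace N)} (hX : IsSmoothOfDim n X)
    {v : Fin (N + 1) → ℂ} (hv : v ∈ cone X) :
    ∃ c : ℕ, n + c = N ∧ ∃ (F : Fin c → Poly N) (G : Poly N),
      (∀ j, ∃ d, (F j).IsHomogeneous d) ∧ eval v G ≠ 0 ∧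
      (∀ x, x ≠ 0 → eval x G ≠ 0 → (x ∈ cone X ↔ ∀ j, eval x (F j) = 0)) ∧
      LinearIndependent ℂ (fun (j : Fin c) (i : Fin (N + 1)) => eval v (pderiv i (F j))) := by
  obtain ⟨hv0, hvX⟩ := hv
  obtain ⟨c, hc, F, G, hF, ⟨dG, hG⟩, hGv, hcut, hli⟩ := hX _ hvX
  refine ⟨c, hc, F, G, hF, fun h => hGv ((evalAt_mk_eq_zero_iff hG hv0).2 h), ?_, ?_⟩
  · intro x hx hGx
    rw [← mk_mem_iff hx, hcut _ fun h => hGx ((evalAt_mk_eq_zero_iff hG hx).1 h)]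
    refine forall_congr' fun j => ?_
    obtain ⟨d, hd⟩ := hF j
    exact evalAt_mk_eq_zero_iff hd hx
  · obtain ⟨a, ha, h⟩ := exists_rep_eq_smul v hv0
    choose d hd using hF
    have h2 := hli.units_smul fun j => (Units.mk0 (a ^ (d j - 1)) (pow_ne_zero _ ha))⁻¹
    convert h2 using 1
    ext j i
    simp only [Pi.smul_apply', Units.smul_def, Units.val_inv_eq_inv_val, Units.val_mk0,
      Pi.smul_apply, evalAt, h, eval_smul_of_isHomogeneous (hd j).pderiv, smul_eq_mul]
    rw [inv_mul_cancel_left₀ (pow_ne_zero _ ha)]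

/-- The differential at `v` of a tuple of polynomials. -/
def jacobian {σ τ : Type*} [Fintype σ] (F : τ → MvPolynomial σ ℂ) (v : σ → ℂ) :
    (σ → ℂ) →ₗ[ℂ] (τ → ℂ) := LinearMap.pi fun j => ddLinear (F j) v

@[simp] lemma jacobian_apply {σ τ : Type*} [Fintype σ] (F : τ → MvPolynomial σ ℂ) (v t : σ → ℂ)
    (j : τ) : jacobian F v t j = dd (F j) v t := rfl

lemma range_jacobian_eq_top {σ τ : Type*} [Fintype σ] [Fintype τ] {F : τ → MvPolynomial σ ℂ}
    {v : σ → ℂ} (h : LinearIndependent ℂ fun (j : τ) (i : σ) => eval v (pderiv i (F j))) :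
    LinearMap.range (jacobian F v) = ⊤ := by
  classical
  have h1 : jacobian F v = (Matrix.of fun j i => eval v (pderiv i (F j))).mulVecLin := by
    ext t j
    simp [dd, Matrix.mulVec, dotProduct]
  apply Submodule.eq_top_of_finrank_eq
  rw [h1]
  change Matrix.rank _ = _
  rw [LinearIndependent.rank_matrix (M := Matrix.of fun j i => eval v (pderiv i (F j))) h,
    Module.finrank_fintype_fun_eq_card]

/-- The local equations `F j` vanish on the cone only where `G ≠ 0`, but `F j * G` vanishes on all
of it and has differential `G(v) dF j` at `v`. So the tangent space lies in the kernel of a Jacobian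
of rank `N - n`. -/
lemma IsSmoothOfDim.finrank_zt_le {n : ℕ} {X : Set (PSpace N)} (hX : IsSmoothOfDim n X)
    {v : Fin (N + 1) → ℂ} (hv : v ∈ cone X) : Module.finrank ℂ (zt (cone X) v) ≤ n + 1 := by
  obtain ⟨c, hc, F, G, hF, hG, hcut, hli⟩ := hX.exists_equations hv
  have hFv := (hcut v hv.1 hG).1 hv
  have hle : zt (cone X) v ≤ LinearMap.ker (jacobian F v) := by
    intro t ht
    rw [LinearMap.mem_ker]
    ext j
    have h1 : F j * G ∈ vanishingIdeal ℂ (cone X) := mem_vanishingIdeal.2 fun x hx => by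
      rw [map_mul]
      by_cases hGx : eval x G = 0
      · rw [hGx, mul_zero]
      · rw [(hcut x hx.1 hGx).1 hx j, zero_mul]
    have h2 := ht _ h1
    rw [dd_mul, hFv j, zero_mul, zero_add] at h2
    exact (mul_eq_zero.1 h2).resolve_left hG
  refine (Submodule.finrank_mono hle).trans ?_
  have h3 := LinearMap.finrank_range_add_finrank_ker (jacobian F v)
  rw [range_jacobian_eq_top hli, finrank_top, Module.finrank_fintype_fun_eq_card,
    Module.finrank_fintype_fun_eq_card, Fintype.card_fin, Fintype.card_fin] at h3
  omega

end SkewEmbedding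

end

/-! ### Analytic charts of a smooth cone -/

noncomputable section

namespace SkewEmbedding

variable {N : ℕ}

/-- An analytic parametrization of an `n`-dimensional piece of an affine slice `L = 1` of a cone `S`,
inverted by a linear map `π`. -/
structure Chart (S : Set (Fin (N + 1) → ℂ)) (n : ℕ) where
  /-- the parametrization -/
  φ : (Fin n → ℂ) → (Fin (N + 1) → ℂ)
  /-- the linear form that is `1` on the slice -/
  L : (Fin (N + 1) → ℂ) →L[ℂ] ℂ
  /-- the coordinates -/
  π : (Fin (N + 1) → ℂ) →L[ℂ] (Fin n → ℂ)
  /-- the centre of the domain -/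
  center : Fin n → ℂ
  /-- the radius of the domain -/
  radius : ℝ
  analyticAt : ∀ s ∈ Metric.ball center radius, AnalyticAt ℂ φ s
  mem : ∀ s ∈ Metric.ball center radius, φ s ∈ S
  L_φ : ∀ s ∈ Metric.ball center radius, L (φ s) = 1
  π_φ : ∀ s ∈ Metric.ball center radius, π (φ s) = s

namespace Chart

variable {S : Set (Fin (N + 1) → ℂ)} {n : ℕ}

/-- The domain of a chart. -/
def dom (κ : Chart S n) : Set (Fin n → ℂ) := Metric.ball κ.center κ.radius

lemma isOpen_dom (κ : Chart S n) : IsOpen κ.dom := Metric.isOpen_ball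

/-- The coordinates of a point of the cone. -/
def coord (κ : Chart S n) (y : Fin (N + 1) → ℂ) : Fin n → ℂ := (κ.L y)⁻¹ • κ.π y

/-- The chart parametrizes the cone near `x`, up to scaling. -/
def Covers (κ : Chart S n) (x : Fin (N + 1) → ℂ) : Prop :=
  ∀ᶠ y in 𝓝[S] x, κ.L y ≠ 0 ∧ κ.coord y ∈ κ.dom ∧ y = κ.L y • κ.φ (κ.coord y)

end Chart

lemma exists_ker_inf_ker_eq_bot {E V : Type*} [AddCommGroup E] [Module ℂ E]
    [FiniteDimensional ℂ E] [AddCommGroup V] [Module ℂ V] [FiniteDimensional ℂ V]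
    (T : E →ₗ[ℂ] V) (hT : LinearMap.range T = ⊤) {n : ℕ}
    (hn : Module.finrank ℂ E = Module.finrank ℂ V + n) :
    ∃ π : E →ₗ[ℂ] (Fin n → ℂ), ∀ x, T x = 0 → π x = 0 → x = 0 := by
  have h := LinearMap.finrank_range_add_finrank_ker T
  rw [hT, finrank_top] at h
  have h2 : Module.finrank ℂ (LinearMap.ker T) = n := by omega
  obtain ⟨π, hπ⟩ := LinearMap.exists_extend
    (LinearEquiv.ofFinrankEq (LinearMap.ker T) (Fin n → ℂ) (by simp [h2])).toLinearMap
  refine ⟨π, fun x hx hπx => ?_⟩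
  have h3 := LinearMap.congr_fun hπ ⟨x, hx⟩
  simp only [LinearMap.comp_apply, Submodule.subtype_apply, hπx, LinearEquiv.coe_coe] at h3
  have h4 := (LinearEquiv.map_eq_zero_iff _).1 h3.symm
  exact congrArg Subtype.val h4

/-- Inverse function theorem: equations, the slice function `L` and `n` complementary linear
coordinates `π` form a local analytic isomorphism at `v`, and the chart is its inverse restricted to
`F = 0`, `L = 1`. -/
lemma IsSmoothOfDim.exists_chart {n : ℕ} {X : Set (PSpace N)} (hX : IsSmoothOfDim n X)
    {v : Fin (N + 1) → ℂ} (hv : v ∈ cone X) : ∃ κ : Chart (cone X) n, κ.Covers v := by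
  obtain ⟨c, hc, F, G, hF, hG, hcut, hli⟩ := hX.exists_equations hv
  have hFv := (hcut v hv.1 hG).1 hv
  choose d hd using hF
  obtain ⟨L, hL⟩ := SeparatingDual.exists_eq_one (R := ℂ) hv.1
  have hJv : jacobian F v v = 0 := by
    ext j
    simp [dd_self_of_isHomogeneous (hd j), hFv j]
  -- By Euler's identity the direction `v` lies in the kernel of the Jacobian, while `L v = 1`; so
  -- the slice is transverse to the equations.
  have hTtop : LinearMap.range ((jacobian F v).prod L.toLinearMap) = ⊤ := by
    rw [eq_top_iff]
    rintro ⟨a, b⟩ -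
    obtain ⟨t, ht⟩ : a ∈ LinearMap.range (jacobian F v) := by
      rw [range_jacobian_eq_top hli]; trivial
    refine ⟨t + (b - L t) • v, ?_⟩
    simp [ht, hJv, hL]
  obtain ⟨π₀, hπ₀⟩ := exists_ker_inf_ker_eq_bot _ hTtop (n := n) (by simp; omega)
  set π := LinearMap.toContinuousLinearMap π₀ with hπ
  let Φ : (Fin (N + 1) → ℂ) → (Fin c → ℂ) × ℂ × (Fin n → ℂ) := fun x => (evalMap F x, L x, π x)
  let T : (Fin (N + 1) → ℂ) →L[ℂ] (Fin c → ℂ) × ℂ × (Fin n → ℂ) :=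
    (LinearMap.toContinuousLinearMap (jacobian F v)).prod (L.prod π)
  have hTinj : Function.Injective T := by
    rw [injective_iff_map_eq_zero]
    intro x hx
    simp only [T, ContinuousLinearMap.prod_apply, Prod.mk_eq_zero] at hx
    exact hπ₀ x (Prod.ext hx.1 hx.2.1) hx.2.2
  let T' : (Fin (N + 1) → ℂ) ≃L[ℂ] (Fin c → ℂ) × ℂ × (Fin n → ℂ) :=
    (LinearMap.linearEquivOfInjective T.toLinearMap hTinj
      (by simp; omega)).toContinuousLinearEquiv
  have hΦan : ∀ x, AnalyticAt ℂ Φ x := fun x =>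
    (analyticAt_pi_iff.2 fun j => analyticAt_eval (F j) x).prod
      ((L.analyticAt x).prod (π.analyticAt x))
  have hΦd : HasFDerivAt Φ (T' : (Fin (N + 1) → ℂ) →L[ℂ] (Fin c → ℂ) × ℂ × (Fin n → ℂ)) v := by
    have h1 : HasFDerivAt Φ T v := by
      refine HasFDerivAt.prodMk ?_ (L.hasFDerivAt.prodMk π.hasFDerivAt)
      exact (hasFDerivAt_pi (φ' := fun j => LinearMap.toContinuousLinearMap (ddLinear (F j) v))).2
        fun j => hasFDerivAt_eval (F j) v
    exact h1.congr_fderiv (ContinuousLinearMap.ext fun _ => rfl)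
  have hΦc : ContDiffAt ℂ ⊤ Φ v := (hΦan v).contDiffAt
  let e := hΦc.toOpenPartialHomeomorph Φ hΦd (by simp)
  have hve : v ∈ e.source := hΦc.mem_toOpenPartialHomeomorph_source hΦd (by simp)
  have hecoe : ∀ x, e x = Φ x := fun x => rfl
  have hesymm : e.symm (Φ v) = v := e.left_inv hve
  have hean : AnalyticAt ℂ e.symm (Φ v) := by
    refine ContDiffAt.analyticAt (e.contDiffAt_symm (f₀' := T') (e.map_source hve) ?_ ?_)
    · rw [hesymm]; exact hΦd
    · rw [hesymm]; exact hΦc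
  let ι : (Fin n → ℂ) → (Fin c → ℂ) × ℂ × (Fin n → ℂ) := fun s => (0, 1, s)
  have hι : ∀ s, AnalyticAt ℂ ι s := fun s =>
    analyticAt_const.prod (analyticAt_const.prod analyticAt_id)
  have hιv : ι (π v) = Φ v := by
    refine Prod.ext ?_ (Prod.ext hL.symm rfl)
    ext j; exact (hFv j).symm
  have hιtend : Filter.Tendsto ι (𝓝 (π v)) (𝓝 (Φ v)) := hιv ▸ (hι (π v)).continuousAt
  have hφtend : Filter.Tendsto (fun s => e.symm (ι s)) (𝓝 (π v)) (𝓝 v) := by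
    have := hean.continuousAt.tendsto.comp hιtend
    rwa [hesymm] at this
  have hGtend : ∀ᶠ x in 𝓝 v, eval x G ≠ 0 :=
    (analyticAt_eval G v).continuousAt.eventually_ne hG
  have hev : ∀ᶠ s in 𝓝 (π v), ι s ∈ e.target ∧ AnalyticAt ℂ e.symm (ι s) ∧
      eval (e.symm (ι s)) G ≠ 0 :=
    (hιtend.eventually (e.open_target.mem_nhds (e.map_source hve))).and
      ((hιtend.eventually hean.eventually_analyticAt).and (hφtend.eventually hGtend))
  obtain ⟨r, hr, hball⟩ := Metric.eventually_nhds_iff_ball.1 hev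
  have hΦφ : ∀ s ∈ Metric.ball (π v) r, Φ (e.symm (ι s)) = ι s := fun s hs =>
    e.right_inv (hball s hs).1
  have hLφ : ∀ s ∈ Metric.ball (π v) r, L (e.symm (ι s)) = 1 := fun s hs =>
    congrArg (fun z => z.2.1) (hΦφ s hs)
  let κ : Chart (cone X) n :=
    { φ := fun s => e.symm (ι s)
      L := L
      π := π
      center := π v
      radius := r
      analyticAt := fun s hs => AnalyticAt.comp (hball s hs).2.1 (hι s)
      mem := fun s hs => by
        refine (hcut _ ?_ (hball s hs).2.2).2 fun j => congrFun (congrArg Prod.fst (hΦφ s hs)) j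
        intro h0
        have := hLφ s hs
        rw [h0, map_zero] at this
        exact zero_ne_one this
      L_φ := hLφ
      π_φ := fun s hs => congrArg (fun z => z.2.2) (hΦφ s hs) }
  refine ⟨κ, ?_⟩
  have hLcont : Filter.Tendsto (fun y => (L y)⁻¹) (𝓝 v) (𝓝 1) := by
    have := (L.continuous.tendsto v).inv₀ (by rw [hL]; exact one_ne_zero)
    rwa [hL, inv_one] at this
  have hcoord : Filter.Tendsto κ.coord (𝓝 v) (𝓝 (π v)) := by
    have := hLcont.smul (π.continuous.tendsto v)
    rwa [one_smul] at this
  have hscale : Filter.Tendsto (fun y => (L y)⁻¹ • y) (𝓝 v) (𝓝 v) := by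
    have := hLcont.smul (Filter.tendsto_id (x := 𝓝 v))
    rwa [one_smul] at this
  have hLne : ∀ᶠ y in 𝓝 v, L y ≠ 0 :=
    L.continuous.continuousAt.eventually_ne (by rw [hL]; exact one_ne_zero)
  have hall : ∀ᶠ y in 𝓝 v, y ∈ cone X →
      (κ.L y ≠ 0 ∧ κ.coord y ∈ κ.dom ∧ y = κ.L y • κ.φ (κ.coord y)) := by
    filter_upwards [hLne, hcoord.eventually (Metric.ball_mem_nhds _ hr),
      hscale.eventually (e.open_source.mem_nhds hve), hGtend] with y h1 h2 h3 h4 hy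
    refine ⟨h1, h2, ?_⟩
    have h5 : Φ ((L y)⁻¹ • y) = ι (κ.coord y) := by
      refine Prod.ext ?_ (Prod.ext ?_ ?_)
      · ext j
        change eval _ (F j) = 0
        rw [eval_smul_of_isHomogeneous (hd j), (hcut y hy.1 h4).1 hy j, mul_zero]
      · change L _ = 1
        rw [map_smul, smul_eq_mul, inv_mul_cancel₀ h1]
      · change π _ = _
        rw [map_smul]; rfl
    have h6 : κ.φ (κ.coord y) = (L y)⁻¹ • y := by
      change e.symm (ι (κ.coord y)) = _
      rw [← h5, ← hecoe, e.left_inv h3]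
    rw [h6]
    change y = L y • (L y)⁻¹ • y
    rw [smul_inv_smul₀ h1]
  exact eventually_nhdsWithin_iff.2 hall

/-- Countably many charts suffice. -/
lemma IsSmoothOfDim.exists_countable_charts {n : ℕ} {X : Set (PSpace N)}
    (hX : IsSmoothOfDim n X) : ∃ 𝒞 : Set (Chart (cone X) n), 𝒞.Countable ∧
      ∀ v ∈ cone X, ∃ κ ∈ 𝒞, κ.Covers v := by
  have h : ∀ v : cone X, ∃ κ : Chart (cone X) n, κ.Covers v := fun v => hX.exists_chart v.2
  choose κ hκ using h
  classical
  let f : (Fin (N + 1) → ℂ) → Set (Fin (N + 1) → ℂ) := fun v =>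
    if hv : v ∈ cone X then {x | (κ ⟨v, hv⟩).Covers x} else ∅
  -- Lindelöf property. Countability matters because Hausdorff dimension is only controlled under
  -- countable unions.
  obtain ⟨t, htX, ht, hcov⟩ := TopologicalSpace.countable_cover_nhdsWithin (f := f)
    (s := cone X) (by
      intro v hv
      simp only [f, dif_pos hv]
      exact eventually_eventually_nhdsWithin.2 (hκ ⟨v, hv⟩))
  have : Countable t := ht
  refine ⟨Set.range fun v : t => κ ⟨v, htX v.2⟩, Set.countable_range _, fun v hv => ?_⟩
  obtain ⟨x, hx, hvx⟩ := Set.mem_iUnion₂.1 (hcov hv)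
  simp only [f, dif_pos (htX hx)] at hvx
  exact ⟨_, ⟨⟨x, hx⟩, rfl⟩, hvx⟩

end SkewEmbedding

end

/-! ### Directional derivatives, jets and their separation by cubics -/

noncomputable section

namespace SkewEmbedding

section Derivatives

variable {E F F' : Type*} [NormedAddCommGroup E] [NormedSpace ℂ E] [NormedAddCommGroup F]
  [NormedSpace ℂ F] [NormedAddCommGroup F'] [NormedSpace ℂ F']

/-- The derivative in the direction `u`. -/
def dir (u : E) (f : E → F) : E → F := fun s => fderiv ℂ f s u

lemma analyticAt_dir [CompleteSpace F] {f : E → F} {s : E} (hf : AnalyticAt ℂ f s) (u : E) :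
    AnalyticAt ℂ (dir u f) s :=
  ((ContinuousLinearMap.apply ℂ F u).analyticAt _).comp hf.fderiv

lemma dir_congr {f g : E → F} {s : E} (h : f =ᶠ[𝓝 s] g) (u : E) : dir u f =ᶠ[𝓝 s] dir u g :=
  h.fderiv.fun_comp fun T => T u

lemma dir_clm [CompleteSpace F] {f : E → F} {s : E} (hf : AnalyticAt ℂ f s) (ℓ : F →L[ℂ] F')
    (u : E) : dir u (fun x => ℓ (f x)) =ᶠ[𝓝 s] fun x => ℓ (dir u f x) := by
  filter_upwards [hf.eventually_analyticAt] with x hx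
  have := ℓ.hasFDerivAt.comp x hx.differentiableAt.hasFDerivAt
  change fderiv ℂ (ℓ ∘ f) x u = _
  rw [this.fderiv]; rfl

lemma dir_const (u : E) (c : F) : dir u (fun _ : E => c) = fun _ => 0 := by
  funext s
  simp [dir]

lemma dir_add [CompleteSpace F] {f g : E → F} {s : E} (hf : AnalyticAt ℂ f s)
    (hg : AnalyticAt ℂ g s) (u : E) :
    dir u (fun x => f x + g x) =ᶠ[𝓝 s] fun x => dir u f x + dir u g x := by
  filter_upwards [hf.eventually_analyticAt, hg.eventually_analyticAt] with x hx hx'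
  simp only [dir]
  rw [fderiv_fun_add hx.differentiableAt hx'.differentiableAt]; rfl

lemma dir_mul {f g : E → ℂ} {s : E} (hf : AnalyticAt ℂ f s) (hg : AnalyticAt ℂ g s) (u : E) :
    dir u (fun x => f x * g x) =ᶠ[𝓝 s] fun x => dir u f x * g x + f x * dir u g x := by
  filter_upwards [hf.eventually_analyticAt, hg.eventually_analyticAt] with x hx hx'
  simp only [dir]
  rw [fderiv_fun_mul hx.differentiableAt hx'.differentiableAt]
  simp only [add_apply, smul_apply, smul_eq_mul]
  ring

lemma dir_dir_mul {f g : E → ℂ} {s : E} (hf : AnalyticAt ℂ f s) (hg : AnalyticAt ℂ g s)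
    (u c : E) : dir u (dir c fun x => f x * g x) =ᶠ[𝓝 s] fun x =>
      dir u (dir c f) x * g x + dir c f x * dir u g x + dir u f x * dir c g x +
        f x * dir u (dir c g) x := by
  have hf' := analyticAt_dir hf c
  have hg' := analyticAt_dir hg c
  filter_upwards [dir_congr (dir_mul hf hg c) u, dir_add (hf'.fun_mul hg) (hf.fun_mul hg') u,
    dir_mul hf' hg u, dir_mul hf hg' u] with x h1 h2 h3 h4
  rw [h1, h2, h3, h4]
  ring

lemma dir_dir_dir_mul {f g : E → ℂ} {s : E} (hf : AnalyticAt ℂ f s) (hg : AnalyticAt ℂ g s)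
    (u : E) : dir u (dir u (dir u fun x => f x * g x)) s =
      dir u (dir u (dir u f)) s * g s + 3 * (dir u (dir u f) s * dir u g s) +
        3 * (dir u f s * dir u (dir u g) s) + f s * dir u (dir u (dir u g)) s := by
  have hf' := analyticAt_dir hf u
  have hg' := analyticAt_dir hg u
  rw [(dir_congr (dir_congr (dir_mul hf hg u) u) u).eq_of_nhds,
    (dir_congr (dir_add (hf'.fun_mul hg) (hf.fun_mul hg') u) u).eq_of_nhds,
    (dir_add (analyticAt_dir (hf'.fun_mul hg) u) (analyticAt_dir (hf.fun_mul hg') u) u).eq_of_nhds,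
    (dir_dir_mul hf' hg u u).eq_of_nhds, (dir_dir_mul hf hg' u u).eq_of_nhds]
  ring

/-- The combination of derivatives of order at most one with coefficients `e`. -/
def jet₁ (e : ℂ × E) (f : E → F) (s : E) : F := e.1 • f s + dir e.2 f s

/-- The combination, with coefficients `e`, of the derivatives that span the dual of the functions
modulo the square of the ideal of the tangent vector `u`. -/
def jet (u : E) (e : ℂ × E × E × ℂ) (f : E → F) (s : E) : F :=
  e.1 • f s + dir e.2.1 f s + dir u (dir e.2.2.1 f) s + e.2.2.2 • dir u (dir u (dir u f)) s

lemma jet₁_congr {f g : E → F} {s : E} (h : f =ᶠ[𝓝 s] g) (e : ℂ × E) :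
    jet₁ e f s = jet₁ e g s := by
  simp only [jet₁, h.eq_of_nhds, (dir_congr h _).eq_of_nhds]

lemma jet_congr {f g : E → F} {s : E} (h : f =ᶠ[𝓝 s] g) (u : E) (e : ℂ × E × E × ℂ) :
    jet u e f s = jet u e g s := by
  simp only [jet, h.eq_of_nhds, (dir_congr h _).eq_of_nhds,
    (dir_congr (dir_congr h _) _).eq_of_nhds, (dir_congr (dir_congr (dir_congr h _) _) _).eq_of_nhds]

lemma jet₁_clm [CompleteSpace F] {f : E → F} {s : E} (hf : AnalyticAt ℂ f s) (ℓ : F →L[ℂ] F')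
    (e : ℂ × E) : jet₁ e (fun x => ℓ (f x)) s = ℓ (jet₁ e f s) := by
  simp only [jet₁, (dir_clm hf ℓ _).eq_of_nhds, map_add, map_smul]

lemma jet_clm [CompleteSpace F] {f : E → F} {s : E} (hf : AnalyticAt ℂ f s) (ℓ : F →L[ℂ] F')
    (u : E) (e : ℂ × E × E × ℂ) : jet u e (fun x => ℓ (f x)) s = ℓ (jet u e f s) := by
  have h1 : ∀ c, dir u (dir c fun x => ℓ (f x)) =ᶠ[𝓝 s] fun x => ℓ (dir u (dir c f) x) := fun c =>
    (dir_congr (dir_clm hf ℓ c) u).trans (dir_clm (analyticAt_dir hf c) ℓ u)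
  have h2 : dir u (dir u (dir u fun x => ℓ (f x))) =ᶠ[𝓝 s] fun x => ℓ (dir u (dir u (dir u f)) x) :=
    (dir_congr (h1 u) u).trans (dir_clm (analyticAt_dir (analyticAt_dir hf u) u) ℓ u)
  simp only [jet, (dir_clm hf ℓ _).eq_of_nhds, (h1 _).eq_of_nhds, h2.eq_of_nhds, map_add, map_smul]

/-- Linearity in the inner direction `c` becomes visible through the second Fréchet derivative; it
makes `jet u` linear in its coefficients. -/
lemma dir_dir_apply {f : E → F} {s : E} (hf : ContDiffAt ℂ 2 f s) (u c : E) :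
    dir u (dir c f) s = fderiv ℂ (fderiv ℂ f) s u c := by
  have h := (hf.fderiv_right (m := 1) (by norm_num)).differentiableAt (by norm_num)
  change fderiv ℂ (fun x => fderiv ℂ f x c) s u = _
  rw [fderiv_clm_apply h (differentiableAt_const c)]
  simp

lemma dir_dir_add [CompleteSpace F] {f : E → F} {s : E} (hf : AnalyticAt ℂ f s) (u c c' : E) :
    dir u (dir (c + c') f) s = dir u (dir c f) s + dir u (dir c' f) s := by
  simp only [dir_dir_apply hf.contDiffAt, map_add]

lemma dir_dir_smul [CompleteSpace F] {f : E → F} {s : E} (hf : AnalyticAt ℂ f s) (u : E) (a : ℂ)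
    (c : E) : dir u (dir (a • c) f) s = a • dir u (dir c f) s := by
  simp only [dir_dir_apply hf.contDiffAt, map_smul]

/-- `jet₁` as a linear function of the coefficients. -/
def jetLinear₁ (f : E → F) (s : E) : ℂ × E →ₗ[ℂ] F where
  toFun e := jet₁ e f s
  map_add' e e' := by simp only [jet₁, dir, Prod.fst_add, Prod.snd_add, map_add, add_smul]; abel
  map_smul' a e := by
    simp only [jet₁, dir, Prod.smul_fst, Prod.smul_snd, map_smul, smul_add, smul_assoc,
      RingHom.id_apply]

lemma jet₁_smul (a : ℂ) (e : ℂ × E) (f : E → F) (s : E) : jet₁ (a • e) f s = a • jet₁ e f s :=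
  (jetLinear₁ f s).map_smul a e

/-- `jet` as a linear function of the coefficients. -/
def jetLinear [CompleteSpace F] {f : E → F} {s : E} (hf : AnalyticAt ℂ f s) (u : E) :
    ℂ × E × E × ℂ →ₗ[ℂ] F where
  toFun e := jet u e f s
  map_add' e e' := by
    simp only [jet, Prod.fst_add, Prod.snd_add, dir_dir_add hf, add_smul]
    rw [show dir (e.2.1 + e'.2.1) f s = dir e.2.1 f s + dir e'.2.1 f s by simp [dir]]
    abel
  map_smul' a e := by
    simp only [jet, Prod.smul_fst, Prod.smul_snd, dir_dir_smul hf, smul_add, smul_assoc,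
      RingHom.id_apply]
    rw [show dir (a • e.2.1) f s = a • dir e.2.1 f s by simp [dir]]

lemma jet₁_mul {f g : E → ℂ} {s : E} (hf : AnalyticAt ℂ f s) (hg : AnalyticAt ℂ g s)
    (e : ℂ × E) : jet₁ e (fun x => f x * g x) s =
      e.1 * (f s * g s) + (dir e.2 f s * g s + f s * dir e.2 g s) := by
  rw [jet₁, (dir_mul hf hg _).eq_of_nhds, smul_eq_mul]

/-- The functionals `jet u e` vanish on the square of the ideal of the tangent vector `u`. -/
lemma jet_mul_mul_eq_zero {k f g : E → ℂ} {s u : E} (hk : AnalyticAt ℂ k s)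
    (hf : AnalyticAt ℂ f s) (hg : AnalyticAt ℂ g s) (hf0 : f s = 0) (hfu : dir u f s = 0)
    (hg0 : g s = 0) (hgu : dir u g s = 0) (e : ℂ × E × E × ℂ) :
    jet u e (fun x => k x * (f x * g x)) s = 0 := by
  have hfg := hf.fun_mul hg
  simp only [jet, (dir_mul hk hfg _).eq_of_nhds, (dir_dir_mul hk hfg _ _).eq_of_nhds,
    dir_dir_dir_mul hk hfg, dir_dir_dir_mul hf hg, (dir_mul hf hg _).eq_of_nhds,
    (dir_dir_mul hf hg _ _).eq_of_nhds, hf0, hg0, hfu, hgu]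
  simp

lemma jet₁_mul_mul_eq_zero {k f g : E → ℂ} {s : E} (hk : AnalyticAt ℂ k s)
    (hf : AnalyticAt ℂ f s) (hg : AnalyticAt ℂ g s) (hf0 : f s = 0) (hg0 : g s = 0) (e : ℂ × E) :
    jet₁ e (fun x => k x * (f x * g x)) s = 0 := by
  rw [jet₁_mul hk (hf.fun_mul hg), (dir_mul hf hg _).eq_of_nhds, hf0, hg0]
  simp

end Derivatives

namespace Chart

variable {N n : ℕ} {S : Set (Fin (N + 1) → ℂ)}

lemma L_dir (κ : Chart S n) {s : Fin n → ℂ} (hs : s ∈ κ.dom) (b : Fin n → ℂ) :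
    κ.L (dir b κ.φ s) = 0 := by
  rw [← (dir_clm (κ.analyticAt s hs) κ.L b).eq_of_nhds]
  have : (fun x => κ.L (κ.φ x)) =ᶠ[𝓝 s] fun _ => 1 := by
    filter_upwards [κ.isOpen_dom.mem_nhds hs] with x hx using κ.L_φ x hx
  rw [(dir_congr this b).eq_of_nhds, dir_const]

lemma π_dir (κ : Chart S n) {s : Fin n → ℂ} (hs : s ∈ κ.dom) (b : Fin n → ℂ) :
    κ.π (dir b κ.φ s) = b := by
  rw [← (dir_clm (κ.analyticAt s hs) κ.π b).eq_of_nhds]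
  have : (fun x => κ.π (κ.φ x)) =ᶠ[𝓝 s] fun x => x := by
    filter_upwards [κ.isOpen_dom.mem_nhds hs] with x hx using κ.π_φ x hx
  rw [(dir_congr this b).eq_of_nhds]
  simp [dir]

/-- Since `L ∘ φ = 1` and `π ∘ φ = id`, applying `L` reads off the scalar coefficient and then `π`
the tangent direction. -/
lemma jet₁_injective (κ : Chart S n) {s : Fin n → ℂ} (hs : s ∈ κ.dom) {e : ℂ × (Fin n → ℂ)}
    (h : jet₁ e κ.φ s = 0) : e = 0 := by
  have h1 := congrArg κ.L h
  rw [jet₁, map_add, map_smul, κ.L_φ s hs, κ.L_dir hs, map_zero, smul_eq_mul, mul_one,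
    add_zero] at h1
  have h2 := congrArg κ.π h
  rw [jet₁, map_add, map_smul, h1, zero_smul, zero_add, κ.π_dir hs, map_zero] at h2
  exact Prod.ext h1 h2

/-- Products of three linear forms separate the jets along a tangent vector. -/
lemma eq_zero_of_jet_eq_zero (κ : Chart S n) {s u : Fin n → ℂ} (hs : s ∈ κ.dom) (hu : u ≠ 0)
    {e : ℂ × (Fin n → ℂ) × (Fin n → ℂ) × ℂ}
    (h : ∀ ξ₁ ξ₂ ξ₃ : (Fin (N + 1) → ℂ) →L[ℂ] ℂ,
      jet u e (fun x => ξ₁ (κ.φ x) * (ξ₂ (κ.φ x) * ξ₃ (κ.φ x))) s = 0) : e = 0 := by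
  obtain ⟨a, b, c, d⟩ := e
  have hφ := κ.analyticAt s hs
  -- On the chart `ξ i` restricts to the centred coordinate `x i - s i` and `L` to `1`, so cubics
  -- restrict to all local monomials of degree at most three.
  let ξ : Fin n → ((Fin (N + 1) → ℂ) →L[ℂ] ℂ) := fun i =>
    (ContinuousLinearMap.proj i).comp κ.π - s i • κ.L
  have hL : (fun x => κ.L (κ.φ x)) =ᶠ[𝓝 s] fun _ => 1 := by
    filter_upwards [κ.isOpen_dom.mem_nhds hs] with x hx using κ.L_φ x hx
  have hξ : ∀ i, (fun x => ξ i (κ.φ x)) =ᶠ[𝓝 s] fun x => x i - s i := fun i => by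
    filter_upwards [κ.isOpen_dom.mem_nhds hs] with x hx
    simp [ξ, κ.π_φ x hx, κ.L_φ x hx]
  have hx : ∀ i, AnalyticAt ℂ (fun x : Fin n → ℂ => x i - s i) s := fun i =>
    ((ContinuousLinearMap.proj (R := ℂ) (φ := fun _ : Fin n => ℂ) i).analyticAt s).sub
      analyticAt_const
  have h1 : AnalyticAt ℂ (fun _ : Fin n → ℂ => (1 : ℂ)) s := analyticAt_const
  have hdir : ∀ i v, dir v (fun x : Fin n → ℂ => x i - s i) = fun _ => v i := fun i v => by
    funext x
    simp only [dir]
    rw [fderiv_sub_const, (hasFDerivAt_apply (𝕜 := ℂ) i x).fderiv]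
    rfl
  obtain ⟨i₀, hi₀⟩ := Function.ne_iff.1 hu
  have hi₀' : u i₀ ≠ 0 := hi₀
  have h' : ∀ {ξ₁ ξ₂ ξ₃ : (Fin (N + 1) → ℂ) →L[ℂ] ℂ} {f₁ f₂ f₃ : (Fin n → ℂ) → ℂ},
      (fun x => ξ₁ (κ.φ x)) =ᶠ[𝓝 s] f₁ → (fun x => ξ₂ (κ.φ x)) =ᶠ[𝓝 s] f₂ →
      (fun x => ξ₃ (κ.φ x)) =ᶠ[𝓝 s] f₃ →
      jet u (a, b, c, d) (fun x => f₁ x * (f₂ x * f₃ x)) s = 0 := by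
    intro ξ₁ ξ₂ ξ₃ f₁ f₂ f₃ h₁ h₂ h₃
    rw [← h ξ₁ ξ₂ ξ₃]
    exact jet_congr (h₁.mul (h₂.mul h₃)).symm u _
  -- The monomials of degree 0, 1, 2, 3 isolate `a`, `b`, `c`, `d` in turn. The last two use the
  -- index `i₀` with `u i₀ ≠ 0`: they yield `c i * u j + u i * c j` and `6 * d * u i₀ ^ 3`.
  have e0 := h' hL hL hL
  have e1 := fun i => h' hL hL (hξ i)
  have e2 := fun i j => h' hL (hξ i) (hξ j)
  have e3 := h' (hξ i₀) (hξ i₀) (hξ i₀)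
  simp only [jet, one_mul, mul_one, hdir, dir_const, (dir_mul (hx _) (hx _) _).eq_of_nhds,
    (dir_dir_mul (hx _) (hx _) _ _).eq_of_nhds, dir_dir_dir_mul (hx _) (hx _), smul_eq_mul,
    sub_self, mul_zero, zero_mul, add_zero, zero_add,
    (dir_mul (hx _) ((hx _).fun_mul (hx _)) _).eq_of_nhds,
    (dir_dir_mul (hx _) ((hx _).fun_mul (hx _)) _ _).eq_of_nhds,
    dir_dir_dir_mul (hx _) ((hx _).fun_mul (hx _))] at e0 e1 e2 e3
  have hd : d = 0 := by
    have : d * (6 * u i₀ ^ 3) = 0 := by linear_combination e3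
    exact (mul_eq_zero.1 this).resolve_right
      (mul_ne_zero (by norm_num) (pow_ne_zero _ hi₀'))
  have hc₀ : c i₀ = 0 := by
    have : u i₀ * (2 * c i₀) = 0 := by linear_combination e2 i₀ i₀
    simpa [hi₀'] using this
  have hc : c = 0 := by
    ext j
    have := e2 i₀ j
    rw [hc₀, zero_mul, zero_add] at this
    exact (mul_eq_zero.1 this).resolve_left hi₀'
  exact Prod.ext e0 (Prod.ext (funext e1) (Prod.ext hc hd))

/-- Products of three linear forms separate the first order jets at two points. -/
lemma eq_zero_of_jet₁_add_jet₁_eq_zero (κ κ' : Chart S n) {s s' : Fin n → ℂ} (hs : s ∈ κ.dom)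
    (hs' : s' ∈ κ'.dom) (hne : ∀ a : ℂ, κ.φ s ≠ a • κ'.φ s') {e e' : ℂ × (Fin n → ℂ)}
    (h : ∀ ξ₁ ξ₂ ξ₃ : (Fin (N + 1) → ℂ) →L[ℂ] ℂ,
      jet₁ e (fun x => ξ₁ (κ.φ x) * (ξ₂ (κ.φ x) * ξ₃ (κ.φ x))) s +
      jet₁ e' (fun x => ξ₁ (κ'.φ x) * (ξ₂ (κ'.φ x) * ξ₃ (κ'.φ x))) s' = 0) : e = 0 := by
  have hφ := κ.analyticAt s hs
  have hφ' := κ'.analyticAt s' hs'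
  -- The cubic `ξ ζ²` vanishes doubly at the second point, so only the jet at the first point
  -- survives.
  obtain ⟨ζ, hζ, hζ'⟩ : ∃ ζ : (Fin (N + 1) → ℂ) →L[ℂ] ℂ, ζ (κ.φ s) ≠ 0 ∧ ζ (κ'.φ s') = 0 := by
    have hmem : κ.φ s ∉ Submodule.span ℂ {κ'.φ s'} := fun hm => by
      obtain ⟨a, ha⟩ := Submodule.mem_span_singleton.1 hm
      exact hne a ha.symm
    obtain ⟨f, hf, hf'⟩ := Submodule.exists_le_ker_of_notMem hmem
    exact ⟨LinearMap.toContinuousLinearMap f, hf,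
      hf' (Submodule.mem_span_singleton_self _)⟩
  have han : ∀ ξ : (Fin (N + 1) → ℂ) →L[ℂ] ℂ, AnalyticAt ℂ (fun x => ξ (κ.φ x)) s := fun ξ =>
    (ξ.analyticAt _).comp hφ
  have han' : ∀ ξ : (Fin (N + 1) → ℂ) →L[ℂ] ℂ, AnalyticAt ℂ (fun x => ξ (κ'.φ x)) s' := fun ξ =>
    (ξ.analyticAt _).comp hφ'
  have key : ∀ ξ : (Fin (N + 1) → ℂ) →L[ℂ] ℂ, ξ (ζ (κ.φ s) • jet₁ e κ.φ s +
      (2 * ζ (dir e.2 κ.φ s)) • κ.φ s) = 0 := by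
    intro ξ
    have h1 := h ξ ζ ζ
    rw [jet₁_mul_mul_eq_zero (han' ξ) (han' ζ) (han' ζ) hζ' hζ', add_zero,
      jet₁_mul (han ξ) ((han ζ).fun_mul (han ζ)), (dir_mul (han ζ) (han ζ) _).eq_of_nhds,
      (dir_clm hφ ξ _).eq_of_nhds, (dir_clm hφ ζ _).eq_of_nhds] at h1
    simp only [jet₁, map_add, map_smul, smul_eq_mul]
    refine (mul_eq_zero.1 (?_ : ζ (κ.φ s) * _ = 0)).resolve_left hζ
    linear_combination h1
  have h2 := SeparatingDual.eq_zero_of_forall_dual_eq_zero (R := ℂ) key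
  -- Multiplication by `ζ²`, after cancelling one factor `ζ`, changes the coefficients of the jet
  -- triangularly with diagonal `ζ (κ.φ s) ≠ 0`.
  have h3 : jet₁ (ζ (κ.φ s) • e + (2 * ζ (dir e.2 κ.φ s), 0)) κ.φ s = 0 := by
    rw [← h2]
    have := (jetLinear₁ κ.φ s).map_add (ζ (κ.φ s) • e) (2 * ζ (dir e.2 κ.φ s), 0)
    rw [map_smul] at this
    refine this.trans ?_
    simp [jetLinear₁, jet₁, dir]
  have h4 := κ.jet₁_injective hs h3
  have h5 : e.2 = 0 := by
    have := congrArg Prod.snd h4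
    simpa [hζ] using this
  have h6 := congrArg Prod.fst h4
  rw [h5] at h6
  exact Prod.ext (by simpa [hζ, dir] using h6) h5

end Chart

end SkewEmbedding

end

/-! ### Hausdorff dimension of the spans and generic linear maps -/

noncomputable section

namespace SkewEmbedding

section Dimension

variable {E F : Type*} [NormedAddCommGroup E] [NormedSpace ℂ E] [NormedAddCommGroup F]
  [NormedSpace ℂ F] [CompleteSpace F]

lemma contDiffAt_jet₁ {f : E → F} {s : E} (hf : AnalyticAt ℂ f s) (e : ℂ × E) :
    ContDiffAt ℂ 1 (fun p : E × ℂ × E => jet₁ p.2 f p.1) (s, e) := by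
  have h0 : ContDiffAt ℂ 1 (fun p : E × ℂ × E => f p.1) (s, e) :=
    hf.contDiffAt.comp (s, e) contDiffAt_fst
  have h1 : ContDiffAt ℂ 1 (fun p : E × ℂ × E => fderiv ℂ f p.1) (s, e) :=
    hf.fderiv.contDiffAt.comp (s, e) contDiffAt_fst
  exact (contDiffAt_snd.fst.smul h0).add (h1.clm_apply contDiffAt_snd.snd)

lemma dir_dir_dir_apply {f : E → F} {s : E} (hf : AnalyticAt ℂ f s) (u : E) :
    dir u (dir u (dir u f)) s = fderiv ℂ (fderiv ℂ (fderiv ℂ f)) s u u u := by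
  let ℓ : (E →L[ℂ] E →L[ℂ] F) →L[ℂ] F :=
    (ContinuousLinearMap.apply ℂ F u).comp (ContinuousLinearMap.apply ℂ (E →L[ℂ] F) u)
  have h1 : dir u (dir u f) =ᶠ[𝓝 s] fun x => ℓ (fderiv ℂ (fderiv ℂ f) x) := by
    filter_upwards [hf.eventually_analyticAt] with x hx using dir_dir_apply hx.contDiffAt u u
  rw [(dir_congr h1 u).eq_of_nhds, (dir_clm hf.fderiv.fderiv ℓ u).eq_of_nhds]
  rfl

lemma contDiffAt_fderiv_apply {f : E → F} {s : E} (hf : AnalyticAt ℂ f s) (u : E) :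
    ContDiffAt ℂ 1 (fun p : E × E => fderiv ℂ f p.1 p.2) (s, u) := by
  have h : ContDiffAt ℂ 1 (fun p : E × E => fderiv ℂ f p.1) (s, u) :=
    hf.fderiv.contDiffAt.comp (s, u) contDiffAt_fst
  exact h.clm_apply contDiffAt_snd

lemma contDiffAt_jet {f : E → F} {s : E} (hf : AnalyticAt ℂ f s) (u : E)
    (e : ℂ × E × E × ℂ) :
    ContDiffAt ℂ 1 (fun p : E × E × ℂ × E × E × ℂ => jet p.2.1 p.2.2 f p.1) (s, u, e) := by
  have h0 : ContDiffAt ℂ 1 (fun p : E × E × ℂ × E × E × ℂ => f p.1) (s, u, e) :=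
    hf.contDiffAt.comp (s, u, e) contDiffAt_fst
  have h1 : ContDiffAt ℂ 1 (fun p : E × E × ℂ × E × E × ℂ => fderiv ℂ f p.1) (s, u, e) :=
    hf.fderiv.contDiffAt.comp (s, u, e) contDiffAt_fst
  have h2 : ContDiffAt ℂ 1 (fun p : E × E × ℂ × E × E × ℂ => fderiv ℂ (fderiv ℂ f) p.1)
      (s, u, e) := hf.fderiv.fderiv.contDiffAt.comp (s, u, e) contDiffAt_fst
  have hu : ContDiffAt ℂ 1 (fun p : E × E × ℂ × E × E × ℂ => p.2.1) (s, u, e) :=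
    contDiffAt_snd.fst
  have h3 : ContDiffAt ℂ 1 (fun p : E × E × ℂ × E × E × ℂ =>
      fderiv ℂ (fderiv ℂ (fderiv ℂ f)) p.1 p.2.1) (s, u, e) :=
    ContDiffAt.comp (g := fun q : E × E => fderiv ℂ (fderiv ℂ (fderiv ℂ f)) q.1 q.2)
      (f := fun p : E × E × ℂ × E × E × ℂ => (p.1, p.2.1)) (s, u, e)
      (contDiffAt_fderiv_apply hf.fderiv.fderiv u) (contDiffAt_fst.prodMk hu)
  have he : ContDiffAt ℂ 1 (fun p : E × E × ℂ × E × E × ℂ => p.2.2) (s, u, e) :=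
    contDiffAt_snd.snd
  refine ContDiffAt.congr_of_eventuallyEq ((((he.fst.smul h0).add
    (h1.clm_apply he.snd.fst)).add ((h2.clm_apply hu).clm_apply he.snd.snd.fst)).add
    (he.snd.snd.snd.smul ((h3.clm_apply hu).clm_apply hu))) ?_
  filter_upwards [continuousAt_fst.eventually hf.eventually_analyticAt] with p hp
  simp only [jet]
  rw [dir_dir_dir_apply hp, dir_dir_apply hp.contDiffAt]
  rfl

end Dimension

lemma dimH_image_le_of_contDiffAt {F G : Type*} [NormedAddCommGroup F]
    [NormedSpace ℂ F] [NormedAddCommGroup G] [NormedSpace ℂ G]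
    [FiniteDimensional ℂ G] [NormedSpace ℝ G] [IsScalarTower ℝ ℂ G] [NormedSpace ℝ F]
    
    [IsScalarTower ℝ ℂ F] {f : G → F}
    {t : Set G} (ht : Convex ℝ t) (hf : ∀ x ∈ t, ContDiffAt ℂ 1 f x) :
    dimH (f '' t) ≤ (Module.finrank ℝ G : ℕ) := by
  have : FiniteDimensional ℝ G := FiniteDimensional.trans ℝ ℂ G
  have h : ContDiffOn ℝ 1 f t := fun x hx => ((hf x hx).restrict_scalars ℝ).contDiffWithinAt
  refine (h.dimH_image_le ht subset_rfl).trans ?_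
  rw [← Real.dimH_univ_eq_finrank G]
  exact dimH_mono (Set.subset_univ t)

/-- A cone of real dimension at most `2 d` is mapped to `ℂ^d` by some linear map without contracting
any of its lines. -/
lemma exists_linearMap_of_dimH_le (d : ℕ) : ∀ (m : ℕ) (Z : Set (Fin m → ℂ)),
    (∀ z ∈ Z, ∀ c : ℂ, c • z ∈ Z) → dimH Z ≤ (2 * d : ℕ) →
    ∃ A : (Fin m → ℂ) →ₗ[ℂ] (Fin d → ℂ), ∀ z ∈ Z, A z = 0 → z = 0 := by
  intro m
  induction m with
  | zero => exact fun Z _ _ => ⟨0, fun z _ _ => Subsingleton.elim _ _⟩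
  | succ m ih =>
    intro Z hZ hdim
    by_cases hmd : m + 1 ≤ d
    -- Enough room: repeat the coordinates cyclically. The first `m + 1` entries already determine
    -- `z`.
    · refine ⟨LinearMap.funLeft ℂ ℂ (fun i : Fin d => (Fin.ofNat (m + 1) i)), fun z _ hz => ?_⟩
      ext i
      have := congrFun hz (Fin.castLE hmd i)
      rw [LinearMap.funLeft_apply] at this
      have h2 : Fin.ofNat (m + 1) ((Fin.castLE hmd i : Fin d) : ℕ) = i := by
        ext; simp
      rwa [h2] at this
    · rcases Z.eq_empty_or_nonempty with rfl | ⟨z₁, hz₁⟩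
      · exact ⟨0, fun z hz => absurd hz (Set.notMem_empty z)⟩
      -- Here `d < m + 1`, so `Z` is too small to fill the space. As `Z` is a cone, it meets the
      -- line of `w` only in zero, and the projection from that line is Lipschitz and does not raise
      -- the dimension.
      obtain ⟨w, hw⟩ : ∃ w, w ∉ Z := by
        by_contra! hall
        rw [Set.eq_univ_of_forall hall, Real.dimH_univ_eq_finrank, finrank_real_of_complex,
          Module.finrank_fin_fun] at hdim
        have : 2 * (m + 1) ≤ 2 * d := by exact_mod_cast hdim
        omega
      have hw0 : w ≠ 0 := by
        rintro rfl
        exact hw (by simpa using hZ z₁ hz₁ 0)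
      have hfin : Module.finrank ℂ ((Fin (m + 1) → ℂ) ⧸ (Submodule.span ℂ {w})) =
          Module.finrank ℂ (Fin m → ℂ) := by
        have := Submodule.finrank_quotient_add_finrank (Submodule.span ℂ {w})
        rw [finrank_span_singleton hw0, Module.finrank_fin_fun] at this
        rw [Module.finrank_fin_fun]
        omega
      let B : (Fin (m + 1) → ℂ) →ₗ[ℂ] (Fin m → ℂ) :=
        (LinearEquiv.ofFinrankEq _ _ hfin).toLinearMap ∘ₗ (Submodule.span ℂ {w}).mkQ
      have hB : ∀ z ∈ Z, B z = 0 → z = 0 := by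
        intro z hz hBz
        have h1 : (Submodule.span ℂ {w}).mkQ z = 0 := (LinearEquiv.map_eq_zero_iff _).1 hBz
        rw [Submodule.mkQ_apply, Submodule.Quotient.mk_eq_zero,
          Submodule.mem_span_singleton] at h1
        obtain ⟨a, rfl⟩ := h1
        by_cases ha : a = 0
        · rw [ha, zero_smul]
        · exact absurd (by simpa [smul_smul, ha] using hZ _ hz a⁻¹) hw
      obtain ⟨A, hA⟩ := ih (B '' Z) (by
          rintro _ ⟨z, hz, rfl⟩ c
          exact ⟨c • z, hZ z hz c, map_smul B c z⟩)
        (((LinearMap.toContinuousLinearMap B).lipschitz.dimH_image_le Z).trans hdim)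
      exact ⟨A ∘ₗ B, fun z hz h => hB z hz (hA _ ⟨z, hz, rfl⟩ h)⟩

lemma exists_linearMap_of_dimH_le' {ι : Type*} [Fintype ι] (d : ℕ) (Z : Set (ι → ℂ))
    (hZ : ∀ z ∈ Z, ∀ c : ℂ, c • z ∈ Z) (hdim : dimH Z ≤ (2 * d : ℕ)) :
    ∃ A : (ι → ℂ) →ₗ[ℂ] (Fin d → ℂ), ∀ z ∈ Z, A z = 0 → z = 0 := by
  let e : (ι → ℂ) ≃ₗ[ℂ] (Fin (Fintype.card ι) → ℂ) :=
    LinearEquiv.funCongrLeft ℂ ℂ (Fintype.equivFin ι).symm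
  obtain ⟨A, hA⟩ := exists_linearMap_of_dimH_le d _ (e '' Z) (by
      rintro _ ⟨z, hz, rfl⟩ c
      exact ⟨c • z, hZ z hz c, map_smul e c z⟩)
    (((LinearMap.toContinuousLinearMap e.toLinearMap).lipschitz.dimH_image_le Z).trans hdim)
  exact ⟨A ∘ₗ e.toLinearMap, fun z hz h =>
    (LinearEquiv.map_eq_zero_iff e).1 (hA _ ⟨z, hz, rfl⟩ h)⟩

variable {N n : ℕ}

/-- All products of three coordinates. -/
def veronese (N : ℕ) (t : Fin (N + 1) × Fin (N + 1) × Fin (N + 1)) : Poly N :=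
  X t.1 * (X t.2.1 * X t.2.2)

lemma isHomogeneous_veronese (t : Fin (N + 1) × Fin (N + 1) × Fin (N + 1)) :
    (veronese N t).IsHomogeneous 3 :=
  (isHomogeneous_X ℂ _).mul ((isHomogeneous_X ℂ _).mul (isHomogeneous_X ℂ _))

lemma evalMap_veronese (x : Fin (N + 1) → ℂ) (t : Fin (N + 1) × Fin (N + 1) × Fin (N + 1)) :
    evalMap (veronese N) x t = x t.1 * (x t.2.1 * x t.2.2) := by
  simp [evalMap, veronese]

lemma analyticAt_evalMap {σ τ : Type*} [Fintype σ] [Fintype τ] (F : τ → MvPolynomial σ ℂ)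
    (x : σ → ℂ) : AnalyticAt ℂ (evalMap F) x :=
  analyticAt_pi_iff.2 fun j => analyticAt_eval (F j) x

/-- A product of three linear forms is a linear form on the Veronese variety. -/
lemma exists_clm_veronese (ξ₁ ξ₂ ξ₃ : (Fin (N + 1) → ℂ) →L[ℂ] ℂ) :
    ∃ ℓ : (Fin (N + 1) × Fin (N + 1) × Fin (N + 1) → ℂ) →L[ℂ] ℂ,
      ∀ x, ℓ (evalMap (veronese N) x) = ξ₁ x * (ξ₂ x * ξ₃ x) := by
  classical
  have hξ : ∀ (ξ : (Fin (N + 1) → ℂ) →L[ℂ] ℂ) (x : Fin (N + 1) → ℂ),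
      ξ x = ∑ i, x i * ξ (Pi.single i 1) := fun ξ x => by
    conv_lhs => rw [pi_eq_sum_univ' x]
    simp
  refine ⟨∑ t, (ξ₁ (Pi.single t.1 1) * (ξ₂ (Pi.single t.2.1 1) * ξ₃ (Pi.single t.2.2 1))) •
    ContinuousLinearMap.proj t, fun x => ?_⟩
  rw [hξ ξ₁, hξ ξ₂, hξ ξ₃, Finset.sum_mul_sum, Finset.sum_mul_sum]
  simp only [sum_apply, smul_apply,
    ContinuousLinearMap.proj_apply, evalMap_veronese, smul_eq_mul, Fintype.sum_prod_type,
    Finset.mul_sum]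
  refine Finset.sum_congr rfl fun i _ => Finset.sum_congr rfl fun j _ =>
    Finset.sum_congr rfl fun k _ => by ring

namespace Chart

variable {S : Set (Fin (N + 1) → ℂ)}

lemma analyticAt_evalMap (κ : Chart S n) {τ : Type*} [Fintype τ] (F : τ → Poly N)
    {s : Fin n → ℂ} (hs : s ∈ κ.dom) : AnalyticAt ℂ (fun x => evalMap F (κ.φ x)) s :=
  (SkewEmbedding.analyticAt_evalMap F _).comp (κ.analyticAt s hs)

end Chart

/-- The union of the linear spans of the doubles of all length two subschemes of the Veronese image
of a cone that are seen by the charts in `𝒞`. -/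
def doubleSpans {S : Set (Fin (N + 1) → ℂ)} (𝒞 : Set (Chart S n)) :
    Set (Fin (N + 1) × Fin (N + 1) × Fin (N + 1) → ℂ) :=
  (⋃ κ ∈ 𝒞, ⋃ κ' ∈ 𝒞, (fun p : ((Fin n → ℂ) × ℂ × (Fin n → ℂ)) × (Fin n → ℂ) × ℂ × (Fin n → ℂ) =>
    jet₁ p.1.2 (fun x => evalMap (veronese N) (κ.φ x)) p.1.1 +
    jet₁ p.2.2 (fun x => evalMap (veronese N) (κ'.φ x)) p.2.1) ''
      ((κ.dom ×ˢ Set.univ) ×ˢ (κ'.dom ×ˢ Set.univ))) ∪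
  ⋃ κ ∈ 𝒞, (fun p : (Fin n → ℂ) × (Fin n → ℂ) × ℂ × (Fin n → ℂ) × (Fin n → ℂ) × ℂ =>
    jet p.2.1 p.2.2 (fun x => evalMap (veronese N) (κ.φ x)) p.1) '' (κ.dom ×ˢ Set.univ)

/-- Count of complex parameters: a pair uses `2 * (n + (1 + n))`, and a tangent vector uses `n` for
the point, `n` for the direction and `2n + 2` for the coefficients. Both are `4n + 2`, and `C^1`
maps do not raise the dimension. -/
lemma dimH_doubleSpans_le {S : Set (Fin (N + 1) → ℂ)} {𝒞 : Set (Chart S n)} (h𝒞 : 𝒞.Countable) :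
    dimH (doubleSpans 𝒞) ≤ (2 * (4 * n + 2) : ℕ) := by
  have hconv : ∀ κ : Chart S n, Convex ℝ κ.dom := fun κ => convex_ball _ _
  rw [doubleSpans, dimH_union]
  refine max_le ?_ ?_
  · rw [dimH_bUnion h𝒞]
    refine iSup₂_le fun κ _ => ?_
    rw [dimH_bUnion h𝒞]
    refine iSup₂_le fun κ' _ => ?_
    have hc1 : Convex ℝ (κ.dom ×ˢ (Set.univ : Set (ℂ × (Fin n → ℂ)))) := (hconv κ).prod convex_univ
    have hc2 : Convex ℝ (κ'.dom ×ˢ (Set.univ : Set (ℂ × (Fin n → ℂ)))) :=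
      (hconv κ').prod convex_univ
    have hc3 := hc1.prod hc2
    refine (dimH_image_le_of_contDiffAt hc3 ?_).trans ?_
    · rintro ⟨⟨s, e⟩, s', e'⟩ ⟨⟨hs, -⟩, hs', -⟩
      refine ContDiffAt.add ?_ ?_
      · exact ContDiffAt.comp (f := Prod.fst)
          (g := fun q : (Fin n → ℂ) × ℂ × (Fin n → ℂ) =>
            jet₁ q.2 (fun x => evalMap (veronese N) (κ.φ x)) q.1) ((s, e), s', e')
          (contDiffAt_jet₁ (κ.analyticAt_evalMap _ hs) e) contDiffAt_fst
      · exact ContDiffAt.comp (f := Prod.snd)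
          (g := fun q : (Fin n → ℂ) × ℂ × (Fin n → ℂ) =>
            jet₁ q.2 (fun x => evalMap (veronese N) (κ'.φ x)) q.1) ((s, e), s', e')
          (contDiffAt_jet₁ (κ'.analyticAt_evalMap _ hs') e') contDiffAt_snd
    · rw [finrank_real_of_complex]
      simp only [Module.finrank_prod, Module.finrank_fin_fun, Module.finrank_self]
      norm_cast
      omega
  · rw [dimH_bUnion h𝒞]
    refine iSup₂_le fun κ _ => ?_
    have hc : Convex ℝ (κ.dom ×ˢ (Set.univ : Set ((Fin n → ℂ) × ℂ × (Fin n → ℂ) × (Fin n → ℂ) × ℂ))) :=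
      (hconv κ).prod convex_univ
    refine (dimH_image_le_of_contDiffAt hc ?_).trans ?_
    · rintro ⟨s, u, e⟩ ⟨hs, -⟩
      exact contDiffAt_jet (κ.analyticAt_evalMap _ hs) u e
    · rw [finrank_real_of_complex]
      simp only [Module.finrank_prod, Module.finrank_fin_fun, Module.finrank_self]
      norm_cast
      omega

lemma smul_mem_doubleSpans {S : Set (Fin (N + 1) → ℂ)} {𝒞 : Set (Chart S n)} :
    ∀ z ∈ doubleSpans 𝒞, ∀ c : ℂ, c • z ∈ doubleSpans 𝒞 := by
  rintro z (hz | hz) c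
  · simp only [Set.mem_iUnion] at hz
    obtain ⟨κ, hκ, κ', hκ', ⟨⟨s, e⟩, s', e'⟩, ⟨⟨hs, -⟩, hs', -⟩, rfl⟩ := hz
    refine Or.inl (Set.mem_biUnion hκ (Set.mem_biUnion hκ'
      ⟨⟨⟨s, c • e⟩, s', c • e'⟩, ⟨⟨hs, trivial⟩, hs', trivial⟩, ?_⟩))
    have h1 := (jetLinear₁ (fun x => evalMap (veronese N) (κ.φ x)) s).map_smul c e
    have h2 := (jetLinear₁ (fun x => evalMap (veronese N) (κ'.φ x)) s').map_smul c e'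
    rw [smul_add]
    exact congrArg₂ (· + ·) h1 h2
  · simp only [Set.mem_iUnion] at hz
    obtain ⟨κ, hκ, ⟨s, u, e⟩, ⟨hs, -⟩, rfl⟩ := hz
    refine Or.inr (Set.mem_biUnion hκ ⟨⟨s, u, c • e⟩, ⟨hs, trivial⟩, ?_⟩)
    exact (jetLinear (κ.analyticAt_evalMap (veronese N) hs) u).map_smul c e

end SkewEmbedding

end

/-! ### Construction of the generic cubic forms -/

noncomputable section

namespace SkewEmbedding

variable {N n : ℕ}

namespace Chart

variable {S : Set (Fin (N + 1) → ℂ)}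

lemma dir_evalMap (κ : Chart S n) {τ : Type*} [Fintype τ] (F : τ → Poly N) {s : Fin n → ℂ}
    (hs : s ∈ κ.dom) (b : Fin n → ℂ) :
    dir b (fun x => evalMap F (κ.φ x)) s = fun j => dd (F j) (κ.φ s) (dir b κ.φ s) := by
  ext j
  have h := (dir_clm (κ.analyticAt_evalMap F hs) (ContinuousLinearMap.proj (R := ℂ)
    (φ := fun _ : τ => ℂ) j) b).eq_of_nhds
  have h2 := (hasFDerivAt_eval (F j) (κ.φ s)).comp s
    (κ.analyticAt s hs).differentiableAt.hasFDerivAt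
  refine h.symm.trans ?_
  change fderiv ℂ ((fun x => eval x (F j)) ∘ κ.φ) s b = _
  rw [h2.fderiv]
  rfl

lemma jet₁_mem_zt (κ : Chart S n) (hS : ∀ v ∈ S, ∀ c : ℂ, c ≠ 0 → c • v ∈ S) {s : Fin n → ℂ}
    (hs : s ∈ κ.dom) (e : ℂ × (Fin n → ℂ)) : jet₁ e κ.φ s ∈ zt S (κ.φ s) := by
  rw [mem_zt_iff_isHomogeneous hS]
  intro d P hP hPS
  have h1 := congrFun (κ.dir_evalMap (fun _ : Unit => P) hs e.2) ()
  have h2 : (fun x => evalMap (fun _ : Unit => P) (κ.φ x)) =ᶠ[𝓝 s] fun _ => 0 := by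
    filter_upwards [κ.isOpen_dom.mem_nhds hs] with x hx
    ext; exact hPS _ (κ.mem x hx)
  rw [(dir_congr h2 _).eq_of_nhds, dir_const] at h1
  rw [jet₁, dd_add_right, dd_smul_right, dd_self_of_isHomogeneous hP, hPS _ (κ.mem s hs), ← h1]
  simp

/-- The first order jets form a subspace of dimension `n + 1` of a tangent space of dimension at
most `n + 1`. -/
lemma exists_eq_jet₁_of_mem_zt (κ : Chart S n) (hS : ∀ v ∈ S, ∀ c : ℂ, c ≠ 0 → c • v ∈ S)
    {s : Fin n → ℂ} (hs : s ∈ κ.dom) (hfin : Module.finrank ℂ (zt S (κ.φ s)) ≤ n + 1)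
    {t : Fin (N + 1) → ℂ} (ht : t ∈ zt S (κ.φ s)) : ∃ e, t = jet₁ e κ.φ s := by
  have hle : LinearMap.range (jetLinear₁ κ.φ s) ≤ zt S (κ.φ s) := by
    rintro _ ⟨e, rfl⟩
    exact κ.jet₁_mem_zt hS hs e
  have hinj : Function.Injective (jetLinear₁ κ.φ s) := by
    rw [injective_iff_map_eq_zero]
    exact fun e he => κ.jet₁_injective hs he
  have h1 := LinearMap.finrank_range_of_inj hinj
  rw [Module.finrank_prod, Module.finrank_fin_fun, Module.finrank_self] at h1
  have h2 := Submodule.eq_of_le_of_finrank_le hle (by omega)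
  rw [← h2] at ht
  obtain ⟨e, he⟩ := ht
  exact ⟨e, he.symm⟩

/-- If `F` has a local inverse, the tangent spaces of the image of a chart are spanned by its
derivatives. -/
lemma exists_eq_jet₁_of_mem_zt_image (κ : Chart S n)
    (hS : ∀ v ∈ S, ∀ c : ℂ, c ≠ 0 → c • v ∈ S) {τ : Type*} [Fintype τ] {F : τ → Poly N} {d : ℕ}
    (hF : ∀ j, (F j).IsHomogeneous d) (hinv : HasLocalInverse S F) {s : Fin n → ℂ}
    (hs : s ∈ κ.dom) (hfin : Module.finrank ℂ (zt S (κ.φ s)) ≤ n + 1)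
    (hne : evalMap F (κ.φ s) ≠ 0) {t : τ → ℂ}
    (ht : t ∈ zt (evalMap F '' S) (evalMap F (κ.φ s))) :
    ∃ e, t = jet₁ e (fun x => evalMap F (κ.φ x)) s := by
  obtain ⟨a, u, hu, rfl⟩ := hinv.exists_of_mem_zt hS hF (κ.mem s hs) hne ht
  obtain ⟨e, rfl⟩ := κ.exists_eq_jet₁_of_mem_zt hS hs hfin hu
  -- The factor `d` comes from Euler's identity, applied to the radial part of the jet.
  refine ⟨(a + e.1 * d, e.2), ?_⟩
  ext j
  simp only [jet₁, κ.dir_evalMap F hs, dd_add_right, dd_smul_right,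
    dd_self_of_isHomogeneous (hF j), Pi.add_apply, Pi.smul_apply, smul_eq_mul, evalMap]
  ring

end Chart

/-- Where `x a ≠ 0`, the cubics `x a * x a * x i` recover `x` up to the factor `x a ^ 2`. -/
lemma hasLocalInverse_veronese {S : Set (Fin (N + 1) → ℂ)} (hS : (0 : Fin (N + 1) → ℂ) ∉ S) :
    HasLocalInverse S (veronese N) := by
  intro v hv
  obtain ⟨a, ha⟩ := Function.ne_iff.1 (show v ≠ 0 by rintro rfl; exact hS hv)
  refine ⟨1, fun i => X (a, a, i), fun x => x a * x a, fun i => isHomogeneous_X ℂ _,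
    mul_ne_zero ha ha, fun x _ => ?_⟩
  ext i
  change eval _ (X (a, a, i)) = _
  rw [eval_X, evalMap_veronese, Pi.smul_apply, smul_eq_mul, mul_assoc]

/-- The linear forms that are the coordinates of a linear map. -/
def formsOfLinearMap {ι τ : Type*} [Fintype ι] [DecidableEq ι] (A : (ι → ℂ) →ₗ[ℂ] (τ → ℂ))
    (j : τ) : MvPolynomial ι ℂ := ∑ t, C (A (Pi.single t 1) j) * X t

lemma isHomogeneous_formsOfLinearMap {ι τ : Type*} [Fintype ι] [DecidableEq ι]
    (A : (ι → ℂ) →ₗ[ℂ] (τ → ℂ)) (j : τ) : (formsOfLinearMap A j).IsHomogeneous 1 :=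
  IsHomogeneous.sum _ _ _ fun _ _ => isHomogeneous_C_mul_X _ _

lemma evalMap_formsOfLinearMap {ι τ : Type*} [Fintype ι] [DecidableEq ι]
    (A : (ι → ℂ) →ₗ[ℂ] (τ → ℂ)) (w : ι → ℂ) : evalMap (formsOfLinearMap A) w = A w := by
  ext j
  conv_rhs => rw [pi_eq_sum_univ' w]
  simp [evalMap, formsOfLinearMap, mul_comm]

/-- Cubic forms on a smooth cone, with charts covering the cone, that embed it such that the doubles
of length two subschemes impose independent conditions. -/
structure GenericForms (S : Set (Fin (N + 1) → ℂ)) (n : ℕ) (τ : Type*)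
    [Fintype τ] where
  /-- the forms -/
  F : τ → Poly N
  /-- the charts -/
  charts : Set (Chart S n)
  isHomogeneous : ∀ j, (F j).IsHomogeneous 3
  ne_zero : ∀ v ∈ S, evalMap F v ≠ 0
  hasLocalInverse : HasLocalInverse S F
  covers : ∀ v ∈ S, ∃ κ ∈ charts, κ.Covers v
  eq_zero_of_pair : ∀ κ ∈ charts, ∀ κ' ∈ charts, ∀ s ∈ κ.dom, ∀ s' ∈ κ'.dom,
    (∀ a : ℂ, κ.φ s ≠ a • κ'.φ s') → (∀ a : ℂ, κ'.φ s' ≠ a • κ.φ s) → ∀ e e',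
    jet₁ e (fun x => evalMap F (κ.φ x)) s + jet₁ e' (fun x => evalMap F (κ'.φ x)) s' = 0 →
    e = 0 ∧ e' = 0
  eq_zero_of_tangent : ∀ κ ∈ charts, ∀ s ∈ κ.dom, ∀ u ≠ 0, ∀ e,
    jet u e (fun x => evalMap F (κ.φ x)) s = 0 → e = 0

lemma Chart.Covers.exists_eq {S : Set (Fin (N + 1) → ℂ)} {κ : Chart S n} {v : Fin (N + 1) → ℂ}
    (h : κ.Covers v) (hv : v ∈ S) : ∃ a : ℂ, a ≠ 0 ∧ ∃ s ∈ κ.dom, v = a • κ.φ s := by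
  have := h.self_of_nhdsWithin hv
  exact ⟨_, this.1, _, this.2.1, this.2.2⟩

lemma ne_smul_symm {V : Type*} [AddCommGroup V] [Module ℂ V] {v w : V}
    (h : ∀ a : ℂ, v ≠ a • w) (hw : w ≠ 0) (a : ℂ) : w ≠ a • v := by
  intro hwv
  have ha : a ≠ 0 := by
    rintro rfl
    exact hw (by rw [hwv, zero_smul])
  exact h a⁻¹ (by rw [hwv, inv_smul_smul₀ ha])

/-- The forms are the Veronese map followed by a linear map `A` that kills no nonzero vector of
`doubleSpans`. A vanishing jet of the forms is then a vanishing jet of all cubics, which forces its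
coefficients to vanish. -/
lemma exists_genericForms {X : Set (PSpace N)} (hX : IsSmoothProjectiveVariety n X) :
    Nonempty (GenericForms (cone X) n (Fin (4 * n + 2))) := by
  classical
  set S := cone X with hSdef
  have hS : IsClosedCone S := hX.algebraic.isClosedCone
  obtain ⟨𝒞, h𝒞, hcov⟩ := hX.smooth.exists_countable_charts
  obtain ⟨A, hA⟩ := exists_linearMap_of_dimH_le' (4 * n + 2) (doubleSpans 𝒞)
    smul_mem_doubleSpans (dimH_doubleSpans_le h𝒞)
  set F : Fin (4 * n + 2) → Poly N := fun j => bind₁ (veronese N) (formsOfLinearMap A j) with hF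
  have hFA : ∀ x, evalMap F x = A (evalMap (veronese N) x) := fun x => by
    rw [← evalMap_formsOfLinearMap A]
    ext j
    exact eval_bind₁ _ _ _
  have hFh : ∀ j, (F j).IsHomogeneous 3 := fun j =>
    (isHomogeneous_formsOfLinearMap A j).aeval _ isHomogeneous_veronese
  let Ac := LinearMap.toContinuousLinearMap A
  have hjet₁ : ∀ κ : Chart S n, ∀ s ∈ κ.dom, ∀ e, jet₁ e (fun x => evalMap F (κ.φ x)) s =
      A (jet₁ e (fun x => evalMap (veronese N) (κ.φ x)) s) := fun κ s hs e => by
    simp only [hFA]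
    exact jet₁_clm (κ.analyticAt_evalMap (veronese N) hs) Ac e
  have hjet : ∀ κ : Chart S n, ∀ s ∈ κ.dom, ∀ u e, jet u e (fun x => evalMap F (κ.φ x)) s =
      A (jet u e (fun x => evalMap (veronese N) (κ.φ x)) s) := fun κ s hs u e => by
    simp only [hFA]
    exact jet_clm (κ.analyticAt_evalMap (veronese N) hs) Ac u e
  have hpair : ∀ κ ∈ 𝒞, ∀ κ' ∈ 𝒞, ∀ s ∈ κ.dom, ∀ s' ∈ κ'.dom, ∀ e e',
      jet₁ e (fun x => evalMap F (κ.φ x)) s + jet₁ e' (fun x => evalMap F (κ'.φ x)) s' = 0 →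
      ∀ ξ₁ ξ₂ ξ₃ : (Fin (N + 1) → ℂ) →L[ℂ] ℂ,
      jet₁ e (fun x => ξ₁ (κ.φ x) * (ξ₂ (κ.φ x) * ξ₃ (κ.φ x))) s +
      jet₁ e' (fun x => ξ₁ (κ'.φ x) * (ξ₂ (κ'.φ x) * ξ₃ (κ'.φ x))) s' = 0 := by
    intro κ hκ κ' hκ' s hs s' hs' e e' h ξ₁ ξ₂ ξ₃
    obtain ⟨ℓ, hℓ⟩ := exists_clm_veronese ξ₁ ξ₂ ξ₃
    rw [hjet₁ κ s hs, hjet₁ κ' s' hs', ← map_add] at h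
    have h2 := hA _ (Or.inl (Set.mem_biUnion hκ (Set.mem_biUnion hκ'
      ⟨⟨⟨s, e⟩, s', e'⟩, ⟨⟨hs, trivial⟩, hs', trivial⟩, rfl⟩))) h
    have h3 := congrArg ℓ h2
    rw [map_zero, map_add, ← jet₁_clm (κ.analyticAt_evalMap (veronese N) hs) ℓ,
      ← jet₁_clm (κ'.analyticAt_evalMap (veronese N) hs') ℓ] at h3
    simpa only [hℓ] using h3
  have hK1 : ∀ κ ∈ 𝒞, ∀ κ' ∈ 𝒞, ∀ s ∈ κ.dom, ∀ s' ∈ κ'.dom,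
      (∀ a : ℂ, κ.φ s ≠ a • κ'.φ s') → (∀ a : ℂ, κ'.φ s' ≠ a • κ.φ s) → ∀ e e',
      jet₁ e (fun x => evalMap F (κ.φ x)) s + jet₁ e' (fun x => evalMap F (κ'.φ x)) s' = 0 →
      e = 0 ∧ e' = 0 := by
    intro κ hκ κ' hκ' s hs s' hs' hne hne' e e' h
    have h2 := hpair κ hκ κ' hκ' s hs s' hs' e e' h
    exact ⟨κ.eq_zero_of_jet₁_add_jet₁_eq_zero κ' hs hs' hne h2,
      κ'.eq_zero_of_jet₁_add_jet₁_eq_zero κ hs' hs hne'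
        fun ξ₁ ξ₂ ξ₃ => by rw [add_comm]; exact h2 ξ₁ ξ₂ ξ₃⟩
  -- A pair whose second coefficient is zero gives a statement at one point. Testing with `ξ * L *
  -- L`, where `L = 1` on the chart, reduces it to linear forms.
  have hK3 : ∀ κ ∈ 𝒞, ∀ s ∈ κ.dom, ∀ e,
      jet₁ e (fun x => evalMap F (κ.φ x)) s = 0 → e = 0 := by
    intro κ hκ s hs e h
    have h2 := hpair κ hκ κ hκ s hs s hs e 0 (by rw [h]; simp [jet₁, dir])
    refine κ.jet₁_injective hs (SeparatingDual.eq_zero_of_forall_dual_eq_zero (R := ℂ) fun ξ => ?_)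
    rw [← jet₁_clm (κ.analyticAt s hs) ξ, ← h2 κ.L κ.L ξ]
    have h3 : ∀ f : (Fin n → ℂ) → ℂ, jet₁ 0 f s = 0 := fun f => by simp [jet₁, dir]
    rw [h3, add_zero]
    refine jet₁_congr ?_ e
    filter_upwards [κ.isOpen_dom.mem_nhds hs] with x hx
    rw [κ.L_φ x hx, one_mul, one_mul]
  have hK2 : ∀ κ ∈ 𝒞, ∀ s ∈ κ.dom, ∀ u ≠ 0, ∀ e,
      jet u e (fun x => evalMap F (κ.φ x)) s = 0 → e = 0 := by
    intro κ hκ s hs u hu e h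
    rw [hjet κ s hs] at h
    have h2 := hA _ (Or.inr (Set.mem_biUnion hκ ⟨⟨s, u, e⟩, ⟨hs, trivial⟩, rfl⟩)) h
    refine κ.eq_zero_of_jet_eq_zero hs hu fun ξ₁ ξ₂ ξ₃ => ?_
    obtain ⟨ℓ, hℓ⟩ := exists_clm_veronese ξ₁ ξ₂ ξ₃
    have h3 := congrArg ℓ h2
    rw [map_zero, ← jet_clm (κ.analyticAt_evalMap (veronese N) hs) ℓ] at h3
    simpa only [hℓ] using h3
  have hne : ∀ v ∈ S, evalMap F v ≠ 0 := by
    intro v hv h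
    obtain ⟨κ, hκ, hκv⟩ := hcov v hv
    obtain ⟨a, ha, s, hs, rfl⟩ := hκv.exists_eq hv
    rw [evalMap_smul hFh, smul_eq_zero_iff_right (pow_ne_zero _ ha)] at h
    have := hK3 κ hκ s hs (1, 0) (by simp [jet₁, dir, h])
    simp at this
  have hver : ∀ v ∈ S, evalMap (veronese N) v ≠ 0 := fun v hv h =>
    hne v hv (by rw [hFA, h, map_zero])
  have hS' := hS.image (by norm_num) isHomogeneous_veronese hver
  -- The inverse is sought on the Veronese cone and not on `S`, because cubic forms identify
  -- multiples of a vector by cube roots of unity.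
  have hAinv : HasLocalInverse (evalMap (veronese N) '' S) (formsOfLinearMap A) := by
    refine hasLocalInverse_of_isHomogeneous_one hS' (isHomogeneous_formsOfLinearMap A) ?_ ?_ ?_
    · rintro _ ⟨v, hv, rfl⟩
      rw [evalMap_formsOfLinearMap, ← hFA]
      exact hne v hv
    · rintro _ ⟨v, hv, rfl⟩ _ ⟨w, hw, rfl⟩ h
      rw [evalMap_formsOfLinearMap, evalMap_formsOfLinearMap, ← hFA, ← hFA] at h
      obtain ⟨κ, hκ, hκv⟩ := hcov v hv
      obtain ⟨a, ha, s, hs, hvs⟩ := hκv.exists_eq hv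
      obtain ⟨κ', hκ', hκw⟩ := hcov w hw
      obtain ⟨a', ha', s', hs', hws⟩ := hκw.exists_eq hw
      by_cases hprop : ∃ b : ℂ, κ.φ s = b • κ'.φ s'
      · obtain ⟨b, hb⟩ := hprop
        obtain ⟨b', hb'⟩ : ∃ b' : ℂ, v = b' • w := ⟨a * b * a'⁻¹, by
          rw [hvs, hws, hb]; simp [smul_smul, ha']⟩
        rw [hb', evalMap_smul hFh, ← sub_eq_zero] at h
        have h2 : (b' ^ 3 - 1) • evalMap F w = 0 := by rw [sub_smul, one_smul, h]
        have h3 := (smul_eq_zero.1 h2).resolve_right (hne w hw)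
        rw [hb', evalMap_smul isHomogeneous_veronese, sub_eq_zero.1 h3, one_smul]
      · push Not at hprop
        have hφ0' : κ'.φ s' ≠ 0 := fun h0 => hS.zero_notMem (h0 ▸ κ'.mem s' hs')
        -- Equal images of independent vectors would be a relation between values at two points,
        -- with coefficients the cubes of the scaling factors.
        have h2 := hK1 κ hκ κ' hκ' s hs s' hs' hprop (ne_smul_symm hprop hφ0')
          (a ^ 3, 0) (-a' ^ 3, 0) (by
            rw [hvs, hws, evalMap_smul hFh, evalMap_smul hFh] at h
            simp [jet₁, dir, h])
        have h3 := congrArg Prod.fst h2.1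
        exact absurd h3 (pow_ne_zero _ ha)
    · rintro _ ⟨v, hv, rfl⟩ t ht hAt
      obtain ⟨κ, hκ, hκv⟩ := hcov v hv
      obtain ⟨a, ha, s, hs, hvs⟩ := hκv.exists_eq hv
      rw [hvs, evalMap_smul isHomogeneous_veronese, zt_smul hS'.smul_mem _ (pow_ne_zero _ ha)] at ht
      obtain ⟨e, rfl⟩ := κ.exists_eq_jet₁_of_mem_zt_image hS.smul_mem isHomogeneous_veronese
        (hasLocalInverse_veronese hS.zero_notMem) hs (hX.smooth.finrank_zt_le (κ.mem s hs))
        (hver _ (κ.mem s hs)) ht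
      rw [evalMap_formsOfLinearMap, ← hjet₁ κ s hs] at hAt
      rw [hK3 κ hκ s hs e hAt]
      simp [jet₁, dir]
  have hinv : HasLocalInverse S F := by
    intro v hv
    obtain ⟨d, G, c, hG, hc, hGc⟩ := hAinv _ ⟨v, hv, rfl⟩
    obtain ⟨a, ha⟩ := Function.ne_iff.1 (show v ≠ 0 from fun h => hS.zero_notMem (h ▸ hv))
    refine ⟨d, fun i => G (a, a, i), fun x => c (evalMap (veronese N) x) * (x a * x a),
      fun i => hG _, mul_ne_zero hc (mul_ne_zero ha ha), fun x hx => ?_⟩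
    ext i
    have := congrFun (hGc _ ⟨x, hx, rfl⟩) (a, a, i)
    rw [evalMap_formsOfLinearMap, ← hFA, Pi.smul_apply, smul_eq_mul, evalMap_veronese] at this
    refine this.trans ?_
    rw [Pi.smul_apply, smul_eq_mul]
    ring
  exact ⟨⟨F, 𝒞, hFh, hne, hinv, hcov, hK1, hK2⟩⟩

end SkewEmbedding

end

/-! ### The embedding into projective space and skewness -/

noncomputable section

namespace SkewEmbedding

variable {M K n : ℕ} {X : Set (PSpace M)}

namespace GenericForms

/-- The map to projective space given by the forms. -/
def map (Γ : GenericForms (cone X) n (Fin (K + 1))) (p : X) : PSpace K :=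
  Projectivization.mk ℂ (evalMap Γ.F p.1.rep) (Γ.ne_zero _ (rep_mem_cone.2 p.2))

variable (Γ : GenericForms (cone X) n (Fin (K + 1)))

lemma map_mk {v : Fin (M + 1) → ℂ} (hv : v ∈ cone X) :
    Γ.map ⟨Projectivization.mk ℂ v hv.1, hv.2⟩ =
      Projectivization.mk ℂ (evalMap Γ.F v) (Γ.ne_zero v hv) := by
  obtain ⟨a, -, h⟩ := exists_rep_eq_smul v hv.1
  refine mk_eq_mk_of_eq_smul _ _ (a := a ^ 3) ?_
  rw [← evalMap_smul Γ.isHomogeneous, ← h]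

/-- Every nonzero scalar is a cube, so the image of the cone is again closed under scaling. -/
lemma cone_range_map : cone (Set.range Γ.map) = evalMap Γ.F '' cone X := by
  ext w
  constructor
  · rintro ⟨hw, p, hp⟩
    obtain ⟨a, ha⟩ := (Projectivization.mk_eq_mk_iff' ℂ _ _ _ _).1 hp
    have ha0 : a ≠ 0 := by
      rintro rfl
      rw [zero_smul] at ha
      exact Γ.ne_zero _ (rep_mem_cone.2 p.2) ha.symm
    have h2 := smul_mem_image_evalMap smul_mem_cone (by norm_num) Γ.isHomogeneous
      _ ⟨p.1.rep, rep_mem_cone.2 p.2, rfl⟩ a⁻¹ (inv_ne_zero ha0)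
    rwa [← ha, inv_smul_smul₀ ha0] at h2
  · rintro ⟨v, hv, rfl⟩
    exact ⟨Γ.ne_zero v hv, ⟨_, hv.2⟩, Γ.map_mk hv⟩

lemma map_injective : Function.Injective Γ.map := by
  intro p p' h
  obtain ⟨a, ha⟩ := (Projectivization.mk_eq_mk_iff' ℂ _ _ _ _).1 h
  obtain ⟨e, G, c, hG, hc, hGc⟩ := Γ.hasLocalInverse _ (rep_mem_cone.2 p.2)
  have h2 := hGc _ (rep_mem_cone.2 p.2)
  rw [← ha, evalMap_smul hG, hGc _ (rep_mem_cone.2 p'.2), smul_smul] at h2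
  have h3 : p.1.rep = ((c p.1.rep)⁻¹ * (a ^ e * c p'.1.rep)) • p'.1.rep := by
    rw [mul_smul, h2, inv_smul_smul₀ hc]
  ext
  rw [← p.1.mk_rep, ← p'.1.mk_rep]
  exact mk_eq_mk_of_eq_smul _ _ h3

lemma isEmbedding_map (hX : IsAlgebraicSet X) : IsEmbeddingOfVarieties Γ.map := by
  refine ⟨fun p => ⟨3, Γ.F, Γ.isHomogeneous, Γ.ne_zero _ (rep_mem_cone.2 p.2), fun q hq => rfl⟩,
    ?_, ?_⟩
  · apply IsClosedCone.isAlgebraicSet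
    rw [cone_range_map]
    exact hX.isClosedCone.image (by norm_num) Γ.isHomogeneous Γ.ne_zero
  · choose g hg using fun y : Set.range Γ.map => y.2
    have hgmap : ∀ x, g ⟨Γ.map x, Set.mem_range_self x⟩ = x := fun x => Γ.map_injective (hg _)
    refine ⟨fun y => (g y).1, ?_, fun x => congrArg Subtype.val (hgmap x)⟩
    rintro ⟨_, p, rfl⟩
    obtain ⟨e, G, c, hG, hc, hGc⟩ := Γ.hasLocalInverse _ (rep_mem_cone.2 p.2)
    -- The forms `G` are evaluated at the chosen representative of `Γ.map q`; being homogeneous,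
    -- they still return a multiple of the representative of `q`.
    have hev : ∀ q : X, ∃ a : ℂ, a ≠ 0 ∧
        (fun i => evalAt (Γ.map q) (G i)) = (a * c q.1.rep) • q.1.rep := by
      intro q
      obtain ⟨a, ha, h⟩ := exists_rep_eq_smul (evalMap Γ.F q.1.rep)
        (Γ.ne_zero _ (rep_mem_cone.2 q.2))
      refine ⟨a ^ e, pow_ne_zero _ ha, ?_⟩
      rw [mul_smul, ← hGc _ (rep_mem_cone.2 q.2), ← evalMap_smul hG, ← h]
      rfl
    refine ⟨e, G, hG, ?_, ?_⟩
    · obtain ⟨a, ha, h⟩ := hev p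
      rw [h]
      exact smul_ne_zero (mul_ne_zero ha hc) p.1.rep_nonzero
    · rintro ⟨_, q, rfl⟩ hq
      obtain ⟨a, -, h⟩ := hev q
      change (g ⟨Γ.map q, _⟩).1 = _
      rw [hgmap, ← q.1.mk_rep]
      refine ((Projectivization.mk_eq_mk_iff' ℂ _ _ hq q.1.rep_nonzero).2 ⟨_, h.symm⟩).symm.trans ?_
      rfl

lemma exists_chart_of_mem {w : Fin (K + 1) → ℂ} (hw : w ∈ cone (Set.range Γ.map)) :
    ∃ κ ∈ Γ.charts, ∃ s ∈ κ.dom, ∃ a : ℂ, a ≠ 0 ∧ w = a • evalMap Γ.F (κ.φ s) := by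
  rw [cone_range_map] at hw
  obtain ⟨v, hv, rfl⟩ := hw
  obtain ⟨κ, hκ, hκv⟩ := Γ.covers v hv
  obtain ⟨a, ha, s, hs, rfl⟩ := hκv.exists_eq hv
  exact ⟨κ, hκ, s, hs, a ^ 3, pow_ne_zero _ ha, evalMap_smul Γ.isHomogeneous _ _⟩

lemma exists_eq_jet₁ (hX : IsSmoothOfDim n X) {κ : Chart (cone X) n} {s : Fin n → ℂ}
    (hs : s ∈ κ.dom) {a : ℂ} (ha : a ≠ 0) {t : Fin (K + 1) → ℂ}
    (ht : t ∈ zt (cone (Set.range Γ.map)) (a • evalMap Γ.F (κ.φ s))) :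
    ∃ e, t = jet₁ e (fun x => evalMap Γ.F (κ.φ x)) s := by
  rw [zt_smul smul_mem_cone _ ha, cone_range_map] at ht
  exact κ.exists_eq_jet₁_of_mem_zt_image smul_mem_cone Γ.isHomogeneous Γ.hasLocalInverse hs
    (hX.finrank_zt_le (κ.mem s hs)) (Γ.ne_zero _ (κ.mem s hs)) ht

lemma eq_zero_of_pair_of_ne {κ : Chart (cone X) n} (hκ : κ ∈ Γ.charts) {κ' : Chart (cone X) n}
    (hκ' : κ' ∈ Γ.charts) {s s' : Fin n → ℂ} (hs : s ∈ κ.dom) (hs' : s' ∈ κ'.dom)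
    (hne : ∀ a : ℂ, evalMap Γ.F (κ.φ s) ≠ a • evalMap Γ.F (κ'.φ s')) {e e' : ℂ × (Fin n → ℂ)}
    (h : jet₁ e (fun x => evalMap Γ.F (κ.φ x)) s + jet₁ e' (fun x => evalMap Γ.F (κ'.φ x)) s' = 0) :
    e = 0 ∧ e' = 0 := by
  have h1 : ∀ a : ℂ, κ.φ s ≠ a • κ'.φ s' := fun a ha =>
    hne (a ^ 3) (by rw [ha, evalMap_smul Γ.isHomogeneous])
  exact Γ.eq_zero_of_pair κ hκ κ' hκ' s hs s' hs' h1
    (ne_smul_symm h1 (ne_zero_of_mem_cone (κ'.mem s' hs'))) e e' h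

end GenericForms

lemma mem_embeddedTangentSpace_iff {Y : Set (PSpace K)} {p q : PSpace K} :
    q ∈ embeddedTangentSpace Y p ↔ q.rep ∈ zt (cone Y) p.rep := by
  rw [mem_zt_iff_isHomogeneous smul_mem_cone]
  refine forall₃_congr fun d F hF => ?_
  rw [forall_evalAt_eq_zero_iff hF]
  rfl

/-- A common point of two tangent spaces is a first order jet at both points. The difference of
these jets is zero, so their coefficients vanish and the point would have zero representative. -/
lemma GenericForms.isSkew (Γ : GenericForms (cone X) n (Fin (K + 1))) (hX : IsSmoothOfDim n X) :
    IsSkew (Set.range Γ.map) := by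
  intro x hx y hy hxy
  rw [Set.eq_empty_iff_forall_notMem]
  rintro q ⟨hqx, hqy⟩
  rw [mem_embeddedTangentSpace_iff] at hqx hqy
  obtain ⟨κ, hκ, s, hs, a, ha, hxs⟩ := Γ.exists_chart_of_mem (rep_mem_cone.2 hx)
  obtain ⟨κ', hκ', s', hs', a', ha', hys⟩ := Γ.exists_chart_of_mem (rep_mem_cone.2 hy)
  rw [hxs] at hqx
  rw [hys] at hqy
  obtain ⟨e, he⟩ := Γ.exists_eq_jet₁ hX hs ha hqx
  obtain ⟨e', he'⟩ := Γ.exists_eq_jet₁ hX hs' ha' hqy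
  have hne : ∀ b : ℂ, evalMap Γ.F (κ.φ s) ≠ b • evalMap Γ.F (κ'.φ s') := fun b hb => by
    apply hxy
    rw [← x.mk_rep, ← y.mk_rep]
    refine mk_eq_mk_of_eq_smul _ _ (a := a * b * a'⁻¹) ?_
    rw [hxs, hys, hb, smul_smul, smul_smul, mul_assoc _ a'⁻¹, inv_mul_cancel₀ ha', mul_one]
  have h0 := (Γ.eq_zero_of_pair_of_ne hκ hκ' hs hs' hne (e := e) (e' := (-1 : ℂ) • e') (by
    rw [jet₁_smul, ← he, ← he', neg_one_smul, add_neg_cancel])).1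
  apply q.rep_nonzero
  rw [he, h0]
  simp [jet₁, dir]

end SkewEmbedding

end

/-! ### Emptiness of the Terracini locus -/

noncomputable section

namespace SkewEmbedding

section Derivatives

variable {E F : Type*} [NormedAddCommGroup E] [NormedSpace ℂ E] [NormedAddCommGroup F]
  [NormedSpace ℂ F] [CompleteSpace F]

/-- Addition is a continuous linear map on the pair `(f, g)`, so `jet_clm` gives this without
expanding derivatives. -/
lemma jet_add {f g : E → F} {s : E} (hf : AnalyticAt ℂ f s) (hg : AnalyticAt ℂ g s) (u : E)
    (e : ℂ × E × E × ℂ) : jet u e (fun x => f x + g x) s = jet u e f s + jet u e g s := by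
  have h := hf.prod hg
  have h1 := jet_clm h (ContinuousLinearMap.fst ℂ F F) u e
  have h2 := jet_clm h (ContinuousLinearMap.snd ℂ F F) u e
  have h3 := jet_clm h (ContinuousLinearMap.fst ℂ F F + ContinuousLinearMap.snd ℂ F F) u e
  exact h3.trans (congrArg₂ (· + ·) h1.symm h2.symm)

lemma jet₁_add {f g : E → F} {s : E} (hf : AnalyticAt ℂ f s) (hg : AnalyticAt ℂ g s)
    (e : ℂ × E) : jet₁ e (fun x => f x + g x) s = jet₁ e f s + jet₁ e g s := by
  have h := hf.prod hg
  have h1 := jet₁_clm h (ContinuousLinearMap.fst ℂ F F) e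
  have h2 := jet₁_clm h (ContinuousLinearMap.snd ℂ F F) e
  have h3 := jet₁_clm h (ContinuousLinearMap.fst ℂ F F + ContinuousLinearMap.snd ℂ F F) e
  exact h3.trans (congrArg₂ (· + ·) h1.symm h2.symm)

end Derivatives

lemma dir_smul {E F : Type*} [NormedAddCommGroup E] [NormedSpace ℂ E] [NormedAddCommGroup F]
    [NormedSpace ℂ F] {k : E → ℂ} {f : E → F} {s : E} (hk : AnalyticAt ℂ k s) (hf : AnalyticAt ℂ f s)
    (u : E) : dir u (fun x => k x • f x) s = k s • dir u f s + dir u k s • f s := by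
  simp only [dir]
  rw [fderiv_fun_smul hk.differentiableAt hf.differentiableAt]
  rfl

/-- A length two subscheme of affine space consists of two points or is a tangent vector. -/
lemma exists_points_or_tangent {σ : Type*} [Fintype σ] {I : Ideal (MvPolynomial σ ℂ)}
    (hI : Module.finrank ℂ (MvPolynomial σ ℂ ⧸ I) = 2) :
    ∃ p : σ → ℂ, (∀ P ∈ I, eval p P = 0) ∧
      ((∃ q, q ≠ p ∧ ∀ P ∈ I, eval q P = 0) ∨ ∃ t, t ≠ 0 ∧ ∀ P ∈ I, dd P p t = 0) := by
  obtain ⟨p, hp⟩ : ∃ p : σ → ℂ, ∀ P ∈ I, eval p P = 0 := by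
    by_contra! h
    have h1 := eq_top_of_forall_exists_eval_ne_zero h
    have : Subsingleton (MvPolynomial σ ℂ ⧸ I) := Ideal.Quotient.subsingleton_iff.2 h1
    rw [Module.finrank_zero_of_subsingleton] at hI
    omega
  refine ⟨p, hp, ?_⟩
  by_contra! h
  -- Without a second point or a tangent vector, `I` would contain the maximal ideal of `p`, leaving
  -- colength at most one.
  have hle : pointIdeal p ≤ I := pointIdeal_le_of_unramified
    (fun P hP => mem_pointIdeal.2 (hp P hP))
    (fun x hx => by
      by_contra hxp
      obtain ⟨P, hP, hP'⟩ := h.1 x hxp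
      exact hP' (hx P hP))
    (fun t ht => by
      by_contra ht0
      obtain ⟨P, hP, hP'⟩ := h.2 t ht0
      exact hP' (ht P hP))
  have h1 : Module.finrank ℂ (MvPolynomial σ ℂ ⧸ I) ≤ 1 := by
    refine finrank_le_one (1 : MvPolynomial σ ℂ ⧸ I) fun b => ?_
    obtain ⟨P, rfl⟩ := Ideal.Quotient.mk_surjective b
    refine ⟨eval p P, ?_⟩
    have h2 : C (eval p P) - P ∈ I := hle (mem_pointIdeal.2 (by simp))
    rw [← Ideal.Quotient.eq] at h2
    rw [← h2]
    exact congrArg (Ideal.Quotient.mk I) (show eval p P • (1 : MvPolynomial σ ℂ) = _ by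
      rw [smul_eq_C_mul, mul_one])
  omega

/-- A linear form as a continuous linear map. -/
lemma exists_clm_of_isHomogeneous_one {σ : Type*} [Fintype σ] {P : MvPolynomial σ ℂ}
    (hP : P.IsHomogeneous 1) : ∃ ℓ : (σ → ℂ) →L[ℂ] ℂ, ∀ x, ℓ x = eval x P :=
  ⟨LinearMap.toContinuousLinearMap (ddLinear P 0), fun x => dd_of_isHomogeneous_one hP 0 x⟩

/-- Linear forms that vanish on a subspace. -/
lemma finrank_add_le_of_eval_eq_zero {K : ℕ} {V : Type*} [AddCommGroup V] [Module ℂ V]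
    [FiniteDimensional ℂ V]
    (τ : V →ₗ[ℂ] (Fin (K + 1) → ℂ)) (hτ : ∀ e, τ e = 0 → e = 0) (U : Submodule ℂ (Poly K))
    (hU : U ≤ linearForms K) (h : ∀ P ∈ U, ∀ e, eval (τ e) P = 0) :
    Module.finrank ℂ U + Module.finrank ℂ V ≤ Module.finrank ℂ (linearForms K) := by
  let δ : Poly K →ₗ[ℂ] Module.Dual ℂ (Fin (K + 1) → ℂ) :=
    { toFun := fun P => ddLinear P 0
      map_add' := fun P Q => by ext; simp
      map_smul' := fun c P => by ext; simp [← C_mul'] }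
  have hδ : ∀ P ∈ linearForms K, ∀ x, δ P x = eval x P := fun P hP x =>
    dd_of_isHomogeneous_one hP 0 x
  have hδ0 : ∀ P ∈ linearForms K, δ P = 0 → P = 0 := fun P hP h0 =>
    MvPolynomial.funext fun x => by rw [← hδ P hP, h0]; simp
  have hfin : FiniteDimensional ℂ (linearForms K) :=
    Module.Finite.iff_fg.2 (homogeneousSubmodule_fg _ _ _)
  have h1 : Module.finrank ℂ (Module.Dual ℂ (Fin (K + 1) → ℂ)) ≤
      Module.finrank ℂ (linearForms K) := by
    refine LinearMap.finrank_le_finrank_of_surjective (f := δ ∘ₗ (linearForms K).subtype) ?_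
    intro ξ
    refine ⟨⟨∑ i, C (ξ (Pi.single i 1)) * X i,
      IsHomogeneous.sum _ _ _ fun _ _ => isHomogeneous_C_mul_X _ _⟩, ?_⟩
    ext i
    simp [δ, Pi.single_apply]
  have hinj : Function.Injective τ := (injective_iff_map_eq_zero τ).2 hτ
  have h2 := Subspace.finrank_add_finrank_dualAnnihilator_eq (LinearMap.range τ)
  rw [Subspace.dual_finrank_eq] at h1
  rw [LinearMap.finrank_range_of_inj hinj] at h2
  -- Linear forms are dual vectors, and those in `U` annihilate the image of the injective map `τ`.
  have h3 : Module.finrank ℂ U ≤ Module.finrank ℂ (LinearMap.range τ).dualAnnihilator := by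
    let δU : U →ₗ[ℂ] (LinearMap.range τ).dualAnnihilator :=
      (δ ∘ₗ U.subtype).codRestrict _ fun P => by
        rw [Submodule.mem_dualAnnihilator]
        rintro _ ⟨e, rfl⟩
        exact (hδ _ (hU P.2) _).trans (h P P.2 e)
    refine LinearMap.finrank_le_finrank_of_injective (f := δU) ?_
    rw [injective_iff_map_eq_zero]
    intro P hP
    exact Subtype.ext (hδ0 _ (hU P.2) (congrArg Subtype.val hP))
  omega

variable {M K n : ℕ} {X : Set (PSpace M)}

namespace GenericForms

variable (Γ : GenericForms (cone X) n (Fin (K + 1)))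

/-- The parametrization of an affine piece of the image obtained by normalizing a chart. -/
lemma exists_normalization {κ : Chart (cone X) n} {s : Fin n → ℂ} (hs : s ∈ κ.dom) {h : Poly K}
    (hh : h.IsHomogeneous 1) {a : ℂ} {p : Fin (K + 1) → ℂ}
    (hp : p = a • evalMap Γ.F (κ.φ s)) (hhp : eval p h = 1) :
    ∃ (k : (Fin n → ℂ) → ℂ) (θ : (Fin n → ℂ) → (Fin (K + 1) → ℂ)), AnalyticAt ℂ k s ∧
      AnalyticAt ℂ θ s ∧ θ s = p ∧ k s ≠ 0 ∧ (∀ x, k x = eval (evalMap Γ.F (κ.φ x)) h) ∧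
      ∀ᶠ x in 𝓝 s, k x • θ x = evalMap Γ.F (κ.φ x) ∧
        θ x ∈ affinePiece (Set.range Γ.map) h := by
  have hΨ := κ.analyticAt_evalMap Γ.F hs
  let k : (Fin n → ℂ) → ℂ := fun x => eval (evalMap Γ.F (κ.φ x)) h
  have hk : AnalyticAt ℂ k s := (analyticAt_eval h _).comp hΨ
  have hak : a * k s = 1 := by
    rw [← hhp, hp, eval_smul_of_isHomogeneous hh, pow_one]
  have hks : k s ≠ 0 := right_ne_zero_of_mul_eq_one hak
  refine ⟨k, fun x => (k x)⁻¹ • evalMap Γ.F (κ.φ x), hk, (hk.inv hks).smul hΨ, ?_, hks,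
    fun x => rfl, ?_⟩
  · rw [hp, eq_inv_of_mul_eq_one_left hak]
  · filter_upwards [hk.continuousAt.eventually_ne hks, κ.isOpen_dom.mem_nhds hs] with x hx hxd
    refine ⟨smul_inv_smul₀ hx _, ?_, ?_⟩
    · rw [eval_smul_of_isHomogeneous hh, pow_one]
      exact inv_mul_cancel₀ hx
    · refine smul_mem_cone (X := Set.range Γ.map) _ ?_ _ (inv_ne_zero hx)
      rw [cone_range_map]
      exact ⟨_, κ.mem x hxd, rfl⟩

end GenericForms

lemma eq_zero_of_mem_sq_sup {R : Type*} [CommRing R] {I J : Ideal R} {Λ : R → ℂ}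
    (hadd : ∀ A B, Λ (A + B) = Λ A + Λ B) (hI : ∀ A ∈ I, ∀ B ∈ I, Λ (A * B) = 0)
    (hJ : ∀ A ∈ J, Λ A = 0) {P : R} (hP : P ∈ I ^ 2 ⊔ J) : Λ P = 0 := by
  obtain ⟨Q, hQ, A, hA, rfl⟩ := Submodule.mem_sup.1 hP
  rw [hadd, hJ A hA, add_zero]
  rw [pow_two] at hQ
  induction hQ using Submodule.mul_induction_on' with
  | mem_mul_mem A hA B hB => exact hI A hA B hB
  | add A _ B _ h1 h2 =>
    rw [hadd, h1 (add_mem (Submodule.mem_sup_left (by rwa [pow_two])) (Submodule.mem_sup_right hA)),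
      h2 (add_mem (Submodule.mem_sup_left (by rwa [pow_two])) (Submodule.mem_sup_right hA)),
      add_zero]

namespace GenericForms

variable (Γ : GenericForms (cone X) n (Fin (K + 1)))

/-- The vector `t` is carried to a direction `u` in a chart. The functionals `jet u e` form a space
of dimension `2n + 2`, embedded in `ℂ^(K+1)` by genericity, and they kill every linear form in the
square of the ideal. -/
lemma finrank_add_le_of_tangent {S : LengthTwoSubscheme (Set.range Γ.map)}
    (hX : IsSmoothOfDim n X) {p t : Fin (K + 1) → ℂ}
    (hpc : p ∈ cone (Set.range Γ.map)) (hph : eval p S.h = 1)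
    (hp : ∀ P ∈ S.ideal, eval p P = 0) (ht : t ≠ 0) (hpt : ∀ P ∈ S.ideal, dd P p t = 0) :
    Module.finrank ℂ (linearFormsVanishingOnDouble S) + (2 * n + 2) ≤
      Module.finrank ℂ (linearForms K) := by
  have hhS : S.h - 1 ∈ S.ideal := S.le_ideal (mem_vanishingIdeal.2 fun x hx => by simp [hx.1])
  have hht : eval t S.h = 0 := by
    have := hpt _ hhS
    rwa [dd_sub, ← C_1, dd_C, sub_zero, dd_of_isHomogeneous_one S.isHomogeneous_h] at this
  have htz : t ∈ zt (cone (Set.range Γ.map)) p := fun P hP =>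
    hpt P (S.le_ideal (mem_vanishingIdeal.2 fun x hx => mem_vanishingIdeal.1 hP x hx.2))
  obtain ⟨κ, hκ, s, hs, a, ha, hps⟩ := Γ.exists_chart_of_mem hpc
  rw [hps] at htz
  obtain ⟨⟨b, u⟩, hbu⟩ := Γ.exists_eq_jet₁ hX hs ha htz
  obtain ⟨k, θ, hk, hθ, hθs, hks, hkdef, hev⟩ := Γ.exists_normalization hs S.isHomogeneous_h hps hph
  have hΨ := κ.analyticAt_evalMap Γ.F hs
  have hkθ : k s • p = evalMap Γ.F (κ.φ s) := by rw [← hθs]; exact hev.self_of_nhds.1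
  obtain ⟨ℓ, hℓ⟩ := exists_clm_of_isHomogeneous_one S.isHomogeneous_h
  have hkℓ : k = fun x => ℓ (evalMap Γ.F (κ.φ x)) := by
    funext x; rw [hkdef, hℓ]
  -- As `t` is tangent to `h = 1`, differentiating `h` fixes the radial coefficient `b`. In the
  -- normalized parametrization `θ` the direction `u` then corresponds to `t / k(s)`.
  have hdk : dir u k s = -b * k s := by
    have h1 : dir u k s = ℓ (dir u (fun x => evalMap Γ.F (κ.φ x)) s) := by
      rw [hkℓ]; exact (dir_clm hΨ ℓ u).eq_of_nhds
    have h2 := congrArg ℓ hbu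
    rw [hℓ, hht, jet₁, map_add, map_smul, ← h1, hℓ, ← hkdef, smul_eq_mul] at h2
    linear_combination -h2
  have hdΨ : dir u (fun x => evalMap Γ.F (κ.φ x)) s = k s • dir u θ s + dir u k s • θ s := by
    rw [← dir_smul hk hθ]
    exact (dir_congr (hev.mono fun x hx => hx.1.symm) u).eq_of_nhds
  have hdθ : k s • dir u θ s = t := by
    rw [hbu, jet₁, hdΨ, hdk, hθs, ← hkθ]
    module
  have hu : u ≠ 0 := by
    rintro rfl
    apply ht
    rw [← hdθ]
    simp [dir]
  have hdP : ∀ P ∈ S.ideal, dd P (θ s) (dir u θ s) = 0 := fun P hP => by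
    have := hpt P hP
    rw [← hdθ, dd_smul_right] at this
    rw [hθs]
    exact (mul_eq_zero.1 this).resolve_left hks
  have han : ∀ Q : Poly K, AnalyticAt ℂ (fun x => eval (θ x) Q) s := fun Q =>
    (analyticAt_eval Q _).comp hθ
  have hdir : ∀ Q ∈ S.ideal, dir u (fun x => eval (θ x) Q) s = 0 := fun Q hQ => by
    rw [← hdP Q hQ]
    have := (hasFDerivAt_eval Q (θ s)).comp s hθ.differentiableAt.hasFDerivAt
    change fderiv ℂ ((fun x => eval x Q) ∘ θ) s u = _
    rw [this.fderiv]; rfl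
  have hval : ∀ Q ∈ S.ideal, eval (θ s) Q = 0 := fun Q hQ => by rw [hθs]; exact hp Q hQ
  have hfin := finrank_add_le_of_eval_eq_zero (jetLinear hΨ u)
    (fun e he => Γ.eq_zero_of_tangent κ hκ s hs u hu e he) (linearFormsVanishingOnDouble S)
    inf_le_left fun P hP e => by
      obtain ⟨hP1, hP2⟩ := hP
      obtain ⟨ℓP, hℓP⟩ := exists_clm_of_isHomogeneous_one hP1
      -- For a linear form, `k * (P ∘ θ)` is `P` along the unnormalized image. Elements of the ideal
      -- make sense only on the slice `h = 1`, hence the detour through `θ`.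
      have h1 : jet u e (fun x => k x * eval (θ x) P) s = 0 :=
        eq_zero_of_mem_sq_sup (Λ := fun P => jet u e (fun x => k x * eval (θ x) P) s)
          (fun A B => by
            simp only [map_add, mul_add]
            exact jet_add (hk.fun_mul (han A)) (hk.fun_mul (han B)) u e)
          (fun A hA B hB => by
            simp only [map_mul]
            exact jet_mul_mul_eq_zero hk (han A) (han B) (hval A hA) (hdir A hA) (hval B hB)
              (hdir B hB) e)
          (fun A hA => by
            have h2 : (fun x => k x * eval (θ x) A) =ᶠ[𝓝 s] fun _ => 0 :=
              hev.mono fun x hx => by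
                simp only [mem_vanishingIdeal.1 hA _ hx.2, mul_zero]
            rw [jet_congr h2]
            simp [jet, dir_const])
          hP2
      change eval (jet u e (fun x => evalMap Γ.F (κ.φ x)) s) P = 0
      rw [← hℓP, ← jet_clm hΨ ℓP, ← h1]
      refine jet_congr (hev.mono fun x hx => ?_) u e
      rw [← hx.1, hℓP, eval_smul_of_isHomogeneous hP1, pow_one]
  simp only [Module.finrank_prod, Module.finrank_fin_fun, Module.finrank_self] at hfin
  omega

lemma finrank_add_le_of_pair {S : LengthTwoSubscheme (Set.range Γ.map)}
    {p q : Fin (K + 1) → ℂ} (hpc : p ∈ cone (Set.range Γ.map)) (hph : eval p S.h = 1)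
    (hp : ∀ P ∈ S.ideal, eval p P = 0) (hqc : q ∈ cone (Set.range Γ.map)) (hqh : eval q S.h = 1)
    (hq : ∀ P ∈ S.ideal, eval q P = 0) (hpq : q ≠ p) :
    Module.finrank ℂ (linearFormsVanishingOnDouble S) + (2 * n + 2) ≤
      Module.finrank ℂ (linearForms K) := by
  have key : ∀ {p : Fin (K + 1) → ℂ}, p ∈ cone (Set.range Γ.map) → eval p S.h = 1 →
      (∀ P ∈ S.ideal, eval p P = 0) → ∃ κ ∈ Γ.charts, ∃ s ∈ κ.dom, ∃ a : ℂ, a ≠ 0 ∧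
        p = a • evalMap Γ.F (κ.φ s) ∧ ∀ P ∈ linearFormsVanishingOnDouble S, ∀ e,
          eval (jet₁ e (fun x => evalMap Γ.F (κ.φ x)) s) P = 0 := by
    intro p hpc hph hp
    obtain ⟨κ, hκ, s, hs, a, ha, hps⟩ := Γ.exists_chart_of_mem hpc
    refine ⟨κ, hκ, s, hs, a, ha, hps, fun P hP e => ?_⟩
    obtain ⟨k, θ, hk, hθ, hθs, -, -, hev⟩ := Γ.exists_normalization hs S.isHomogeneous_h hps hph
    have hΨ := κ.analyticAt_evalMap Γ.F hs
    have han : ∀ Q : Poly K, AnalyticAt ℂ (fun x => eval (θ x) Q) s := fun Q =>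
      (analyticAt_eval Q _).comp hθ
    have hval : ∀ Q ∈ S.ideal, eval (θ s) Q = 0 := fun Q hQ => by rw [hθs]; exact hp Q hQ
    obtain ⟨hP1, hP2⟩ := hP
    obtain ⟨ℓP, hℓP⟩ := exists_clm_of_isHomogeneous_one hP1
    have h1 : jet₁ e (fun x => k x * eval (θ x) P) s = 0 :=
      eq_zero_of_mem_sq_sup (Λ := fun P => jet₁ e (fun x => k x * eval (θ x) P) s)
        (fun A B => by
          simp only [map_add, mul_add]
          exact jet₁_add (hk.fun_mul (han A)) (hk.fun_mul (han B)) e)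
        (fun A hA B hB => by
          simp only [map_mul]
          exact jet₁_mul_mul_eq_zero hk (han A) (han B) (hval A hA) (hval B hB) e)
        (fun A hA => by
          have h2 : (fun x => k x * eval (θ x) A) =ᶠ[𝓝 s] fun _ => 0 :=
            hev.mono fun x hx => by
              simp only [mem_vanishingIdeal.1 hA _ hx.2, mul_zero]
          rw [jet₁_congr h2]
          simp [jet₁, dir_const])
        hP2
    rw [← hℓP, ← jet₁_clm hΨ ℓP, ← h1]
    refine jet₁_congr (hev.mono fun x hx => ?_) e
    rw [← hx.1, hℓP, eval_smul_of_isHomogeneous hP1, pow_one]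
  obtain ⟨κ, hκ, s, hs, a, ha, hps, hP⟩ := key hpc hph hp
  obtain ⟨κ', hκ', s', hs', a', ha', hqs, hP'⟩ := key hqc hqh hq
  have hne : ∀ b : ℂ, evalMap Γ.F (κ.φ s) ≠ b • evalMap Γ.F (κ'.φ s') := by
    intro b hb
    obtain ⟨c, hc⟩ : ∃ c : ℂ, p = c • q := ⟨a * b * a'⁻¹, by
      rw [hps, hqs, hb]; simp [smul_smul, ha']⟩
    rw [hc, eval_smul_of_isHomogeneous S.isHomogeneous_h, hqh, pow_one, mul_one] at hph
    exact hpq (by rw [hc, hph, one_smul])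
  have hfin := finrank_add_le_of_eval_eq_zero
    ((jetLinear₁ (fun x => evalMap Γ.F (κ.φ x)) s).coprod
      (jetLinear₁ (fun x => evalMap Γ.F (κ'.φ x)) s'))
    (fun e he => by
      have := Γ.eq_zero_of_pair_of_ne hκ hκ' hs hs' hne (e := e.1) (e' := e.2) he
      exact Prod.ext this.1 this.2)
    (linearFormsVanishingOnDouble S) inf_le_left fun P hPV e => by
      obtain ⟨ℓP, hℓP⟩ := exists_clm_of_isHomogeneous_one hPV.1
      rw [← hℓP, LinearMap.coprod_apply, map_add, hℓP, hℓP]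
      exact (congrArg₂ (· + ·) (hP P hPV e.1) (hP' P hPV e.2)).trans (add_zero 0)
  simp only [Module.finrank_prod, Module.finrank_fin_fun, Module.finrank_self] at hfin
  omega

lemma terraciniLocus_eq_empty (hX : IsSmoothProjectiveVariety n X) :
    terraciniLocus n (Set.range Γ.map) = ∅ := by
  rw [Set.eq_empty_iff_forall_notMem]
  intro S hS
  change Module.finrank ℂ (linearForms K) <
    Module.finrank ℂ (linearFormsVanishingOnDouble S) + (2 * n + 2) at hS
  refine absurd hS (not_lt.2 ?_)
  have hY : IsClosedCone (cone (Set.range Γ.map)) :=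
    (Γ.isEmbedding_map hX.algebraic).closed_range.isClosedCone
  -- The ideal contains `h - 1` and all equations of the cone, so its zeros lie on the cone and in
  -- the slice.
  have hmem : ∀ p, (∀ P ∈ S.ideal, eval p P = 0) →
      p ∈ cone (Set.range Γ.map) ∧ eval p S.h = 1 := by
    intro p hp
    have h1 : eval p S.h = 1 := by
      have := hp (S.h - 1) (S.le_ideal (mem_vanishingIdeal.2 fun x hx => by simp [hx.1]))
      rwa [map_sub, map_one, sub_eq_zero] at this
    have hp0 : p ≠ 0 := by
      rintro rfl
      rw [← zero_smul ℂ (0 : Fin (K + 1) → ℂ),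
        eval_smul_of_isHomogeneous S.isHomogeneous_h] at h1
      simp at h1
    exact ⟨hY.mem_of_vanishing p hp0 fun P hP =>
      hp P (S.le_ideal (mem_vanishingIdeal.2 fun x hx => mem_vanishingIdeal.1 hP x hx.2)), h1⟩
  obtain ⟨p, hp, ⟨q, hqp, hq⟩ | ⟨t, ht, hpt⟩⟩ := exists_points_or_tangent S.length_eq
  · exact Γ.finrank_add_le_of_pair (hmem p hp).1 (hmem p hp).2 hp (hmem q hq).1 (hmem q hq).2 hq hqp
  · exact Γ.finrank_add_le_of_tangent hX.smooth (hmem p hp).1 (hmem p hp).2 hp ht hpt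

end GenericForms

end SkewEmbedding

end

/-! ### Osculating planes of curves -/

noncomputable section

namespace SkewEmbedding

section Osculating

variable {F : Type*} [NormedAddCommGroup F] [NormedSpace ℂ F]

lemma deriv_smul_comp {G : (Fin 1 → ℂ) → F} {σ : ℂ → Fin 1 → ℂ} {a : ℂ → ℂ} {z : ℂ}
    (hG : AnalyticAt ℂ G (σ z)) (hσ : AnalyticAt ℂ σ z) (ha : AnalyticAt ℂ a z) :
    deriv (fun y => a y • G (σ y)) z =
      deriv a z • G (σ z) + (a z * deriv σ z 0) • dir 1 G (σ z) := by
  have h1 : HasDerivAt (fun y => G (σ y)) (fderiv ℂ G (σ z) (deriv σ z)) z :=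
    hG.differentiableAt.hasFDerivAt.comp_hasDerivAt z hσ.differentiableAt.hasDerivAt
  have h2 : deriv σ z = deriv σ z 0 • (1 : Fin 1 → ℂ) := by
    ext i; fin_cases i; simp
  rw [(ha.differentiableAt.hasDerivAt.fun_smul h1).deriv, mul_smul, add_comm]
  congr 2
  conv_lhs => rw [h2, map_smul]
  rfl

/-- The derivatives of a reparametrized and rescaled analytic curve are triangular in the
derivatives of the curve. -/
lemma exists_triangular [CompleteSpace F] {Ψ : (Fin 1 → ℂ) → F} {f : ℂ → F}
    {σ : ℂ → Fin 1 → ℂ} {μ : ℂ → ℂ}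
    (hΨ : AnalyticAt ℂ Ψ (σ 0)) (hσ : AnalyticAt ℂ σ 0) (hμ : AnalyticAt ℂ μ 0)
    (hf : f =ᶠ[𝓝 0] fun z => μ z • Ψ (σ z)) :
    ∃ (x b₀ b₁ b₂ c₀ c₁ c₂ : ℂ),
      deriv f 0 = b₀ • Ψ (σ 0) + (μ 0 * x) • dir 1 Ψ (σ 0) ∧
      iteratedDeriv 2 f 0 = b₁ • Ψ (σ 0) + b₂ • dir 1 Ψ (σ 0) +
        (μ 0 * x * x) • dir 1 (dir 1 Ψ) (σ 0) ∧
      iteratedDeriv 3 f 0 = c₀ • Ψ (σ 0) + c₁ • dir 1 Ψ (σ 0) + c₂ • dir 1 (dir 1 Ψ) (σ 0) +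
        (μ 0 * x * x * x) • dir 1 (dir 1 (dir 1 Ψ)) (σ 0) := by
  set x : ℂ → ℂ := fun z => deriv σ z 0 with hx
  have hxa : AnalyticAt ℂ x 0 :=
    ((ContinuousLinearMap.proj (R := ℂ) (φ := fun _ : Fin 1 => ℂ) 0).analyticAt _).comp hσ.deriv
  have hΨ₁ := analyticAt_dir hΨ 1
  have hΨ₂ := analyticAt_dir hΨ₁ 1
  have key : ∀ {G : (Fin 1 → ℂ) → F} {a : ℂ → ℂ}, AnalyticAt ℂ G (σ 0) → AnalyticAt ℂ a 0 →
      ∀ᶠ z in 𝓝 0, HasDerivAt (fun y => a y • G (σ y))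
        (deriv a z • G (σ z) + (a z * x z) • dir 1 G (σ z)) z := by
    intro G a hG ha
    filter_upwards [hσ.continuousAt.eventually hG.eventually_analyticAt,
      hσ.eventually_analyticAt, ha.eventually_analyticAt] with z h1 h2 h3
    rw [← deriv_smul_comp h1 h2 h3]
    exact (h3.fun_smul (h1.comp h2)).differentiableAt.hasDerivAt
  have hd1 : deriv f =ᶠ[𝓝 0] fun z => deriv μ z • Ψ (σ z) + (μ z * x z) • dir 1 Ψ (σ z) :=
    hf.deriv.trans ((key hΨ hμ).mono fun z h => h.deriv)
  have ha1 := hμ.deriv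
  have ha2 := hμ.fun_mul hxa
  have hd2 : deriv (deriv f) =ᶠ[𝓝 0] fun z => deriv (deriv μ) z • Ψ (σ z) +
      (deriv μ z * x z + deriv (fun z => μ z * x z) z) • dir 1 Ψ (σ z) +
      (μ z * x z * x z) • dir 1 (dir 1 Ψ) (σ z) := by
    refine hd1.deriv.trans ?_
    filter_upwards [key hΨ ha1, key hΨ₁ ha2] with z h1 h2
    rw [(h1.fun_add h2).deriv, add_smul]
    abel
  have hd3 := hd2.deriv.eq_of_nhds
  have ha3 := ((ha1.fun_mul hxa).fun_add ha2.deriv)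
  have ha4 := ha2.fun_mul hxa
  rw [(((key hΨ ha1.deriv).self_of_nhds.fun_add (key hΨ₁ ha3).self_of_nhds).fun_add
    (key hΨ₂ ha4).self_of_nhds).deriv] at hd3
  refine ⟨x 0, deriv μ 0, deriv (deriv μ) 0, deriv μ 0 * x 0 + deriv (fun z => μ z * x z) 0,
    deriv (deriv (deriv μ)) 0, deriv (deriv μ) 0 * x 0 +
    deriv (fun z => deriv μ z * x z + deriv (fun z => μ z * x z) z) 0,
    (deriv μ 0 * x 0 + deriv (fun z => μ z * x z) 0) * x 0 + deriv (fun z => μ z * x z * x z) 0,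
    hd1.eq_of_nhds, ?_, ?_⟩
  · rw [iteratedDeriv_succ, iteratedDeriv_one]
    exact hd2.eq_of_nhds
  · rw [iteratedDeriv_succ, iteratedDeriv_succ, iteratedDeriv_one]
    refine hd3.trans ?_
    simp only [add_smul]
    abel

lemma linearIndependent_osculating [CompleteSpace F] {Ψ : (Fin 1 → ℂ) → F} {f : ℂ → F}
    {σ : ℂ → Fin 1 → ℂ} {μ : ℂ → ℂ} (hΨ : AnalyticAt ℂ Ψ (σ 0)) (hσ : AnalyticAt ℂ σ 0) (hμ : AnalyticAt ℂ μ 0)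
    (hf : f =ᶠ[𝓝 0] fun z => μ z • Ψ (σ z)) (hli : LinearIndependent ℂ ![f 0, deriv f 0])
    (hjet : ∀ e, jet 1 e Ψ (σ 0) = 0 → e = 0) :
    LinearIndependent ℂ ![f 0, deriv f 0, iteratedDeriv 2 f 0, iteratedDeriv 3 f 0] := by
  obtain ⟨x, b₀, b₁, b₂, c₀, c₁, c₂, h1, h2, h3⟩ := exists_triangular hΨ hσ hμ hf
  have h0 := hf.eq_of_nhds
  have hindep : ∀ a b c d : ℂ, a • Ψ (σ 0) + b • dir 1 Ψ (σ 0) + c • dir 1 (dir 1 Ψ) (σ 0) +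
      d • dir 1 (dir 1 (dir 1 Ψ)) (σ 0) = 0 → a = 0 ∧ b = 0 ∧ c = 0 ∧ d = 0 := by
    intro a b c d h
    have := hjet (a, b • 1, c • 1, d) (by
      rw [← h]
      simp only [jet, dir_dir_smul hΨ]
      simp only [dir, map_smul])
    simpa using this
  have hμ0 : μ 0 ≠ 0 := by
    intro h
    refine hli.ne_zero 0 ?_
    change f 0 = 0
    rw [h0]; simp [h]
  -- `x` is the speed of the reparametrization: if it were zero, `f'(0)` would be a multiple of
  -- `f(0)`. With `μ 0 ≠ 0`, the triangular matrix with diagonal `μ`, `μ x`, `μ x²`, `μ x³` is then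
  -- invertible.
  have hx : x ≠ 0 := by
    rintro rfl
    have := (LinearIndependent.pair_iff.1 hli) b₀ (-μ 0) (by
      rw [h0, h1, smul_smul, mul_zero, zero_smul, add_zero, smul_smul, ← add_smul]
      simp [mul_comm])
    exact hμ0 (neg_eq_zero.1 this.2)
  rw [Fintype.linearIndependent_iff]
  intro g hg
  simp only [Fin.sum_univ_four, Matrix.cons_val] at hg
  rw [h0, h1, h2, h3] at hg
  obtain ⟨e0, e1, e2, e3⟩ := hindep (g 0 * μ 0 + g 1 * b₀ + g 2 * b₁ + g 3 * c₀)
    (g 1 * (μ 0 * x) + g 2 * b₂ + g 3 * c₁) (g 2 * (μ 0 * x * x) + g 3 * c₂)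
    (g 3 * (μ 0 * x * x * x)) (by rw [← hg]; module)
  have g3 : g 3 = 0 := by simpa [hμ0, hx] using e3
  have g2 : g 2 = 0 := by simpa [hμ0, hx, g3] using e2
  have g1 : g 1 = 0 := by simpa [hμ0, hx, g3, g2] using e1
  have g0 : g 0 = 0 := by simpa [hμ0, hx, g3, g2, g1] using e0
  intro i
  fin_cases i <;> assumption

end Osculating

/-- A local lifting of a curve in the image factors through a chart. -/
lemma GenericForms.exists_factorization {M K n : ℕ} {X : Set (PSpace M)}
    (Γ : GenericForms (cone X) n (Fin (K + 1))) {f : ℂ → Fin (K + 1) → ℂ} (hf : AnalyticAt ℂ f 0)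
    (hfY : ∀ᶠ z in 𝓝 (0 : ℂ), f z ∈ cone (Set.range Γ.map)) :
    ∃ κ ∈ Γ.charts, ∃ (σ : ℂ → Fin n → ℂ) (μ : ℂ → ℂ), AnalyticAt ℂ σ 0 ∧ AnalyticAt ℂ μ 0 ∧
      σ 0 ∈ κ.dom ∧ f =ᶠ[𝓝 0] fun z => μ z • evalMap Γ.F (κ.φ (σ z)) := by
  rw [Γ.cone_range_map] at hfY
  obtain ⟨v, hv, hv0⟩ := hfY.self_of_nhds
  have hf0 : f 0 ≠ 0 := by rw [← hv0]; exact Γ.ne_zero v hv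
  obtain ⟨e, G, c, hG, hc, hGF⟩ := Γ.hasLocalInverse v hv
  -- The local inverse transports the curve analytically to the cone over `X`, where a chart gives
  -- its coordinate.
  set γ : ℂ → Fin (M + 1) → ℂ := fun z => evalMap G (f z) with hγ
  have hγa : AnalyticAt ℂ γ 0 := (analyticAt_evalMap G _).comp hf
  have hγ0 : γ 0 = c v • v := by rw [hγ, ← hGF v hv, hv0]
  have hγS : γ 0 ∈ cone X := by rw [hγ0]; exact smul_mem_cone v hv _ hc
  have hev : ∀ᶠ z in 𝓝 (0 : ℂ), γ z ∈ cone X ∧ ∃ a : ℂ, f z = a • evalMap Γ.F (γ z) := by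
    filter_upwards [hfY, hγa.continuousAt.eventually_ne hγS.1] with z hz hne
    obtain ⟨w, hw, hwz⟩ := hz
    have h1 : γ z = c w • w := by rw [hγ, ← hGF w hw, hwz]
    have hcw : c w ≠ 0 := by
      intro h
      rw [h, zero_smul] at h1
      exact hne h1
    refine ⟨by rw [h1]; exact smul_mem_cone w hw _ hcw, (c w ^ 3)⁻¹, ?_⟩
    rw [h1, evalMap_smul Γ.isHomogeneous, inv_smul_smul₀ (pow_ne_zero _ hcw), hwz]
  obtain ⟨κ, hκ, hcov⟩ := Γ.covers _ hγS
  have hcov' : ∀ᶠ z in 𝓝 (0 : ℂ), κ.L (γ z) ≠ 0 ∧ κ.coord (γ z) ∈ κ.dom ∧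
      γ z = κ.L (γ z) • κ.φ (κ.coord (γ z)) :=
    (tendsto_nhdsWithin_iff.2 ⟨hγa.continuousAt, hev.mono fun z hz => hz.1⟩).eventually hcov
  obtain ⟨hL, hdom, -⟩ := hcov'.self_of_nhds
  have hLa : AnalyticAt ℂ (fun z => κ.L (γ z)) 0 := (κ.L.analyticAt _).comp hγa
  have hσa : AnalyticAt ℂ (fun z => κ.coord (γ z)) 0 :=
    (hLa.inv hL).smul ((κ.π.analyticAt _).comp hγa)
  have hΨ : AnalyticAt ℂ (fun z => evalMap Γ.F (κ.φ (κ.coord (γ z)))) 0 :=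
    (κ.analyticAt_evalMap Γ.F hdom).comp (g := fun x => evalMap Γ.F (κ.φ x))
      (f := fun z => κ.coord (γ z)) hσa
  have hprop : ∀ᶠ z in 𝓝 (0 : ℂ), ∃ a : ℂ, f z = a • evalMap Γ.F (κ.φ (κ.coord (γ z))) := by
    filter_upwards [hev, hcov'] with z hz hz'
    obtain ⟨-, a, ha⟩ := hz
    refine ⟨a * κ.L (γ z) ^ 3, ?_⟩
    rw [mul_smul, ← evalMap_smul Γ.isHomogeneous, ← hz'.2.2, ha]
  -- So far the factor of proportionality is only pointwise; a functional nonzero at `f 0` writes it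
  -- as a quotient of analytic functions.
  obtain ⟨ℓ, hℓ⟩ := SeparatingDual.exists_eq_one (R := ℂ) hf0
  have hℓf : AnalyticAt ℂ (fun z => ℓ (f z)) 0 := (ℓ.analyticAt _).comp hf
  have hℓΨ : AnalyticAt ℂ (fun z => ℓ (evalMap Γ.F (κ.φ (κ.coord (γ z))))) 0 :=
    (ℓ.analyticAt _).comp hΨ
  have hmul : ∀ᶠ z in 𝓝 (0 : ℂ), ℓ (evalMap Γ.F (κ.φ (κ.coord (γ z)))) ≠ 0 ∧
      f z = (ℓ (f z) * (ℓ (evalMap Γ.F (κ.φ (κ.coord (γ z)))))⁻¹) •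
        evalMap Γ.F (κ.φ (κ.coord (γ z))) := by
    filter_upwards [hprop, hℓf.continuousAt.eventually_ne (by rw [hℓ]; exact one_ne_zero)]
      with z ⟨a, ha⟩ hz
    have h1 : ℓ (f z) = a * ℓ (evalMap Γ.F (κ.φ (κ.coord (γ z)))) := by
      rw [ha, map_smul, smul_eq_mul]
    have h2 := right_ne_zero_of_mul (h1 ▸ hz)
    refine ⟨h2, ?_⟩
    rw [h1, mul_inv_cancel_right₀ h2, ha]
  exact ⟨κ, hκ, _, _, hσa, hℓf.fun_mul (hℓΨ.inv hmul.self_of_nhds.1), hdom,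
    hmul.mono fun z hz => hz.2⟩

lemma GenericForms.hasNondegenerateOsculatingPlanes {M K : ℕ} {X : Set (PSpace M)}
    (Γ : GenericForms (cone X) 1 (Fin (K + 1))) :
    HasNondegenerateOsculatingPlanes (Set.range Γ.map) := by
  intro f hf hfY hli
  obtain ⟨κ, hκ, σ, μ, hσ, hμ, hdom, hfac⟩ := Γ.exists_factorization hf hfY
  exact linearIndependent_osculating (κ.analyticAt_evalMap Γ.F hdom) hσ hμ hfac hli
    (Γ.eq_zero_of_tangent κ hκ _ hdom 1 one_ne_zero)

end SkewEmbedding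

end

/-! ### The theorem -/

theorem mainTheorem6 (n M : ℕ) (X : Set (SkewEmbedding.PSpace M))
    (hX : SkewEmbedding.IsSmoothProjectiveVariety n X) :
    SkewEmbedding.HasAlgebraicallySkewEmbedding n X (4 * n + 1) ∧
      SkewEmbedding.msdim n X ≤ 4 * n + 1 := by
  obtain ⟨Γ⟩ := SkewEmbedding.exists_genericForms hX
  have h : SkewEmbedding.HasAlgebraicallySkewEmbedding n X (4 * n + 1) :=
    ⟨Γ.map (K := 4 * n + 1), Γ.isEmbedding_map hX.algebraic, Γ.isSkew hX.smooth,
      Γ.terraciniLocus_eq_empty hX, fun hn => by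
        subst hn
        exact Γ.hasNondegenerateOsculatingPlanes⟩
  exact ⟨h, Nat.sInf_le h⟩
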